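/- For $n\ge 1$ let $G_n$ be the $n\times n$ grid graph, whose vertices are numbered row by row (so horizontal neighbours have numbers differing by $1$ and vertical neighbours by $n$). The edges of $G_n$ carry independent random weights, each equal to $1$ or $1+\Delta$ with probability $\tfrac12$, where $\Delta>0$. The greedy algorithm proceeds in iterations: in each iteration every unmatched vertex that has an unmatched neighbour proposes to the unmatched neighbour joined to it by an edge of maximum weight, ties being resolved in favour of the neighbour with the smallest number; two vertices that propose to each other are matched and removed. Iterations are repeated until nothing more can be matched. For a weight vector $W$ let $\hat f(G_n,W)$ be the total weight of the matching so obtained and $f^\star(G_n,W)$ the maximum total weight of a matching of $G_n$, and let $$PR(G_n)=\frac{\mathbb E_W[\hat f(G_n,W)]}{\mathbb E_W[f^\star(G_n,W)]}$$ be the average performance ratio (for $n\ge 2$). Then for every $\Delta>0$ the limit $\lim_{n\to\infty}PR(G_n)$ exists and $$\lim_{n\to\infty}PR(G_n)\;\ge\; B(\Delta):=\frac{0.9213+0.6967\,\Delta}{1+0.9375\,\Delta}.$$ The bound $B$ is strictly decreasing on $(0,\infty)$; its limit as $\Delta\to0^+$ is $92.1\%$ and its limit as $\Delta\to\infty$ is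 $74.3\%$, both up to rounding (error at most $0.05$ percentage points). -/

import Mathlib

open Filter Topology MeasureTheory

noncomputable section

namespace GreedyMatching

section Algorithm

variable {V : Type*} (G : SimpleGraph V)

/-- The weight of the edge joining `u` and `v`, for weights `W` on the edges of `G`
(the value `0` for non-adjacent pairs is never used). -/
def pairWeight (W : G.edgeSet → ℝ) (u v : V) : ℝ :=
  open Classical in if h : G.Adj u v then W ⟨s(u, v), h⟩ else 0

/-- Proposal phase. When `S` is the set of unmatched users, `u` proposes to `v`: among the unmatched
neighbours of `u`, the edge to `v` has the maximum weight, and `v` has the smallest index among the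
unmatched neighbours of `u` that attain this maximum. -/
def Proposes (idx : V ↪ ℕ) (W : G.edgeSet → ℝ) (S : Set V) (u v : V) : Prop :=
  (v ∈ S ∧ G.Adj u v) ∧
    ∀ k ∈ S, G.Adj u k → k ≠ v →
      pairWeight G W u k < pairWeight G W u v ∨
        (pairWeight G W u k = pairWeight G W u v ∧ idx v < idx k)

/-- Matching phase: `u` and `v` are unmatched and propose to each other. -/
def MutualProposal (idx : V ↪ ℕ) (W : G.edgeSet → ℝ) (S : Set V) (u v : V) : Prop :=
  u ∈ S ∧ v ∈ S ∧ Proposes G idx W S u v ∧ Proposes G idx W S v u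

/-- The set of users that are still unmatched after `t` iterations of the greedy algorithm. -/
def unmatched (idx : V ↪ ℕ) (W : G.edgeSet → ℝ) : ℕ → Set V
  | 0 => Set.univ
  | t + 1 => {u | u ∈ unmatched idx W t ∧ ¬ ∃ v, MutualProposal G idx W (unmatched idx W t) u v}

/-- The greedy matching: all edges that are matched in some iteration. -/
def greedyMatching (idx : V ↪ ℕ) (W : G.edgeSet → ℝ) : Set G.edgeSet :=
  {e | ∃ t u v, (e : Sym2 V) = s(u, v) ∧ MutualProposal G idx W (unmatched G idx W t) u v}

/-- `M` is a matching: every user belongs to at most one edge of `M`. -/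
def IsMatching (M : Set G.edgeSet) : Prop :=
  ∀ e ∈ M, ∀ f ∈ M, ∀ u : V, u ∈ (e : Sym2 V) → u ∈ (f : Sym2 V) → e = f

variable [Fintype V]

/-- The total weight of a set `M` of edges. -/
def totalWeight (W : G.edgeSet → ℝ) (M : Set G.edgeSet) : ℝ :=
  open Classical in ∑ e : G.edgeSet, if e ∈ M then W e else 0

/-- The total weight of the greedy matching. -/
def greedyValue (idx : V ↪ ℕ) (W : G.edgeSet → ℝ) : ℝ :=
  totalWeight G W (greedyMatching G idx W)

/-- The maximum total weight of a matching. -/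
def optimalValue (W : G.edgeSet → ℝ) : ℝ :=
  ⨆ M : {M : Set G.edgeSet // IsMatching G M}, totalWeight G W M

/-- The law of a family, indexed by the edges of `G`, of independent random variables with
distribution `p`. -/
def edgeLaw {K : ℕ} (p : PMF (Fin K)) : Measure (G.edgeSet → Fin K) :=
  open Classical in Measure.pi fun _ : G.edgeSet => p.toMeasure

/-- The average performance ratio of the greedy algorithm on `G`: expected total weight of the
greedy matching over expected total weight of the optimal matching, when the edge weights are
independent and each of them equals `v k` with probability `p k`. -/
def performanceRatio (idx : V ↪ ℕ) {K : ℕ} (v : Fin K → ℝ) (p : PMF (Fin K)) : ℝ :=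
  (∫ c, greedyValue G idx (fun e => v (c e)) ∂(edgeLaw G p)) /
    (∫ c, optimalValue G (fun e => v (c e)) ∂(edgeLaw G p))

end Algorithm

/-- The `n × n` grid; the vertex `(i, j)` lies in row `i` and column `j`. -/
def grid (n : ℕ) : SimpleGraph (Fin n × Fin n) :=
  (SimpleGraph.pathGraph n).boxProd (SimpleGraph.pathGraph n)

/-- The row-by-row numbering of the vertices of the grid: `(i, j)` gets the number `j + n * i`, so
that horizontal neighbours differ by `1` and vertical neighbours by `n`. -/
def gridIndex (n : ℕ) : Fin n × Fin n ↪ ℕ :=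
  finProdFinEquiv.toEmbedding.trans Fin.valEmbedding

/-- The average performance ratio of the greedy algorithm on the `n × n` grid with independent
weights that are `1` or `1 + Δ` with probability `1 / 2` each. -/
def gridRatio (Δ : ℝ) (n : ℕ) : ℝ :=
  performanceRatio (grid n) (gridIndex n) ![1, 1 + Δ] (PMF.uniformOfFintype (Fin 2))

/-- The lower bound for the limiting average performance ratio. -/
def gridBound (Δ : ℝ) : ℝ := (0.9213 + 0.6967 * Δ) / (1 + 0.9375 * Δ)

end GreedyMatching

end

/-! At each vertex the preferences order the edges by the key (minus weight, sum of the two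
numbers). Hence the greedy matching is stable (`isStable_greedyPartner`), and it is what results
from offering the edges one by one in the order of increasing key (`freeVertices_insert`). A
matching weighs half of (covered vertices + Δ · vertices covered through heavy edges), so the bound
reduces to three densities.

Optimum: at most every vertex is covered, and a vertex whose edges are all light, an event of
probability at least 1/16, is not covered heavily. Hence the mean is at most n²/2 · (1 + 15/16 Δ)
(`coinMean_optimalValue_le`).

Greedy: each cell of the grid prefers heavy edges to light ones, and then up, left, right, down. The
matching thus obeys a local recursion (`Sweep`) in which every cell, and every offer of a cell to
the one below, has one of three states. A cell stays unmatched only if it waits for the cell below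
and that cell gets matched through a heavy edge. The state of the cell (r, x) depends only on coins
with column + 2 · row at most x + 2r (`Sweep.dependence`). So when three consecutive rows are swept
together, each lagging two columns behind the one above, every step meets six coins that are
independent of the current states.

The law of these states is never computed. It is bounded by a dual certificate: a potential φ on the
states of three rows and a potential g on two rows and the vertex entering from above, such that in
each of the 3^7 states, averaged over the six coins, cost + new φ + g one row lower is at most φ + g
+ a constant (`bandCheck`). In the sum over all steps φ telescopes along the rows and g across the
rows (`telescope`), so the constant bounds the density of the cost up to a boundary term of order n.
For unmatched vertices the constant is 1793/(64 · 356) < 1 - 0.9213; for vertices not matched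
heavily it is 1/4 < 1 - 0.6967.

Existence of the limit: deleting vertices from a graph changes the set of free vertices in at most
as many places as vertices were deleted (`card_symmDiff_freeVertices_le`). Cutting the grid into
separated m × m blocks therefore changes both values only by a multiple of the number of deleted
vertices, and a function that is almost additive over blocks has a density
(`exists_tendsto_div_sq`). -/

noncomputable section

namespace GreedyMatching

/-! ### Local rules of the sweep and the numerical certificates -/

/-- The state of a vertex after the heavy horizontal edges of its row have been matched: `matched`
through a heavy edge from above or in its row, otherwise `claimed` or `free` according to whether
the vertex above still waits for it. -/
inductive VertexState
  | matched
  | free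
  | claimed
  deriving DecidableEq

/-- What a vertex offers to the vertex below: nothing, a heavy edge, or (so far) a light edge. -/
inductive Offer
  | idle
  | heavy
  | pending
  deriving DecidableEq

namespace VertexState

/-- The base-three digit of a vertex state. -/
def code : VertexState → ℕ
  | matched => 0
  | free => 1
  | claimed => 2

/-- All vertex states satisfy a Boolean predicate. -/
def all (p : VertexState → Bool) : Bool := p matched && p free && p claimed

theorem of_all {p : VertexState → Bool} (h : all p = true) (x : VertexState) : p x = true := by
  simp only [all, Bool.and_eq_true] at h
  cases x <;> tauto

end VertexState

namespace Offer

/-- The base-three digit of an offer. -/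
def code : Offer → ℕ
  | idle => 0
  | heavy => 1
  | pending => 2

/-- All offers satisfy a Boolean predicate. -/
def all (p : Offer → Bool) : Bool := p idle && p heavy && p pending

theorem of_all {p : Offer → Bool} (h : all p = true) (x : Offer) : p x = true := by
  simp only [all, Bool.and_eq_true] at h
  cases x <;> tauto

end Offer

/-- Reading the next vertex of a row together with the coin of the edge below it settles the offer
of the previous vertex and produces the provisional offer of the new one. -/
def reveal (e : Offer) (x : VertexState) (d : Bool) : Offer × Offer :=
  match x, d with
  | .matched, _ => (e, .idle)
  | .free, true => (e, .heavy)
  | .claimed, true => (e, .heavy)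
  | .claimed, false => (e, .idle)
  | .free, false => match e with
    | .pending => (.idle, .idle)
    | .idle => (.idle, .pending)
    | .heavy => (.heavy, .pending)

/-- Placing the next vertex of a row below a vertex with offer `e`, when the previous vertex of the
row is in the provisional state `t` and `h` is the coin of the edge between them: the final state of
the previous vertex and the provisional state of the new one. -/
def place (t : VertexState) (e : Offer) (h : Bool) : VertexState × VertexState :=
  match e, t, h with
  | .heavy, t, _ => (t, .matched)
  | .idle, .free, true => (.matched, .matched)
  | .idle, .claimed, true => (.matched, .matched)
  | .pending, .free, true => (.matched, .matched)
  | .pending, .claimed, true => (.matched, .matched)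
  | .idle, t, _ => (t, .free)
  | .pending, t, _ => (t, .claimed)

/-- One step of the sweep of a row: the final state of a vertex, the provisional state of the next
one, and the provisional offer made to the one after that. -/
def rowStep (t : VertexState) (e : Offer) (x : VertexState) (d h : Bool) :
    VertexState × VertexState × Offer :=
  let p := place t (reveal e x d).1 h
  (p.1, p.2, (reveal e x d).2)

/-- Evaluation of a function at a vertex state, by cases. -/
def VertexState.eval (x : VertexState) (k : VertexState → ℕ) : ℕ :=
  match x with
  | .matched => k .matched
  | .free => k .free
  | .claimed => k .claimed

/-- Evaluation of a function at an offer, by cases. -/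
def Offer.eval (x : Offer) (k : Offer → ℕ) : ℕ :=
  match x with
  | .idle => k .idle
  | .heavy => k .heavy
  | .pending => k .pending

/-- The value of a function at the outcome of a step of the sweep of a row. -/
def rowStepThen (t : VertexState) (e : Offer) (x : VertexState) (d h : Bool)
    (k : VertexState → VertexState → Offer → ℕ) : ℕ :=
  (rowStep t e x d h).1.eval fun y => (rowStep t e x d h).2.1.eval fun u =>
    (rowStep t e x d h).2.2.eval fun f => k y u f

/-- The case analysis in `rowStepThen` brings each outcome to a constructor before the continuation
uses it, which suits evaluation of `bandCheck`. The probabilistic argument needs only plain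
substitution. -/
theorem rowStepThen_eq (t : VertexState) (e : Offer) (x : VertexState) (d h : Bool)
    (k : VertexState → VertexState → Offer → ℕ) :
    rowStepThen t e x d h k =
      k (rowStep t e x d h).1 (rowStep t e x d h).2.1 (rowStep t e x d h).2.2 := by
  unfold rowStepThen VertexState.eval Offer.eval
  cases (rowStep t e x d h).1 <;> cases (rowStep t e x d h).2.1 <;>
    cases (rowStep t e x d h).2.2 <;> rfl

/-- The number of light-matchable vertices that a step of the sweep leaves unmatched. -/
def lossCount (t : VertexState) (e : Offer) (x : VertexState) (d h : Bool) : ℕ :=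
  (match x, d with
    | .claimed, true => 1
    | _, _ => 0) +
  (match (reveal e x d).1, t, h with
    | .idle, .claimed, true => 1
    | .pending, .free, true => 1
    | .pending, .claimed, true => 2
    | _, _, _ => 0)

/-- The number of vertices that a step of the sweep finds unmatched through heavy edges. -/
def lightCount (_ : VertexState) (_ : Offer) (x : VertexState) (d _ : Bool) : ℕ :=
  match x, d with
  | .free, false => 1
  | .claimed, false => 1
  | _, _ => 0

/-- The sum of a function over the two values of a coin. -/
def coinSum (f : Bool → ℕ) : ℕ := f false + f true

/-- A potential on the states of three consecutive rows. -/
abbrev BandPotential :=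
  VertexState → Offer → VertexState → Offer → VertexState → Offer → ℕ

/-- A potential on the states of two consecutive rows and of the vertex that enters from above. -/
abbrev LinkPotential := VertexState → VertexState → Offer → VertexState → Offer → ℕ

/-- The inequality, summed over the six fresh coins of a step of a band of three rows, that
certifies the bound `C / (64 * S)` for the mean of `cost`. -/
def BandInequality (cost : VertexState → Offer → VertexState → Bool → Bool → ℕ) (S C : ℕ)
    (φ : BandPotential) (g : LinkPotential)
    (x t₁ : VertexState) (e₁ : Offer) (t₂ : VertexState) (e₂ : Offer) (t₃ : VertexState)
    (e₃ : Offer) : Bool :=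
  Nat.ble
    (coinSum fun d₁ => coinSum fun h₁ => rowStepThen t₁ e₁ x d₁ h₁ fun y₁ u₁ f₁ =>
      16 * (S * cost t₁ e₁ x d₁ h₁) + 16 * g y₁ t₂ e₂ t₃ e₃ +
      coinSum fun d₂ => coinSum fun h₂ => rowStepThen t₂ e₂ y₁ d₂ h₂ fun y₂ u₂ f₂ =>
        coinSum fun d₃ => coinSum fun h₃ => rowStepThen t₃ e₃ y₂ d₃ h₃ fun _ u₃ f₃ =>
          φ u₁ f₁ u₂ f₂ u₃ f₃)
    (64 * φ t₁ e₁ t₂ e₂ t₃ e₃ + 64 * g x t₁ e₁ t₂ e₂ + C)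

/-- The band inequality in all states. -/
def bandCheck (cost : VertexState → Offer → VertexState → Bool → Bool → ℕ) (S C : ℕ)
    (φ : BandPotential) (g : LinkPotential) : Bool :=
  VertexState.all fun x => VertexState.all fun t₁ => Offer.all fun e₁ =>
    VertexState.all fun t₂ => Offer.all fun e₂ => VertexState.all fun t₃ => Offer.all fun e₃ =>
      BandInequality cost S C φ g x t₁ e₁ t₂ e₂ t₃ e₃

theorem bandInequality_of_bandCheck {cost : VertexState → Offer → VertexState → Bool → Bool → ℕ}
    {S C : ℕ} {φ : BandPotential} {g : LinkPotential} (h : bandCheck cost S C φ g = true)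
    (x t₁ : VertexState) (e₁ : Offer) (t₂ : VertexState) (e₂ : Offer) (t₃ : VertexState)
    (e₃ : Offer) : BandInequality cost S C φ g x t₁ e₁ t₂ e₂ t₃ e₃ = true :=
  Offer.of_all (VertexState.of_all (Offer.of_all (VertexState.of_all (Offer.of_all
    (VertexState.of_all (VertexState.of_all h x) t₁) e₁) t₂) e₂) t₃) e₃

/-- Values of the band potential for `lossCount`, as base-1000 digits. -/
def lossBandTable : List ℕ :=
  [387277227227206115271176165342188151130106036186094096332203127157145007184117047,
   392262247218173127263152203429284269226206154284176226348198181132110047191094140,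
   463335336333284278367289310441247289271088193323159243379173198183027115234089150,
   366251193211191086247151132334167124118095014167074068334203115166154000184117038,
   351211195179127077217106150382222203170148091224116161318162134106086005154058094,
   436325317321280273351284300410218253248066161295132208375187201205054122247104153,
   437326269286266162322227208373248205198175095247155149383278191240229075259192113,
   415290274256205185295184229433301282274226171303194239362233206178157077226130166,
   521364380377284297422294341478291327320139235368205282428256271274122192316174223,
   391281217247229113277182156338186136144123031186094082343226130196185019207141053,
   354229212209203159234124163370217196180148086220112153326182147150116060173078104,
   450314304309274269352277290409220252252072164298135207392217220240099146274134173,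
   403286221254235117282187160364201151161140045202110096384250152221210041231164075,
   366233238252201197252128198398218189231156080247113146331176152190111096176072098,
   466342325349286278377291309427236264271090176313151220414238240265115165296155192,
   419309244276263140305210183360227177187165071228136122378272175244233064254187098,
   365271268252255228245157204394255229279191174262150185330210239227150210197106169,
   494347346356280278396287308448262291299121204339177246428270268288157227316187221,
   448339286300294174332237224359224170184164061222132115388281197236227078258191117,
   413289274275257203292183230345176159189124069177070116374244225206159123237140184,
   534384400389300313438312362432252287272103191323166241450276296298151213337192247,
   456346286309289179342246226359232170199179065231140114411304213268256098284217135,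
   420295275272226211301190230329162138189102034187058095375247219211172127240144179,
   542387401401293318445310362434253281280112189325168236467296307319168229356213260,
   498395330352357269385314299392323286285319260307285279444350292312335262337306280,
   463360331320330267348294299350304282275301260293276275409307280272298261289274275,
   597426455455301372499348417479341326332283272370288302510366350363293277398298312]

/-- Values of the link potential for `lossCount`, as base-1000 digits. -/
def lossLinkTable : List ℕ :=
  [354240133211154120244097114269166063132075048168016039306199073178128094201039058,
   318206112155112081219073089286179090145073052196047066277167071150080058192032044,
   399237175232105129273092132344192132187048095230053096314178095156057063196032048,
   250096076206146130282122174232024008129068058207042099235049000171120093233059115,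
   241070091209114111262105153260044049161079073240079130216026028148071078233063105,
   270191176257200189319191217245060078191051109272094163219039029152049070233065117,
   512395294357303275419260308427323225280224203344180233457350225324276243372199246,
   482366283313279241397240288456341264316288228375215265434323240296227217368198240,
   559395339383255286450267329504350297342245253408231295470332255304202218370203245]

/-- The digit with index `i + 27 * k` of a table. -/
def tableEntry (T : List ℕ) (k i : ℕ) : ℕ := T.getD k 0 / 1000 ^ i % 1000

/-- The band potential for `lossCount`. -/
def lossBand : BandPotential := fun t₁ e₁ t₂ e₂ t₃ e₃ =>
  tableEntry lossBandTable (e₂.code + 3 * t₃.code + 9 * e₃.code)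
    (t₁.code + 3 * e₁.code + 9 * t₂.code)

/-- The link potential for `lossCount`. -/
def lossLink : LinkPotential := fun x t₁ e₁ t₂ e₂ =>
  tableEntry lossLinkTable (e₂.code + 3 * x.code) (t₁.code + 3 * e₁.code + 9 * t₂.code)

/-- The band potential for `lightCount`. -/
def lightBand : BandPotential := fun t₁ _ _ _ _ _ =>
  match t₁ with
  | .matched => 0
  | _ => 1

/-- The link potential for `lightCount`. -/
def lightLink : LinkPotential := fun x _ _ _ _ =>
  match x with
  | .matched => 0
  | _ => 2

-- The two tables are a feasible point of the finite linear system `bandCheck`, scaled by 356 to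
-- integers. The resulting density is 1793 / (64 · 356) ≈ 0.078696, just below 1 - 0.9213.
set_option maxRecDepth 100000 in
theorem bandCheck_loss : bandCheck lossCount 356 1793 lossBand lossLink = true := by
  decide +kernel

-- Here the potentials are explicit. The mean cost 4 · 1/2 of an entering unmatched vertex cancels
-- against its link potential 2. What remains is 2 P(final state not matched) + P(new state not
-- matched) ≤ 1 + [old state not matched], which holds because without a heavy offer a heavy
-- horizontal edge, of probability 1/2, matches both cells. The density is 64 / (64 · 4) = 1/4.
set_option maxRecDepth 100000 in
theorem bandCheck_light : bandCheck lightCount 4 64 lightBand lightLink = true := by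
  decide +kernel

theorem lossBand_lt (t₁ : VertexState) (e₁ : Offer) (t₂ : VertexState) (e₂ : Offer)
    (t₃ : VertexState) (e₃ : Offer) : lossBand t₁ e₁ t₂ e₂ t₃ e₃ < 1000 :=
  Nat.mod_lt _ (by norm_num)

theorem lossLink_lt (x t₁ : VertexState) (e₁ : Offer) (t₂ : VertexState) (e₂ : Offer) :
    lossLink x t₁ e₁ t₂ e₂ < 1000 :=
  Nat.mod_lt _ (by norm_num)

/-! ### Stability of the greedy matching -/

/-- A matching relation `m` on the pairs related by `adj` such that every unmatched pair has an end
that is matched to somebody it prefers; `better u w v` says that `u` prefers `w` to `v`. -/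
structure IsStable {V : Type*} (adj : V → V → Prop) (better : V → V → V → Prop)
    (m : V → V → Prop) : Prop where
  symm : ∀ {u v}, m u v → m v u
  rel : ∀ {u v}, m u v → adj u v
  unique : ∀ {u v w}, m u v → m u w → v = w
  blocked : ∀ {u v}, adj u v → ¬ m u v →
    (∃ w, m u w ∧ better u w v) ∨ (∃ w, m v w ∧ better v w u)

section Greedy

variable {V : Type*} (G : SimpleGraph V) (idx : V ↪ ℕ) (W : G.edgeSet → ℝ)

/-- `u` prefers its neighbour `w` to its neighbour `v`. -/
def Prefers (u w v : V) : Prop :=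
  pairWeight G W u v < pairWeight G W u w ∨
    (pairWeight G W u v = pairWeight G W u w ∧ idx w < idx v)

/-- The greedy algorithm matches `u` with `v`. -/
def GreedyPartner (u v : V) : Prop :=
  ∃ t, MutualProposal G idx W (unmatched G idx W t) u v

theorem pairWeight_of_adj {u v : V} (h : G.Adj u v) : pairWeight G W u v = W ⟨s(u, v), h⟩ := by
  rw [pairWeight, dif_pos h]

theorem pairWeight_comm (u v : V) : pairWeight G W u v = pairWeight G W v u := by
  by_cases h : G.Adj u v
  · rw [pairWeight_of_adj G W h, pairWeight_of_adj G W h.symm]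
    congr 1
    exact Subtype.ext Sym2.eq_swap
  · rw [pairWeight, pairWeight, dif_neg h, dif_neg fun h' => h h'.symm]

theorem unmatched_antitone : Antitone (unmatched G idx W) :=
  antitone_nat_of_succ_le fun _ _ h => h.1

theorem MutualProposal.symm {S : Set V} {u v : V} (h : MutualProposal G idx W S u v) :
    MutualProposal G idx W S v u :=
  ⟨h.2.1, h.1, h.2.2.2, h.2.2.1⟩

theorem Proposes.unique {S : Set V} {u v w : V} (hv : Proposes G idx W S u v)
    (hw : Proposes G idx W S u w) : v = w := by
  by_contra hne
  have h1 := hv.2 w hw.1.1 hw.1.2 (Ne.symm hne)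
  have h2 := hw.2 v hv.1.1 hv.1.2 hne
  rcases h1 with h1 | ⟨h1, h1'⟩ <;> rcases h2 with h2 | ⟨h2, h2'⟩ <;> linarith

theorem GreedyPartner.unique {u v w : V} (hv : GreedyPartner G idx W u v)
    (hw : GreedyPartner G idx W u w) : v = w := by
  obtain ⟨t, ht⟩ := hv
  obtain ⟨t', ht'⟩ := hw
  rcases lt_trichotomy t t' with h | h | h
  · exact absurd ⟨v, ht⟩ (unmatched_antitone G idx W h ht'.1).2
  · subst h
    exact ht.2.2.1.unique G idx W ht'.2.2.1
  · exact absurd ⟨w, ht'⟩ (unmatched_antitone G idx W h ht.1).2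

/-- An available edge of minimal key (minus weight, sum of indices) is a mutual proposal: with one
end fixed, comparing sums of indices is comparing the indices of the other ends. -/
theorem exists_mutualProposal [Finite V] {S : Set V} {u v : V} (hu : u ∈ S) (hv : v ∈ S)
    (huv : G.Adj u v) : ∃ a b, MutualProposal G idx W S a b := by
  obtain ⟨⟨a, b⟩, ⟨ha, hb, hab⟩, hmin⟩ := Set.exists_min_image
    {p : V × V | p.1 ∈ S ∧ p.2 ∈ S ∧ G.Adj p.1 p.2}
    (fun p => toLex (-pairWeight G W p.1 p.2, idx p.1 + idx p.2)) (Set.toFinite _)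
    ⟨(u, v), hu, hv, huv⟩
  have key : ∀ a' b', a' ∈ S → b' ∈ S → G.Adj a' b' →
      pairWeight G W a' b' < pairWeight G W a b ∨
        (pairWeight G W a' b' = pairWeight G W a b ∧ idx a + idx b ≤ idx a' + idx b') := by
    intro a' b' h1 h2 h3
    have := hmin (a', b') ⟨h1, h2, h3⟩
    rw [Prod.Lex.toLex_le_toLex] at this
    simpa [eq_comm] using this
  refine ⟨a, b, ha, hb, ⟨⟨hb, hab⟩, fun k hk hak hkb => ?_⟩, ⟨ha, hab.symm⟩, fun k hk hbk hka => ?_⟩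
  · have hne : idx k ≠ idx b := fun h => hkb (idx.injective h)
    rcases key a k ha hk hak with h | ⟨h, h'⟩
    · exact Or.inl h
    · exact Or.inr ⟨h, by omega⟩
  · have hne : idx k ≠ idx a := fun h => hka (idx.injective h)
    rw [pairWeight_comm G W b k, pairWeight_comm G W b a]
    rcases key k b hk hb hbk.symm with h | ⟨h, h'⟩
    · exact Or.inl h
    · exact Or.inr ⟨h, by omega⟩

/-- Otherwise every iteration would have an available edge and so remove a vertex, contradicting the
existence of an iteration with the fewest unmatched vertices. -/
theorem exists_notMem_unmatched [Finite V] {u v : V} (huv : G.Adj u v) :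
    ∃ t, ¬ (u ∈ unmatched G idx W t ∧ v ∈ unmatched G idx W t) := by
  by_contra! hcon
  obtain ⟨t, ht⟩ : ∃ t, ∀ t', (unmatched G idx W t).ncard ≤ (unmatched G idx W t').ncard :=
    ⟨_, fun t' => Function.argmin_le (fun t => (unmatched G idx W t).ncard) t'⟩
  have heq : unmatched G idx W (t + 1) = unmatched G idx W t :=
    Set.eq_of_subset_of_ncard_le (unmatched_antitone G idx W t.le_succ) (ht _)
  obtain ⟨a, b, hab⟩ := exists_mutualProposal G idx W (hcon t).1 (hcon t).2 huv
  have ha : a ∈ unmatched G idx W (t + 1) := heq ▸ hab.1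
  exact ha.2 ⟨b, hab⟩

/-- For an unmatched pair, consider the last moment at which both ends are available. An end that
leaves then was proposing to somebody else while the other end was on offer, hence prefers its
partner. -/
theorem isStable_greedyPartner [Finite V] :
    IsStable G.Adj (Prefers G idx W) (GreedyPartner G idx W) where
  symm := fun ⟨t, ht⟩ => ⟨t, ht.symm⟩
  rel := fun ⟨_, ht⟩ => ht.2.2.1.1.2
  unique := fun h h' => h.unique G idx W h'
  blocked := by
    classical
    intro u v huv hm
    have hex := exists_notMem_unmatched G idx W huv
    -- The first bad time is not 0, since initially every vertex is unmatched.
    obtain ⟨t, ht, htmin⟩ : ∃ t, ¬ (u ∈ unmatched G idx W (t + 1) ∧ v ∈ unmatched G idx W (t + 1)) ∧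
        (u ∈ unmatched G idx W t ∧ v ∈ unmatched G idx W t) := by
      have hpos : Nat.find hex ≠ 0 := fun h0 => by
        have := Nat.find_spec hex
        rw [h0] at this
        exact this ⟨Set.mem_univ _, Set.mem_univ _⟩
      obtain ⟨t, ht⟩ := Nat.exists_eq_succ_of_ne_zero hpos
      have hspec := Nat.find_spec hex
      rw [ht] at hspec
      refine ⟨t, hspec, ?_⟩
      have := Nat.find_min hex (m := t) (by omega)
      tauto
    have main : ∀ u v, G.Adj u v → ¬ GreedyPartner G idx W u v → u ∈ unmatched G idx W t →
        v ∈ unmatched G idx W t → u ∉ unmatched G idx W (t + 1) →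
        ∃ w, GreedyPartner G idx W u w ∧ Prefers G idx W u w v := by
      intro u v huv hm hu hv hnot
      have : ∃ w, MutualProposal G idx W (unmatched G idx W t) u w := by
        by_contra h
        exact hnot ⟨hu, h⟩
      obtain ⟨w, hw⟩ := this
      refine ⟨w, ⟨t, hw⟩, hw.2.2.1.2 v hv huv ?_⟩
      rintro rfl
      exact hm ⟨t, hw⟩
    by_cases h : u ∈ unmatched G idx W (t + 1)
    · exact Or.inr (main v u huv.symm (fun ⟨s, hs⟩ => hm ⟨s, hs.symm⟩) htmin.2 htmin.1
        fun h' => ht ⟨h, h'⟩)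
    · exact Or.inl (main u v huv hm htmin.1 htmin.2 h)

theorem mem_greedyMatching_iff {u v : V} (h : G.Adj u v) :
    (⟨s(u, v), h⟩ : G.edgeSet) ∈ greedyMatching G idx W ↔ GreedyPartner G idx W u v := by
  constructor
  · rintro ⟨t, a, b, hab, hm⟩
    rcases Sym2.eq_iff.1 hab with ⟨rfl, rfl⟩ | ⟨rfl, rfl⟩
    · exact ⟨t, hm⟩
    · exact ⟨t, hm.symm⟩
  · rintro ⟨t, ht⟩
    exact ⟨t, u, v, rfl, ht⟩

theorem isMatching_greedyMatching [Finite V] : IsMatching G (greedyMatching G idx W) := by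
  have hst := isStable_greedyPartner G idx W
  rintro ⟨e, he⟩ hM ⟨f, hf⟩ hM' u hu hu'
  obtain ⟨v, rfl⟩ := Sym2.mem_iff_exists.1 hu
  obtain ⟨w, rfl⟩ := Sym2.mem_iff_exists.1 hu'
  have h1 := (mem_greedyMatching_iff G idx W he).1 hM
  have h2 := (mem_greedyMatching_iff G idx W hf).1 hM'
  have := hst.unique h1 h2
  subst this
  rfl

/-- The preferences at a vertex are decreasing in a key of the edge. -/
theorem Prefers.key_lt {u v w : V} (h : Prefers G idx W u w v) :
    (toLex (-pairWeight G W u w, idx u + idx w) : ℝ ×ₗ ℕ) <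
      toLex (-pairWeight G W u v, idx u + idx v) := by
  rw [Prod.Lex.toLex_lt_toLex]
  rcases h with h | ⟨h, h'⟩
  · exact Or.inl (neg_lt_neg h)
  · exact Or.inr ⟨by simp [h], by simpa using h'⟩

/-- The key of an edge: heavy edges first, then small sums of the indices. -/
def edgeKey : Sym2 V → ℝ ×ₗ ℕ :=
  Sym2.lift ⟨fun u v => toLex (-pairWeight G W u v, idx u + idx v), fun u v => by
    simp only [pairWeight_comm G W u v, add_comm (idx u)]⟩

end Greedy

/-! ### Sensitivity of a stable matching to the set of vertices -/

section Comparison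

variable {V : Type*} [DecidableEq V]

/-- The effect on the set of free vertices of offering them the edge between `a` and `b`. -/
def offerEdge (a b : V) (P : Finset V) : Finset V :=
  if a ∈ P ∧ b ∈ P then (P.erase a).erase b else P

/-- If only one of the two sets accepts the edge, some end of the edge already belongs to the
symmetric difference. Acceptance removes that end from the difference and adds at most the other
one. -/
theorem card_symmDiff_offerEdge_le (a b : V) (P P' : Finset V) :
    (symmDiff (offerEdge a b P) (offerEdge a b P')).card ≤ (symmDiff P P').card := by
  -- The critical case: `b` is the end missing from `P'`, so it leaves the difference, and at most
  -- `a` enters it.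
  have move : ∀ a b : V, ∀ P P' : Finset V, a ∈ P → b ∈ P → b ∉ P' →
      (symmDiff ((P.erase a).erase b) P').card ≤ (symmDiff P P').card := by
    intro a b P P' ha hb hb'
    have hmem : b ∈ symmDiff P P' := Finset.mem_symmDiff.2 (Or.inl ⟨hb, hb'⟩)
    calc (symmDiff ((P.erase a).erase b) P').card
        ≤ (insert a ((symmDiff P P').erase b)).card := Finset.card_le_card fun x hx => by
          simp only [Finset.mem_symmDiff, Finset.mem_erase, Finset.mem_insert] at hx ⊢
          by_cases hxa : x = a
          · exact Or.inl hxa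
          · refine Or.inr ⟨?_, ?_⟩
            · rintro rfl
              tauto
            · rcases hx with hx | hx
              · exact Or.inl ⟨hx.1.2.2, hx.2⟩
              · refine Or.inr ⟨hx.1, fun h => ?_⟩
                refine hx.2 ⟨?_, hxa, h⟩
                rintro rfl
                exact hb' hx.1
      _ ≤ ((symmDiff P P').erase b).card + 1 := Finset.card_insert_le _ _
      _ = (symmDiff P P').card := Finset.card_erase_add_one hmem
  have move' : ∀ P P' : Finset V, a ∈ P → b ∈ P → ¬ (a ∈ P' ∧ b ∈ P') →
      (symmDiff ((P.erase a).erase b) P').card ≤ (symmDiff P P').card := by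
    intro P P' ha hb h
    by_cases hb' : b ∈ P'
    · rw [Finset.erase_right_comm]
      exact move b a P P' hb ha fun ha' => h ⟨ha', hb'⟩
    · exact move a b P P' ha hb hb'
  unfold offerEdge
  split_ifs with h h' h'
  · refine Finset.card_le_card fun x hx => ?_
    simp only [Finset.mem_symmDiff, Finset.mem_erase] at hx ⊢
    tauto
  · exact move' P P' h.1 h.2 h'
  · rw [symmDiff_comm, symmDiff_comm P]
    exact move' P' P h'.1 h'.2 h
  · exact le_rfl

variable {adj : V → V → Prop} {better : V → V → V → Prop} {α : Type*} [LinearOrder α]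

open Classical in
/-- The vertices of `S` that are not matched by `m` through an edge of `E`. -/
def freeVertices (S : Finset V) (m : V → V → Prop) (E : Finset (Sym2 V)) : Finset V :=
  S.filter fun v => ∀ w, m v w → s(v, w) ∉ E

-- When all edges of smaller key have been offered, stability says that the next edge is matched
-- exactly if both its ends are still free: a blocking partner would have been reached through a
-- smaller key. Ties are harmless, as only disjoint pairs of competing edges can tie.
open Classical in
theorem freeVertices_insert {S : Finset V} {m : V → V → Prop} {f : Sym2 V → α}
    (hf : ∀ {u v w}, adj u v → adj u w → better u w v → f s(u, w) < f s(u, v))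
    (hadj : ∀ {u v}, adj u v → adj v u)
    (hm : IsStable (fun u v => adj u v ∧ u ∈ S ∧ v ∈ S) better m) {a b : V} {E : Finset (Sym2 V)}
    (hab : s(a, b) ∉ E) (hE : ∀ x ∈ insert s(a, b) E, ∀ y, f y < f x → y ∈ insert s(a, b) E) :
    freeVertices S m (insert s(a, b) E) =
      if adj a b then offerEdge a b (freeVertices S m E) else freeVertices S m E := by
  have hlow : ∀ y, f y < f s(a, b) → y ∈ E := fun y hy => by
    rcases Finset.mem_insert.1 (hE _ (Finset.mem_insert_self _ _) y hy) with rfl | h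
    · exact absurd hy (lt_irrefl _)
    · exact h
  have hiff : m a b ↔ adj a b ∧ a ∈ freeVertices S m E ∧ b ∈ freeVertices S m E := by
    constructor
    · intro h
      have h' := hm.rel h
      refine ⟨h'.1, Finset.mem_filter.2 ⟨h'.2.1, fun w hw => ?_⟩,
        Finset.mem_filter.2 ⟨h'.2.2, fun w hw => ?_⟩⟩
      · rwa [← hm.unique h hw]
      · rwa [← hm.unique (hm.symm h) hw, Sym2.eq_swap]
    · rintro ⟨h, ha, hb⟩
      by_contra hno
      obtain ⟨haS, ha⟩ := Finset.mem_filter.1 ha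
      obtain ⟨hbS, hb⟩ := Finset.mem_filter.1 hb
      rcases hm.blocked ⟨h, haS, hbS⟩ hno with ⟨w, hw, hbet⟩ | ⟨w, hw, hbet⟩
      · exact ha w hw (hlow _ (hf h (hm.rel hw).1 hbet))
      · refine hb w hw (hlow _ ?_)
        rw [Sym2.eq_swap (a := a)]
        exact hf (hadj h) (hm.rel hw).1 hbet
  have hmem : ∀ v, v ∈ freeVertices S m (insert s(a, b) E) ↔
      v ∈ freeVertices S m E ∧ ¬ (m a b ∧ (v = a ∨ v = b)) := by
    intro v
    simp only [freeVertices, Finset.mem_filter, Finset.mem_insert, not_or]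
    constructor
    · rintro ⟨hv, h⟩
      refine ⟨⟨hv, fun w hw => (h w hw).2⟩, ?_⟩
      rintro ⟨hmab, rfl | rfl⟩
      · exact (h b hmab).1 rfl
      · exact (h a (hm.symm hmab)).1 Sym2.eq_swap
    · rintro ⟨⟨hv, h⟩, h'⟩
      refine ⟨hv, fun w hw => ⟨fun heq => h' ?_, h w hw⟩⟩
      rcases Sym2.eq_iff.1 heq with ⟨rfl, rfl⟩ | ⟨rfl, rfl⟩
      · exact ⟨hw, Or.inl rfl⟩
      · exact ⟨hm.symm hw, Or.inr rfl⟩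
  ext v
  rw [hmem, hiff]
  unfold offerEdge
  split_ifs with h1 h2
  · simp only [Finset.mem_erase]
    tauto
  · tauto
  · tauto

/-- Changing the set of available vertices changes the set of free vertices at the end by no
more. -/
theorem card_symmDiff_freeVertices_le {S S' : Finset V} {m m' : V → V → Prop} (f : Sym2 V → α)
    (hf : ∀ {u v w}, adj u v → adj u w → better u w v → f s(u, w) < f s(u, v))
    (hadj : ∀ {u v}, adj u v → adj v u)
    (hm : IsStable (fun u v => adj u v ∧ u ∈ S ∧ v ∈ S) better m)
    (hm' : IsStable (fun u v => adj u v ∧ u ∈ S' ∧ v ∈ S') better m') (E : Finset (Sym2 V))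
    (hE : ∀ x ∈ E, ∀ y, f y < f x → y ∈ E) :
    (symmDiff (freeVertices S m E) (freeVertices S' m' E)).card ≤ (symmDiff S S').card := by
  classical
  -- Removing an element of maximal key leaves a set that is still closed under smaller keys.
  induction E using Finset.induction_on_max_value f with
  | empty => simp [freeVertices]
  | insert e E he hmax ih =>
    induction e using Sym2.ind with
    | _ a b =>
    have hE0 : ∀ x ∈ E, ∀ y, f y < f x → y ∈ E := fun x hx y hy => by
      rcases Finset.mem_insert.1 (hE x (Finset.mem_insert_of_mem hx) y hy) with rfl | h
      · exact absurd (hmax x hx) (not_le.2 hy)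
      · exact h
    rw [freeVertices_insert hf hadj hm he hE, freeVertices_insert hf hadj hm' he hE]
    split_ifs
    · exact (card_symmDiff_offerEdge_le a b _ _).trans (ih hE0)
    · exact ih hE0

end Comparison

/-! ### The sweep as a local recursion with a cone of dependence -/

/-- The cell `(r, x)` lies in the grid with rows and columns `1, …, n`. -/
def inGrid (n r x : ℕ) : Bool := decide (1 ≤ r ∧ r ≤ n ∧ 1 ≤ x ∧ x ≤ n)

/-- The cell `(r, x)` is not matched through a heavy edge, when `hh` and `hv` tell which horizontal
and which vertical edges are heavy and matched. -/
def isLight (n : ℕ) (hh hv : ℕ → ℕ → Bool) (r x : ℕ) : Bool :=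
  inGrid n r x && !hv (r - 1) x && !hh r (x - 1) && !hh r x && !hv r x

/-- The greedy matching of a grid with rows and columns `1, …, n`. The edge from `(r, x)` to
`(r, x + 1)` is heavy if `H r x`, heavy and matched if `hh r x`, light and matched if `lh r x`; `D`,
`hv` and `lv` describe in the same way the edge from `(r, x)` to `(r + 1, x)`. -/
structure Sweep (n : ℕ) where
  D : ℕ → ℕ → Bool
  H : ℕ → ℕ → Bool
  hh : ℕ → ℕ → Bool
  hv : ℕ → ℕ → Bool
  lh : ℕ → ℕ → Bool
  lv : ℕ → ℕ → Bool
  D_range : ∀ r x, D r x = true → 1 ≤ r ∧ r < n ∧ 1 ≤ x ∧ x ≤ n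
  H_range : ∀ r x, H r x = true → 1 ≤ r ∧ r ≤ n ∧ 1 ≤ x ∧ x < n
  hh_eq : ∀ r x, hh r x = (H r x && !hv (r - 1) x && !hv (r - 1) (x + 1) && !hh r (x - 1))
  hv_eq : ∀ r x, hv r x = (D r x && !hv (r - 1) x && !hh r (x - 1) && !hh r x)
  lh_eq : ∀ r x, lh r x = (isLight n hh hv r x && isLight n hh hv r (x + 1) && !lv (r - 1) x &&
    !lv (r - 1) (x + 1) && !lh r (x - 1))
  lv_eq : ∀ r x, lv r x = (isLight n hh hv r x && isLight n hh hv (r + 1) x && !lv (r - 1) x &&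
    !lh r (x - 1) && !lh r x)

namespace Sweep

variable {n : ℕ} (S : Sweep n)

/-- The cell is not matched through a heavy edge. -/
def light (r x : ℕ) : Bool := isLight n S.hh S.hv r x

/-- The cell is matched neither through a heavy edge nor upwards or sideways. -/
def waits (r x : ℕ) : Bool := S.light r x && !S.lv (r - 1) x && !S.lh r (x - 1) && !S.lh r x

/-- The state of a cell before the edge to its right is considered. -/
def provisional (r x : ℕ) : VertexState :=
  if !inGrid n r x || S.hv (r - 1) x || S.hh r (x - 1) then .matched
  else if S.waits (r - 1) x then .claimed else .free

/-- The state of a cell after the heavy horizontal edges of its row have been considered. -/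
def state (r x : ℕ) : VertexState := if S.hh r x then .matched else S.provisional r x

/-- The offer of a cell to the one below, before the edge to its right is considered. -/
def offer (r x : ℕ) : Offer :=
  if S.hv r x then .heavy
  else if S.light r x && !S.lv (r - 1) x && !S.lh r (x - 1) then .pending else .idle

/-- The offer of a cell to the one below. -/
def settledOffer (r x : ℕ) : Offer :=
  if S.hv r x then .heavy else if S.waits r x then .pending else .idle

theorem light_eq (r x : ℕ) : S.light r x =
    (inGrid n r x && !S.hv (r - 1) x && !S.hh r (x - 1) && !S.hh r x && !S.hv r x) := rfl

/-- The recursion for `lv` does not mention what else the lower cell could do: the cell above is its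
first choice, so lightness of the lower cell is all that the waiting cell needs. -/
theorem lv_eq_waits (r x : ℕ) : S.lv r x = (S.waits r x && S.light (r + 1) x) := by
  rw [S.lv_eq, waits, light, light]
  generalize isLight n S.hh S.hv r x = a
  generalize isLight n S.hh S.hv (r + 1) x = b
  cases a <;> cases b <;> simp

theorem D_eq_false {r x : ℕ} (h : inGrid n r x = false) : S.D r x = false := by
  by_contra hD
  have := S.D_range r x (by simpa using hD)
  simp only [inGrid, decide_eq_false_iff_not] at h
  omega

theorem H_eq_false {r x : ℕ} (h : inGrid n r x = false) : S.H r x = false := by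
  by_contra hH
  have := S.H_range r x (by simpa using hH)
  simp only [inGrid, decide_eq_false_iff_not] at h
  omega

/-- The finite rules of `reveal` compute the sweep. A light cell claimed from above is taken by the
cell above and leaves the offer to its left untouched; a light unclaimed cell absorbs a pending left
neighbour. -/
theorem reveal_offer (r x : ℕ) :
    reveal (S.offer r x) (S.state r (x + 1)) (S.D r (x + 1)) =
      (S.settledOffer r x, S.offer r (x + 1)) := by
  have hlh := S.lh_eq r x
  have hvx := S.hv_eq r (x + 1)
  have hl : S.light r (x + 1) = _ := S.light_eq r (x + 1)
  have hD := S.D_eq_false (r := r) (x := x + 1)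
  -- For `r = 0` the truncated `r - 1` is 0 again; both sides vanish because row 0 has no light
  -- cells.
  have hlv : S.lv (r - 1) (x + 1) = (S.waits (r - 1) (x + 1) && S.light r (x + 1)) := by
    rcases r with _ | r
    · have h0 : ∀ y, S.light 0 y = false := fun y => by simp [light_eq, inGrid]
      rw [Nat.zero_sub, lv_eq_waits, waits, h0]
      simp
    · exact S.lv_eq_waits r (x + 1)
  have hlt : S.light r x = true → S.hv r x = false := by
    rw [S.light_eq r x]; simp
  change S.lh r x = (S.light r x && S.light r (x + 1) && !S.lv (r - 1) x &&
    !S.lv (r - 1) (x + 1) && !S.lh r (x - 1)) at hlh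
  simp only [Nat.add_sub_cancel] at hvx hl
  unfold offer state provisional settledOffer
  rw [waits.eq_def S r x]
  simp only [Nat.add_sub_cancel]
  generalize S.waits (r - 1) (x + 1) = w at *
  generalize S.light r x = l at *
  generalize S.light r (x + 1) = l' at *
  generalize S.lv (r - 1) x = v at *
  generalize S.lv (r - 1) (x + 1) = v' at *
  generalize S.lh r (x - 1) = a at *
  generalize S.lh r x = a' at *
  generalize S.hv r x = p at *
  generalize S.hv r (x + 1) = p' at *
  generalize S.hv (r - 1) (x + 1) = q at *
  generalize S.hh r x = b at *
  generalize S.hh r (x + 1) = b' at *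
  generalize S.D r (x + 1) = d at *
  generalize inGrid n r (x + 1) = i at *
  subst hlh hvx hlv hl
  cases i
  · obtain rfl := hD rfl
    cases p <;> cases l <;> cases v <;> cases a <;> cases b' <;> simp [reveal]
  · cases q
    · cases b
      · cases b'
        · cases d <;> cases w <;> cases p <;> cases l <;> cases v <;> cases a <;> simp_all [reveal]
        · cases d <;> cases p <;> cases l <;> cases v <;> cases a <;> simp_all [reveal]
      · cases d <;> cases b' <;> cases p <;> cases l <;> cases v <;> cases a <;> simp_all [reveal]
    · cases d <;> cases b' <;> cases p <;> cases l <;> cases v <;> cases a <;> simp_all [reveal]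

/-- A cell that is not matched from above is matched through the heavy edge to its left exactly when
the left cell is still available. Columns outside the grid behave as matched, which handles the
boundary. -/
theorem place_settledOffer {r x : ℕ} (hr : 1 ≤ r) (hrn : r ≤ n) (hx : x + 1 ≤ n) :
    place (S.provisional r x) (S.settledOffer (r - 1) (x + 1)) (S.H r x) =
      (S.state r x, S.provisional r (x + 1)) := by
  have hh := S.hh_eq r x
  have hg : inGrid n r (x + 1) = true := by simp [inGrid]; omega
  have hH := S.H_eq_false (r := r) (x := x)
  unfold state provisional settledOffer
  rw [hg]
  simp only [Nat.add_sub_cancel]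
  generalize S.hh r x = b at *
  generalize S.H r x = h at *
  generalize S.hv (r - 1) x = p at *
  generalize S.hv (r - 1) (x + 1) = p' at *
  generalize S.hh r (x - 1) = a at *
  generalize S.waits (r - 1) x = w at *
  generalize S.waits (r - 1) (x + 1) = w' at *
  generalize inGrid n r x = i at *
  subst hh
  cases i
  · obtain rfl := hH rfl
    cases p' <;> cases w' <;> simp [place]
  · cases p <;> cases p' <;> cases a <;> cases w <;> cases w' <;> cases h <;> simp [place]

theorem rowStep_eq {r x : ℕ} (hr : 1 ≤ r) (hrn : r ≤ n) (hx : x + 1 ≤ n) :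
    rowStep (S.provisional r x) (S.offer (r - 1) (x + 1)) (S.state (r - 1) (x + 2))
        (S.D (r - 1) (x + 2)) (S.H r x) =
      (S.state r x, S.provisional r (x + 1), S.offer (r - 1) (x + 2)) := by
  unfold rowStep
  rw [S.reveal_offer (r - 1) (x + 1)]
  simp only [S.place_settledOffer hr hrn hx]

theorem provisional_of_not_inGrid {r x : ℕ} (h : inGrid n r x = false) :
    S.provisional r x = .matched := by simp [provisional, h]

theorem state_of_not_inGrid {r x : ℕ} (h : inGrid n r x = false) : S.state r x = .matched := by
  simp [state, S.provisional_of_not_inGrid h]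

theorem offer_of_not_inGrid {r x : ℕ} (h : inGrid n r x = false) : S.offer r x = .idle := by
  simp [offer, S.hv_eq r x, S.D_eq_false h, light_eq, h]

/-- Two sweeps have the same coins in the cone of dependence with apex `(r, ·)` and level `T`. -/
def AgreeBelow (S S' : Sweep n) (r T : ℕ) : Prop :=
  (∀ r' y, r' < r → y + 2 * r' ≤ T → S.D r' y = S'.D r' y) ∧
    ∀ r' y, r' ≤ r → y + 2 * r' ≤ T → S.H r' y = S'.H r' y

theorem AgreeBelow.mono {S S' : Sweep n} {r T r' T' : ℕ} (h : AgreeBelow S S' r T) (hr : r' ≤ r)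
    (hT : T' ≤ T) : AgreeBelow S S' r' T' :=
  ⟨fun a y h1 h2 => h.1 a y (by omega) (by omega), fun a y h1 h2 => h.2 a y (by omega) (by omega)⟩

/-- The state of a cell depends only on the coins in a cone, and so do the provisional states and
the offers. -/
theorem dependence {S S' : Sweep n} (r : ℕ) :
    (∀ x, AgreeBelow S S' r (x + 2 * r) → S.state r x = S'.state r x) ∧
      (∀ x, AgreeBelow S S' r (x + 2 * r - 1) → S.provisional r x = S'.provisional r x) ∧
      ∀ x, AgreeBelow S S' (r + 1) (x + 2 * r) → S.offer r x = S'.offer r x := by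
  -- Offers are produced from left to right; the offer at `x` also uses the vertical coin of row
  -- `r`, hence the cone with apex row `r + 1`.
  have hoffer : ∀ r, (∀ x, AgreeBelow S S' r (x + 2 * r) → S.state r x = S'.state r x) →
      ∀ x, AgreeBelow S S' (r + 1) (x + 2 * r) → S.offer r x = S'.offer r x := by
    intro r hs x
    induction x with
    | zero => 
      intro _
      rw [S.offer_of_not_inGrid (by simp [inGrid]), S'.offer_of_not_inGrid (by simp [inGrid])]
    | succ x ih =>
      intro h
      have h1 := congrArg Prod.snd (S.reveal_offer r x)
      have h2 := congrArg Prod.snd (S'.reveal_offer r x)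
      dsimp only at h1 h2
      rw [← h1, ← h2, ih (h.mono le_rfl (by omega)), hs (x + 1) (h.mono (by omega) le_rfl),
        h.1 r (x + 1) (by omega) le_rfl]
  induction r with
  | zero =>
    have h0 : ∀ x, inGrid n 0 x = false := fun x => by simp [inGrid]
    exact ⟨fun x _ => by rw [S.state_of_not_inGrid (h0 x), S'.state_of_not_inGrid (h0 x)],
      fun x _ => by rw [S.provisional_of_not_inGrid (h0 x), S'.provisional_of_not_inGrid (h0 x)],
      fun x _ => by rw [S.offer_of_not_inGrid (h0 x), S'.offer_of_not_inGrid (h0 x)]⟩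
  | succ r ih =>
    obtain ⟨ihs, -, iho⟩ := ih
    -- Settling an offer reads one column further right, and placing a cell uses the settled offer
    -- another column to the right. This is the source of the slope 2 of the cone.
    have hsettled : ∀ x, AgreeBelow S S' (r + 1) (x + 1 + 2 * r) →
        S.settledOffer r x = S'.settledOffer r x := by
      intro x h
      have h1 := congrArg Prod.fst (S.reveal_offer r x)
      have h2 := congrArg Prod.fst (S'.reveal_offer r x)
      dsimp only at h1 h2
      rw [← h1, ← h2, iho x (h.mono le_rfl (by omega)), ihs (x + 1) (h.mono (by omega) le_rfl),
        h.1 r (x + 1) (by omega) le_rfl]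
    have hprov : ∀ x, AgreeBelow S S' (r + 1) (x + 2 * (r + 1) - 1) →
        S.provisional (r + 1) x = S'.provisional (r + 1) x := by
      intro x
      induction x with
      | zero =>
        intro _
        rw [S.provisional_of_not_inGrid (by simp [inGrid]),
          S'.provisional_of_not_inGrid (by simp [inGrid])]
      | succ x ihx =>
        intro h
        by_cases hin : r + 1 ≤ n ∧ x + 1 ≤ n
        · have h1 := congrArg Prod.snd (S.place_settledOffer (r := r + 1) (by omega) hin.1 hin.2)
          have h2 := congrArg Prod.snd (S'.place_settledOffer (r := r + 1) (by omega) hin.1 hin.2)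
          simp only [Nat.add_sub_cancel] at h1 h2
          rw [← h1, ← h2, ihx (h.mono le_rfl (by omega)), hsettled _ (h.mono le_rfl (by omega)),
            h.2 (r + 1) x le_rfl (by omega)]
        · have hg : inGrid n (r + 1) (x + 1) = false := by simp [inGrid]; omega
          rw [S.provisional_of_not_inGrid hg, S'.provisional_of_not_inGrid hg]
    have hstate : ∀ x, AgreeBelow S S' (r + 1) (x + 2 * (r + 1)) →
        S.state (r + 1) x = S'.state (r + 1) x := by
      intro x h
      by_cases hin : r + 1 ≤ n ∧ x + 1 ≤ n
      · have h1 := congrArg Prod.fst (S.place_settledOffer (r := r + 1) (by omega) hin.1 hin.2)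
        have h2 := congrArg Prod.fst (S'.place_settledOffer (r := r + 1) (by omega) hin.1 hin.2)
        simp only [Nat.add_sub_cancel] at h1 h2
        rw [← h1, ← h2, hprov x (h.mono le_rfl (by omega)), hsettled _ (h.mono le_rfl (by omega)),
          h.2 (r + 1) x le_rfl (by omega)]
      -- At the right or lower boundary there is no edge to the right, so the provisional state is
      -- final.
      · have hH : ∀ S : Sweep n, S.hh (r + 1) x = false := fun S => by
          rw [S.hh_eq]
          have : S.H (r + 1) x = false := by
            by_contra hH
            have := S.H_range _ _ (by simpa using hH)
            omega
          simp [this]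
        simp only [state, hH, Bool.false_eq_true, if_false]
        exact hprov x (h.mono le_rfl (by omega))
    exact ⟨hstate, hprov, hoffer _ hstate⟩

/-- The cost of the step that places the cell `(r, x + 1)`. -/
def stepCost (cost : VertexState → Offer → VertexState → Bool → Bool → ℕ) (r x : ℕ) : ℕ :=
  cost (S.provisional r x) (S.offer (r - 1) (x + 1)) (S.state (r - 1) (x + 2))
    (S.D (r - 1) (x + 2)) (S.H r x)

/-- The loss recorded by a step for the vertex two rows above. -/
def lossAbove (_ : VertexState) (_ : Offer) (x : VertexState) (d _ : Bool) : ℕ :=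
  if x = .claimed ∧ d = true then 1 else 0

/-- The loss recorded by a step for the vertex above the previous one. -/
def lossLeft (t : VertexState) (e : Offer) (x : VertexState) (d h : Bool) : ℕ :=
  if (reveal e x d).1 ≠ .heavy ∧ t = .claimed ∧ h = true then 1 else 0

/-- The loss recorded by a step for the vertex above the new one. -/
def lossRight (t : VertexState) (e : Offer) (x : VertexState) (d h : Bool) : ℕ :=
  if (reveal e x d).1 = .pending ∧ t ≠ .matched ∧ h = true then 1 else 0

/-- Splitting the cost by the vertex that is charged lets the three parts be reassembled per vertex,
since they are recorded at different steps. -/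
theorem lossCount_eq (t : VertexState) (e : Offer) (x : VertexState) (d h : Bool) :
    lossCount t e x d h = lossAbove t e x d h + lossLeft t e x d h + lossRight t e x d h := by
  unfold lossCount lossAbove lossLeft lossRight
  generalize (reveal e x d).1 = f
  cases t <;> cases f <;> cases x <;> cases d <;> cases h <;> rfl

theorem stepCost_lossCount (r x : ℕ) : S.stepCost lossCount r x =
    S.stepCost lossAbove r x + S.stepCost lossLeft r x + S.stepCost lossRight r x :=
  lossCount_eq _ _ _ _ _

/-- A vertex that is left unmatched is recorded by one of three steps. -/
theorem loss_le {r x : ℕ} (hr : r + 1 ≤ n) (hx : x + 2 ≤ n)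
    (hw : S.waits r (x + 2) = true) (hl : S.light (r + 1) (x + 2) = false) :
    1 ≤ S.stepCost lossLeft (r + 1) (x + 2) + S.stepCost lossRight (r + 1) (x + 1) +
      S.stepCost lossAbove (r + 2) x := by
  have hg : inGrid n (r + 1) (x + 2) = true := by simp [inGrid]; omega
  have hv : S.hv r (x + 2) = false := by
    simp only [waits, light_eq, Bool.and_eq_true, Bool.not_eq_true'] at hw
    tauto
  rw [light_eq, hg] at hl
  simp only [Nat.add_sub_cancel, hv, Bool.not_false, Bool.and_true, Bool.true_and,
    show x + 2 - 1 = x + 1 by omega] at hl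
  -- The cell below is matched heavily to its left, to its right or downwards; upwards is
  -- impossible, because the waiting cell is light. Each of the three cases is seen by a different
  -- step.
  by_cases h1 : S.hh (r + 1) (x + 1) = true
  · have h := S.hh_eq (r + 1) (x + 1)
    simp only [h1, Nat.add_sub_cancel] at h
    have h' := h.symm
    simp only [Bool.and_eq_true, Bool.not_eq_true'] at h'
    have hg' := S.H_range _ _ h'.1.1.1
    have : S.stepCost lossRight (r + 1) (x + 1) = 1 := by
      unfold stepCost lossRight
      simp only [Nat.add_sub_cancel]
      rw [S.reveal_offer r (x + 1 + 1), if_pos]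
      refine ⟨by simp [settledOffer, hv, hw], ?_, h'.1.1.1⟩
      have hg'' : inGrid n (r + 1) (x + 1) = true := by simp [inGrid]; omega
      simp only [provisional, hg'', h', Nat.add_sub_cancel]
      cases S.waits r (x + 1) <;> simp
    omega
  · have h1 : S.hh (r + 1) (x + 1) = false := by simpa using h1
    have hp : S.provisional (r + 1) (x + 2) = .claimed := by
      simp [provisional, hg, hv, h1, hw]
    by_cases h2 : S.hh (r + 1) (x + 2) = true
    · have h := S.hh_eq (r + 1) (x + 2)
      simp only [h2, Nat.add_sub_cancel] at h
      have h' := h.symm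
      simp only [Bool.and_eq_true, Bool.not_eq_true'] at h'
      have : S.stepCost lossLeft (r + 1) (x + 2) = 1 := by
        unfold stepCost lossLeft
        simp only [Nat.add_sub_cancel]
        rw [S.reveal_offer r (x + 2 + 1), if_pos]
        refine ⟨?_, hp, h'.1.1.1⟩
        simp only [settledOffer, h', Bool.false_eq_true, if_false]
        cases S.waits r (x + 2 + 1) <;> simp
      omega
    · have h2 : S.hh (r + 1) (x + 2) = false := by simpa using h2
      have h3 : S.hv (r + 1) (x + 2) = true := by simpa [h1, h2] using hl
      have hD : S.D (r + 1) (x + 2) = true := by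
        rw [S.hv_eq] at h3
        simp only [Bool.and_eq_true] at h3
        exact h3.1.1.1
      have : S.stepCost lossAbove (r + 2) x = 1 := by
        unfold stepCost lossAbove
        simp only [show r + 2 - 1 = r + 1 by omega]
        rw [if_pos ⟨by simp [state, h2, hp], hD⟩]
      omega

/-- A vertex that is not matched through a heavy edge is recorded by a step. -/
theorem light_le {r x : ℕ} (hl : S.light r (x + 2) = true) :
    1 ≤ S.stepCost lightCount (r + 1) x := by
  rw [light_eq] at hl
  simp only [Bool.and_eq_true, Bool.not_eq_true'] at hl
  have hD : S.D r (x + 2) = false := by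
    have := S.hv_eq r (x + 2)
    rw [hl.2, hl.1.2, hl.1.1.2, hl.1.1.1.2] at this
    simpa using this.symm
  have hs : S.state r (x + 2) ≠ .matched := by
    simp only [state, provisional, hl]
    cases S.waits (r - 1) (x + 2) <;> simp
  unfold stepCost lightCount
  simp only [Nat.add_sub_cancel, hD]
  cases h : S.state r (x + 2) <;> simp_all

end Sweep

/-! ### Averaging over fresh coins and telescoping the certificates -/

/-- A family of sweeps in which every coin can be tossed again without changing the others. -/
structure SweepFamily (n : ℕ) (Ω : Type*) [Fintype Ω] where
  sweep : Ω → Sweep n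
  setD : ℕ → ℕ → Bool → Ω → Ω
  setH : ℕ → ℕ → Bool → Ω → Ω
  setD_D : ∀ {r x}, 1 ≤ r → r < n → 1 ≤ x → x ≤ n → ∀ b ω r' x',
    (sweep (setD r x b ω)).D r' x' = if r' = r ∧ x' = x then b else (sweep ω).D r' x'
  setD_H : ∀ r x b ω r' x', (sweep (setD r x b ω)).H r' x' = (sweep ω).H r' x'
  setH_H : ∀ {r x}, 1 ≤ r → r ≤ n → 1 ≤ x → x < n → ∀ b ω r' x',
    (sweep (setH r x b ω)).H r' x' = if r' = r ∧ x' = x then b else (sweep ω).H r' x'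
  setH_D : ∀ r x b ω r' x', (sweep (setH r x b ω)).D r' x' = (sweep ω).D r' x'
  sum_setD : ∀ {r x}, 1 ≤ r → r < n → 1 ≤ x → x ≤ n → ∀ F : Ω → ℕ,
    2 * ∑ ω, F ω = ∑ ω, coinSum fun b => F (setD r x b ω)
  sum_setH : ∀ {r x}, 1 ≤ r → r ≤ n → 1 ≤ x → x < n → ∀ F : Ω → ℕ,
    2 * ∑ ω, F ω = ∑ ω, coinSum fun b => F (setH r x b ω)

namespace SweepFamily

variable {n : ℕ} {Ω : Type*} [Fintype Ω] (X : SweepFamily n Ω)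

/-- Independence in counting form: a quantity that does not change when the coin is tossed again may
be averaged over both values of that coin. -/
theorem sum_coinD {r x : ℕ} (hr : 1 ≤ r) (hrn : r < n) (hx : 1 ≤ x) (hxn : x ≤ n)
    (F : Ω → Bool → ℕ) (hF : ∀ b ω, F (X.setD r x b ω) = F ω) :
    2 * ∑ ω, F ω ((X.sweep ω).D r x) = ∑ ω, coinSum (F ω) := by
  rw [X.sum_setD hr hrn hx hxn]
  refine Finset.sum_congr rfl fun ω _ => ?_
  simp [coinSum, hF, X.setD_D hr hrn hx hxn]

theorem sum_coinH {r x : ℕ} (hr : 1 ≤ r) (hrn : r ≤ n) (hx : 1 ≤ x) (hxn : x < n)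
    (F : Ω → Bool → ℕ) (hF : ∀ b ω, F (X.setH r x b ω) = F ω) :
    2 * ∑ ω, F ω ((X.sweep ω).H r x) = ∑ ω, coinSum (F ω) := by
  rw [X.sum_setH hr hrn hx hxn]
  refine Finset.sum_congr rfl fun ω _ => ?_
  simp [coinSum, hF, X.setH_H hr hrn hx hxn]

/-- The state of the rows `a + 2`, `a + 3`, `a + 4` and of the vertex that enters from the row
`a + 1` when the row `a + 2` has been swept up to the column `k + 5`. -/
def bandState (a k : ℕ) (ω : Ω) :
    VertexState × VertexState × Offer × VertexState × Offer × VertexState × Offer :=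
  ((X.sweep ω).state (a + 1) (k + 7),
    (X.sweep ω).provisional (a + 2) (k + 5), (X.sweep ω).offer (a + 1) (k + 6),
    (X.sweep ω).provisional (a + 3) (k + 3), (X.sweep ω).offer (a + 2) (k + 4),
    (X.sweep ω).provisional (a + 4) (k + 1), (X.sweep ω).offer (a + 3) (k + 2))

/-- All entries of the band state lie strictly below the level `k + 2 * a + 9` of the fresh coins,
except the entering vertex in row `a + 1`. That one reaches this level, but only through horizontal
coins of rows up to `a + 1` and vertical coins of rows up to `a`, none of which is fresh. -/
theorem bandState_congr {a k : ℕ} {ω ω' : Ω}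
    (hD : ∀ r x, (x + 2 * r < k + 2 * a + 9 ∨ r ≤ a ∧ x + 2 * r ≤ k + 2 * a + 9) →
      (X.sweep ω).D r x = (X.sweep ω').D r x)
    (hH : ∀ r x, (x + 2 * r < k + 2 * a + 9 ∨ r ≤ a + 1 ∧ x + 2 * r ≤ k + 2 * a + 9) →
      (X.sweep ω).H r x = (X.sweep ω').H r x) : X.bandState a k ω = X.bandState a k ω' := by
  have hlt : ∀ r T, T < k + 2 * a + 9 → Sweep.AgreeBelow (X.sweep ω) (X.sweep ω') r T :=
    fun r T hT => ⟨fun r' y _ h => hD r' y (Or.inl (by omega)),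
      fun r' y _ h => hH r' y (Or.inl (by omega))⟩
  have hle : Sweep.AgreeBelow (X.sweep ω) (X.sweep ω') (a + 1) (k + 7 + 2 * (a + 1)) :=
    ⟨fun r' y h h' => hD r' y (Or.inr (by omega)), fun r' y h h' => hH r' y (Or.inr (by omega))⟩
  unfold bandState
  rw [(Sweep.dependence (a + 1)).1 _ hle,
    (Sweep.dependence (a + 2)).2.1 _ (hlt _ _ (by omega)),
    (Sweep.dependence (a + 1)).2.2 _ (hlt _ _ (by omega)),
    (Sweep.dependence (a + 3)).2.1 _ (hlt _ _ (by omega)),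
    (Sweep.dependence (a + 2)).2.2 _ (hlt _ _ (by omega)),
    (Sweep.dependence (a + 4)).2.1 _ (hlt _ _ (by omega)),
    (Sweep.dependence (a + 3)).2.2 _ (hlt _ _ (by omega))]

theorem bandState_setD {a k r x : ℕ} (hr : a + 1 ≤ r) (hrn : r < n) (hx : 1 ≤ x) (hxn : x ≤ n)
    (h : x + 2 * r = k + 2 * a + 9) (b : Bool) (ω : Ω) :
    X.bandState a k (X.setD r x b ω) = X.bandState a k ω := by
  refine X.bandState_congr (fun r' x' h' => ?_) fun r' x' _ => X.setD_H _ _ _ _ _ _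
  rw [X.setD_D (by omega) hrn hx hxn, if_neg]
  rintro ⟨rfl, rfl⟩
  omega

theorem bandState_setH {a k r x : ℕ} (hr : a + 2 ≤ r) (hrn : r ≤ n) (hx : 1 ≤ x) (hxn : x < n)
    (h : x + 2 * r = k + 2 * a + 9) (b : Bool) (ω : Ω) :
    X.bandState a k (X.setH r x b ω) = X.bandState a k ω := by
  refine X.bandState_congr (fun r' x' _ => X.setH_D _ _ _ _ _ _) fun r' x' h' => ?_
  rw [X.setH_H (by omega) hrn hx hxn, if_neg]
  rintro ⟨rfl, rfl⟩
  omega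

/-- The two fresh coins of the first row of a band can be averaged out. -/
theorem sum_first {a k : ℕ} (ha : a + 4 ≤ n) (hk : k + 7 ≤ n)
    (F : VertexState × VertexState × Offer × VertexState × Offer × VertexState × Offer →
      Bool → Bool → ℕ) :
    4 * ∑ ω, F (X.bandState a k ω) ((X.sweep ω).D (a + 1) (k + 7)) ((X.sweep ω).H (a + 2) (k + 5)) =
      ∑ ω, coinSum fun d => coinSum fun h => F (X.bandState a k ω) d h := by
  rw [← X.sum_coinD (r := a + 1) (x := k + 7) (by omega) (by omega) (by omega) (by omega)
      (fun ω d => coinSum fun h => F (X.bandState a k ω) d h)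
      (fun b ω => by
        simp only [X.bandState_setD (a := a) (k := k) (r := a + 1) (x := k + 7) (by omega)
          (by omega) (by omega) (by omega) (by omega)]),
    ← X.sum_coinH (r := a + 2) (x := k + 5) (by omega) (by omega) (by omega) (by omega)
      (fun ω h => F (X.bandState a k ω) ((X.sweep ω).D (a + 1) (k + 7)) h)
      (fun b ω => by
        simp only [X.setH_D, X.bandState_setH (a := a) (k := k) (r := a + 2) (x := k + 5) (by omega)
          (by omega) (by omega) (by omega) (by omega)])]
  ring

/-- The six fresh coins of a band can be averaged out. -/
theorem sum_band {a k : ℕ} (ha : a + 4 ≤ n) (hk : k + 7 ≤ n)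
    (F : VertexState × VertexState × Offer × VertexState × Offer × VertexState × Offer →
      Bool → Bool → Bool → Bool → Bool → Bool → ℕ) :
    64 * ∑ ω, F (X.bandState a k ω) ((X.sweep ω).D (a + 1) (k + 7)) ((X.sweep ω).H (a + 2) (k + 5))
        ((X.sweep ω).D (a + 2) (k + 5)) ((X.sweep ω).H (a + 3) (k + 3))
        ((X.sweep ω).D (a + 3) (k + 3)) ((X.sweep ω).H (a + 4) (k + 1)) =
      ∑ ω, coinSum fun d₁ => coinSum fun h₁ => coinSum fun d₂ => coinSum fun h₂ =>
        coinSum fun d₃ => coinSum fun h₃ => F (X.bandState a k ω) d₁ h₁ d₂ h₂ d₃ h₃ := by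
  -- The coins are replaced one after the other. Each time, the other coins and the band state are
  -- unaffected by the new toss.
  rw [← X.sum_first ha hk fun s d₁ h₁ => coinSum fun d₂ => coinSum fun h₂ =>
        coinSum fun d₃ => coinSum fun h₃ => F s d₁ h₁ d₂ h₂ d₃ h₃,
    ← X.sum_coinD (r := a + 2) (x := k + 5) (by omega) (by omega) (by omega) (by omega)
      (fun ω d₂ => coinSum fun h₂ => coinSum fun d₃ => coinSum fun h₃ =>
        F (X.bandState a k ω) ((X.sweep ω).D (a + 1) (k + 7)) ((X.sweep ω).H (a + 2) (k + 5))
          d₂ h₂ d₃ h₃)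
      (fun b ω => by
        simp only [X.setD_H, X.setD_D (r := a + 2) (x := k + 5) (by omega) (by omega) (by omega)
          (by omega), X.bandState_setD (a := a) (k := k) (r := a + 2) (x := k + 5) (by omega)
          (by omega) (by omega) (by omega) (by omega)]
        simp),
    ← X.sum_coinH (r := a + 3) (x := k + 3) (by omega) (by omega) (by omega) (by omega)
      (fun ω h₂ => coinSum fun d₃ => coinSum fun h₃ =>
        F (X.bandState a k ω) ((X.sweep ω).D (a + 1) (k + 7)) ((X.sweep ω).H (a + 2) (k + 5))
          ((X.sweep ω).D (a + 2) (k + 5)) h₂ d₃ h₃)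
      (fun b ω => by
        simp only [X.setH_D, X.setH_H (r := a + 3) (x := k + 3) (by omega) (by omega) (by omega)
          (by omega), X.bandState_setH (a := a) (k := k) (r := a + 3) (x := k + 3) (by omega)
          (by omega) (by omega) (by omega) (by omega)]
        simp),
    ← X.sum_coinD (r := a + 3) (x := k + 3) (by omega) (by omega) (by omega) (by omega)
      (fun ω d₃ => coinSum fun h₃ =>
        F (X.bandState a k ω) ((X.sweep ω).D (a + 1) (k + 7)) ((X.sweep ω).H (a + 2) (k + 5))
          ((X.sweep ω).D (a + 2) (k + 5)) ((X.sweep ω).H (a + 3) (k + 3)) d₃ h₃)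
      (fun b ω => by
        simp only [X.setD_H, X.setD_D (r := a + 3) (x := k + 3) (by omega) (by omega) (by omega)
          (by omega), X.bandState_setD (a := a) (k := k) (r := a + 3) (x := k + 3) (by omega)
          (by omega) (by omega) (by omega) (by omega)]
        simp),
    ← X.sum_coinH (r := a + 4) (x := k + 1) (by omega) (by omega) (by omega) (by omega)
      (fun ω h₃ =>
        F (X.bandState a k ω) ((X.sweep ω).D (a + 1) (k + 7)) ((X.sweep ω).H (a + 2) (k + 5))
          ((X.sweep ω).D (a + 2) (k + 5)) ((X.sweep ω).H (a + 3) (k + 3))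
          ((X.sweep ω).D (a + 3) (k + 3)) h₃)
      (fun b ω => by
        simp only [X.setH_D, X.setH_H (r := a + 4) (x := k + 1) (by omega) (by omega) (by omega)
          (by omega), X.bandState_setH (a := a) (k := k) (r := a + 4) (x := k + 1) (by omega)
          (by omega) (by omega) (by omega) (by omega)]
        simp)]
  ring

/-- The band potential along a band. -/
def bandSum (φ : BandPotential) (a k : ℕ) : ℕ :=
  ∑ ω, φ ((X.sweep ω).provisional (a + 2) (k + 5)) ((X.sweep ω).offer (a + 1) (k + 6))
    ((X.sweep ω).provisional (a + 3) (k + 3)) ((X.sweep ω).offer (a + 2) (k + 4))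
    ((X.sweep ω).provisional (a + 4) (k + 1)) ((X.sweep ω).offer (a + 3) (k + 2))

/-- The link potential along a band. -/
def linkSum (g : LinkPotential) (a k : ℕ) : ℕ :=
  ∑ ω, g ((X.sweep ω).state (a + 1) (k + 4)) ((X.sweep ω).provisional (a + 2) (k + 2))
    ((X.sweep ω).offer (a + 1) (k + 3)) ((X.sweep ω).provisional (a + 3) k)
    ((X.sweep ω).offer (a + 2) (k + 1))

/-- The total cost of a step. -/
def costSum (cost : VertexState → Offer → VertexState → Bool → Bool → ℕ) (r x : ℕ) : ℕ :=
  ∑ ω, (X.sweep ω).stepCost cost r x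

/-- The certificate holds pointwise in every state, and the six coins are independent of the state,
so it may be summed over all outcomes. The shift of the link potential from `(a, k + 3)` to `(a + 1,
k + 1)` reflects the lag of two columns per row. -/
theorem band_step {cost : VertexState → Offer → VertexState → Bool → Bool → ℕ} {s C : ℕ}
    {φ : BandPotential} {g : LinkPotential} (h : bandCheck cost s C φ g = true) {a k : ℕ}
    (ha : a + 4 ≤ n) (hk : k + 7 ≤ n) :
    64 * (s * X.costSum cost (a + 2) (k + 5) + X.linkSum g (a + 1) (k + 1) +
        X.bandSum φ a (k + 1)) ≤
      64 * (X.bandSum φ a k + X.linkSum g a (k + 3)) + C * Fintype.card Ω := by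
  have step1 : ∀ ω, rowStep ((X.sweep ω).provisional (a + 2) (k + 5))
      ((X.sweep ω).offer (a + 1) (k + 6)) ((X.sweep ω).state (a + 1) (k + 7))
      ((X.sweep ω).D (a + 1) (k + 7)) ((X.sweep ω).H (a + 2) (k + 5)) =
      ((X.sweep ω).state (a + 2) (k + 5), (X.sweep ω).provisional (a + 2) (k + 6),
        (X.sweep ω).offer (a + 1) (k + 7)) := fun ω =>
    (X.sweep ω).rowStep_eq (r := a + 2) (x := k + 5) (by omega) (by omega) (by omega)
  have step2 : ∀ ω, rowStep ((X.sweep ω).provisional (a + 3) (k + 3))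
      ((X.sweep ω).offer (a + 2) (k + 4)) ((X.sweep ω).state (a + 2) (k + 5))
      ((X.sweep ω).D (a + 2) (k + 5)) ((X.sweep ω).H (a + 3) (k + 3)) =
      ((X.sweep ω).state (a + 3) (k + 3), (X.sweep ω).provisional (a + 3) (k + 4),
        (X.sweep ω).offer (a + 2) (k + 5)) := fun ω =>
    (X.sweep ω).rowStep_eq (r := a + 3) (x := k + 3) (by omega) (by omega) (by omega)
  have step3 : ∀ ω, rowStep ((X.sweep ω).provisional (a + 4) (k + 1))
      ((X.sweep ω).offer (a + 3) (k + 2)) ((X.sweep ω).state (a + 3) (k + 3))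
      ((X.sweep ω).D (a + 3) (k + 3)) ((X.sweep ω).H (a + 4) (k + 1)) =
      ((X.sweep ω).state (a + 4) (k + 1), (X.sweep ω).provisional (a + 4) (k + 2),
        (X.sweep ω).offer (a + 3) (k + 3)) := fun ω =>
    (X.sweep ω).rowStep_eq (r := a + 4) (x := k + 1) (by omega) (by omega) (by omega)
  have hfirst := X.sum_first ha hk fun st d₁ h₁ =>
    s * cost st.2.1 st.2.2.1 st.1 d₁ h₁ +
      g (rowStep st.2.1 st.2.2.1 st.1 d₁ h₁).1 st.2.2.2.1 st.2.2.2.2.1 st.2.2.2.2.2.1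
        st.2.2.2.2.2.2
  have hband := X.sum_band ha hk fun st d₁ h₁ d₂ h₂ d₃ h₃ =>
    rowStepThen st.2.1 st.2.2.1 st.1 d₁ h₁ fun y₁ u₁ f₁ =>
      rowStepThen st.2.2.2.1 st.2.2.2.2.1 y₁ d₂ h₂ fun y₂ u₂ f₂ =>
        rowStepThen st.2.2.2.2.2.1 st.2.2.2.2.2.2 y₂ d₃ h₃ fun _ u₃ f₃ => φ u₁ f₁ u₂ f₂ u₃ f₃
  simp only [bandState, step1, step2, step3, rowStepThen_eq] at hfirst hband
  have hcost : ∑ ω, (s * cost ((X.sweep ω).provisional (a + 2) (k + 5))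
        ((X.sweep ω).offer (a + 1) (k + 6)) ((X.sweep ω).state (a + 1) (k + 7))
        ((X.sweep ω).D (a + 1) (k + 7)) ((X.sweep ω).H (a + 2) (k + 5)) +
      g ((X.sweep ω).state (a + 2) (k + 5)) ((X.sweep ω).provisional (a + 3) (k + 3))
        ((X.sweep ω).offer (a + 2) (k + 4)) ((X.sweep ω).provisional (a + 4) (k + 1))
        ((X.sweep ω).offer (a + 3) (k + 2))) =
      s * X.costSum cost (a + 2) (k + 5) + X.linkSum g (a + 1) (k + 1) := by
    rw [Finset.sum_add_distrib, ← Finset.mul_sum]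
    rfl
  rw [hcost] at hfirst
  have hφ : X.bandSum φ a (k + 1) = ∑ ω, φ ((X.sweep ω).provisional (a + 2) (k + 6))
      ((X.sweep ω).offer (a + 1) (k + 7)) ((X.sweep ω).provisional (a + 3) (k + 4))
      ((X.sweep ω).offer (a + 2) (k + 5)) ((X.sweep ω).provisional (a + 4) (k + 2))
      ((X.sweep ω).offer (a + 3) (k + 3)) := rfl
  rw [← hφ] at hband
  have hsum := Finset.sum_le_sum fun ω (_ : ω ∈ Finset.univ) =>
    Nat.le_of_ble_eq_true (bandInequality_of_bandCheck h ((X.sweep ω).state (a + 1) (k + 7))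
      ((X.sweep ω).provisional (a + 2) (k + 5)) ((X.sweep ω).offer (a + 1) (k + 6))
      ((X.sweep ω).provisional (a + 3) (k + 3)) ((X.sweep ω).offer (a + 2) (k + 4))
      ((X.sweep ω).provisional (a + 4) (k + 1)) ((X.sweep ω).offer (a + 3) (k + 2)))
  simp only [rowStepThen_eq] at hsum
  have hright : ∑ ω, (64 * φ ((X.sweep ω).provisional (a + 2) (k + 5))
        ((X.sweep ω).offer (a + 1) (k + 6)) ((X.sweep ω).provisional (a + 3) (k + 3))
        ((X.sweep ω).offer (a + 2) (k + 4)) ((X.sweep ω).provisional (a + 4) (k + 1))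
        ((X.sweep ω).offer (a + 3) (k + 2)) +
      64 * g ((X.sweep ω).state (a + 1) (k + 7)) ((X.sweep ω).provisional (a + 2) (k + 5))
        ((X.sweep ω).offer (a + 1) (k + 6)) ((X.sweep ω).provisional (a + 3) (k + 3))
        ((X.sweep ω).offer (a + 2) (k + 4)) + C) =
      64 * (X.bandSum φ a k + X.linkSum g a (k + 3)) + C * Fintype.card Ω := by
    rw [Finset.sum_add_distrib, Finset.sum_add_distrib, ← Finset.mul_sum, ← Finset.mul_sum,
      Finset.sum_const, Finset.card_univ, smul_eq_mul, mul_add, mul_comm C]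
    rfl
  rw [hright] at hsum
  refine le_trans (le_of_eq ?_) hsum
  -- Cost and link potential involve only the first two coins, so four outcomes are summed and the
  -- factor 16 stands for the other four coins.
  calc 64 * (s * X.costSum cost (a + 2) (k + 5) + X.linkSum g (a + 1) (k + 1) +
        X.bandSum φ a (k + 1))
      = 16 * (4 * (s * X.costSum cost (a + 2) (k + 5) + X.linkSum g (a + 1) (k + 1))) +
        64 * X.bandSum φ a (k + 1) := by ring
    _ = _ := by
      rw [hfirst, hband, Finset.mul_sum, ← Finset.sum_add_distrib]
      refine Finset.sum_congr rfl fun ω _ => ?_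
      simp only [coinSum]
      ring

end SweepFamily

/-- Telescoping of the band inequalities. -/
theorem telescope {s c B : ℕ} {A Φ Γ : ℕ → ℕ → ℕ} (hΦ : ∀ a k, Φ a k ≤ B) (hΓ : ∀ a k, Γ a k ≤ B)
    (p q : ℕ) (h : ∀ a < p, ∀ k < q,
      64 * (s * A a k + Γ (a + 1) (k + 1) + Φ a (k + 1)) ≤ 64 * (Φ a k + Γ a (k + 3)) + c) :
    64 * (s * ∑ a ∈ Finset.range p, ∑ k ∈ Finset.range q, A a k) ≤
      c * p * q + 64 * B * (3 * p + q) := by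
  -- Along a row the band potential telescopes, leaving only its initial value.
  have hrow : ∀ a < p, ∀ m ≤ q,
      64 * (s * (∑ k ∈ Finset.range m, A a k) + ∑ k ∈ Finset.range m, Γ (a + 1) (k + 1) + Φ a m) ≤
        64 * (∑ k ∈ Finset.range m, Γ a (k + 3)) + 64 * Φ a 0 + c * m := by
    intro a ha m hm
    induction m with
    | zero => simp
    | succ m ih =>
      have h1 := ih (by omega)
      have h2 := h a ha m (by omega)
      simp only [Finset.sum_range_succ, mul_add] at h1 h2 ⊢
      linarith
  -- The two ranges of columns differ by two terms at each end, which costs at most `2 * B` per row.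
  -- Together with the initial band potential this gives the `3 * p` in the error; the `q` comes
  -- from the link potential of the first row.
  have hshift : ∀ a, ∑ k ∈ Finset.range q, Γ a (k + 3) ≤
      ∑ k ∈ Finset.range q, Γ a (k + 1) + 2 * B := by
    intro a
    have h1 : ∑ k ∈ Finset.range (q + 2), Γ a (k + 1) =
        ∑ k ∈ Finset.range q, Γ a (k + 1) + Γ a (q + 1) + Γ a (q + 2) := by
      rw [Finset.sum_range_succ, Finset.sum_range_succ]
    have h2 : ∑ k ∈ Finset.range (q + 2), Γ a (k + 1) =
        ∑ k ∈ Finset.range q, Γ a (k + 3) + Γ a 2 + Γ a 1 := by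
      rw [Finset.sum_range_succ', Finset.sum_range_succ']
    have h3 := hΓ a (q + 1)
    have h4 := hΓ a (q + 2)
    omega
  have hall : ∀ m ≤ p, 64 * (s * ∑ a ∈ Finset.range m, ∑ k ∈ Finset.range q, A a k) +
      64 * ∑ k ∈ Finset.range q, Γ m (k + 1) ≤
        64 * ∑ k ∈ Finset.range q, Γ 0 (k + 1) + m * (c * q + 64 * (3 * B)) := by
    intro m hm
    induction m with
    | zero => simp
    | succ m ih =>
      have h1 := ih (by omega)
      have h2 := hrow m (by omega) q le_rfl
      have h3 := hshift m
      have h4 := hΦ m 0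
      simp only [Finset.sum_range_succ, mul_add, add_mul] at h1 h2 ⊢
      nlinarith
  have h0 : ∑ k ∈ Finset.range q, Γ 0 (k + 1) ≤ q * B := by
    calc ∑ k ∈ Finset.range q, Γ 0 (k + 1) ≤ ∑ _k ∈ Finset.range q, B :=
          Finset.sum_le_sum fun k _ => hΓ _ _
      _ = q * B := by simp
  have := hall p le_rfl
  calc 64 * (s * ∑ a ∈ Finset.range p, ∑ k ∈ Finset.range q, A a k)
      ≤ 64 * (q * B) + p * (c * q + 64 * (3 * B)) := by omega
    _ = c * p * q + 64 * B * (3 * p + q) := by ring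

namespace SweepFamily

variable {n : ℕ} {Ω : Type*} [Fintype Ω] (X : SweepFamily n Ω)

/-- The certified bound for the total cost of all steps in the interior. -/
theorem sum_costSum_le {cost : VertexState → Offer → VertexState → Bool → Bool → ℕ} {s C : ℕ}
    {φ : BandPotential} {g : LinkPotential} (h : bandCheck cost s C φ g = true) {B : ℕ}
    (hφ : ∀ t₁ e₁ t₂ e₂ t₃ e₃, φ t₁ e₁ t₂ e₂ t₃ e₃ ≤ B) (hg : ∀ x t₁ e₁ t₂ e₂, g x t₁ e₁ t₂ e₂ ≤ B)
    {p q : ℕ} (hp : p + 3 ≤ n) (hq : q + 6 ≤ n) :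
    64 * (s * ∑ a ∈ Finset.range p, ∑ k ∈ Finset.range q, X.costSum cost (a + 2) (k + 5)) ≤
      (C * (p * q) + 64 * B * (3 * p + q)) * Fintype.card Ω := by
  refine (telescope (c := C * Fintype.card Ω) (B := B * Fintype.card Ω) (Φ := X.bandSum φ)
    (Γ := X.linkSum g) (fun a k => ?_) (fun a k => ?_) p q
    fun a ha k hk => X.band_step h (by omega) (by omega)).trans (le_of_eq (by ring))
  · refine (Finset.sum_le_card_nsmul _ _ B fun ω _ => hφ _ _ _ _ _ _).trans (le_of_eq ?_)
    rw [smul_eq_mul, Finset.card_univ, mul_comm]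
  · refine (Finset.sum_le_card_nsmul _ _ B fun ω _ => hg _ _ _ _ _).trans (le_of_eq ?_)
    rw [smul_eq_mul, Finset.card_univ, mul_comm]

end SweepFamily

/-! ### From a stable matching of cells to a sweep -/

/-- Adjacency of cells in the grid with rows and columns `1, …, n`. -/
def CellAdj (n : ℕ) (p q : ℕ × ℕ) : Prop :=
  inGrid n p.1 p.2 = true ∧ inGrid n q.1 q.2 = true ∧
    (q = (p.1, p.2 + 1) ∨ q = (p.1 + 1, p.2) ∨ p = (q.1, q.2 + 1) ∨ p = (q.1 + 1, q.2))

/-- `w` precedes `v` in the numbering row by row. -/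
def CellLT (w v : ℕ × ℕ) : Prop := w.1 < v.1 ∨ (w.1 = v.1 ∧ w.2 < v.2)

/-- The preferences of cells: heavy edges first, then cells with a small number. -/
def CellPrefers (heavy : ℕ × ℕ → ℕ × ℕ → Prop) (u w v : ℕ × ℕ) : Prop :=
  (heavy u w ∧ ¬ heavy u v) ∨ ((heavy u w ↔ heavy u v) ∧ CellLT w v)

section CellMatching

open Classical

variable {n : ℕ} {heavy m : ℕ × ℕ → ℕ × ℕ → Prop}

theorem CellAdj.cases {r x : ℕ} {w : ℕ × ℕ} (h : CellAdj n (r, x) w) :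
    w = (r, x + 1) ∨ w = (r + 1, x) ∨ (2 ≤ x ∧ w = (r, x - 1)) ∨ (2 ≤ r ∧ w = (r - 1, x)) := by
  obtain ⟨h1, h2, h | h | h | h⟩ := h
  · exact Or.inl h
  · exact Or.inr (Or.inl h)
  · obtain ⟨a, b⟩ := w
    simp only [Prod.mk.injEq, inGrid, decide_eq_true_eq] at h h2 ⊢
    right; right; left; omega
  · obtain ⟨a, b⟩ := w
    simp only [Prod.mk.injEq, inGrid, decide_eq_true_eq] at h h2 ⊢
    right; right; right; omega

theorem matched_left_iff (hm : IsStable (CellAdj n) (CellPrefers heavy) m) {r x : ℕ} :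
    m (r, x - 1) (r, x - 1 + 1) ↔ 2 ≤ x ∧ m (r, x) (r, x - 1) := by
  constructor
  · intro h
    have h1 := (hm.rel h).1
    simp only [inGrid, decide_eq_true_eq] at h1
    refine ⟨by omega, ?_⟩
    rw [show x - 1 + 1 = x by omega] at h
    exact hm.symm h
  · rintro ⟨h1, h⟩
    rw [show x - 1 + 1 = x by omega]
    exact hm.symm h

theorem matched_up_iff (hm : IsStable (CellAdj n) (CellPrefers heavy) m) {r x : ℕ} :
    m (r - 1, x) (r - 1 + 1, x) ↔ 2 ≤ r ∧ m (r, x) (r - 1, x) := by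
  constructor
  · intro h
    have h1 := (hm.rel h).1
    simp only [inGrid, decide_eq_true_eq] at h1
    refine ⟨by omega, ?_⟩
    rw [show r - 1 + 1 = r by omega] at h
    exact hm.symm h
  · rintro ⟨h1, h⟩
    rw [show r - 1 + 1 = r by omega]
    exact hm.symm h

theorem heavy_left_iff (hsymm : ∀ {p q}, heavy p q → heavy q p) {r x : ℕ} (hx : 2 ≤ x) :
    heavy (r, x - 1) (r, x - 1 + 1) ↔ heavy (r, x) (r, x - 1) := by
  rw [show x - 1 + 1 = x by omega]
  exact ⟨hsymm, hsymm⟩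

theorem heavy_up_iff (hsymm : ∀ {p q}, heavy p q → heavy q p) {r x : ℕ} (hr : 2 ≤ r) :
    heavy (r - 1, x) (r - 1 + 1, x) ↔ heavy (r, x) (r - 1, x) := by
  rw [show r - 1 + 1 = r by omega]
  exact ⟨hsymm, hsymm⟩

theorem isLight_iff (hsymm : ∀ {p q}, heavy p q → heavy q p)
    (hm : IsStable (CellAdj n) (CellPrefers heavy) m) (r x : ℕ) :
    isLight n (fun r x => decide (m (r, x) (r, x + 1) ∧ heavy (r, x) (r, x + 1)))
      (fun r x => decide (m (r, x) (r + 1, x) ∧ heavy (r, x) (r + 1, x))) r x = true ↔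
      inGrid n r x = true ∧ ∀ w, m (r, x) w → ¬ heavy (r, x) w := by
  simp only [isLight, Bool.and_eq_true, Bool.not_eq_true', decide_eq_false_iff_not,
    matched_left_iff hm, matched_up_iff hm]
  constructor
  · rintro ⟨⟨⟨⟨h0, h1⟩, h2⟩, h3⟩, h4⟩
    refine ⟨h0, fun w hw hh => ?_⟩
    rcases (hm.rel hw).cases with rfl | rfl | ⟨hx, rfl⟩ | ⟨hr, rfl⟩
    · exact h3 ⟨hw, hh⟩
    · exact h4 ⟨hw, hh⟩
    · exact h2 ⟨⟨hx, hw⟩, (heavy_left_iff (heavy := heavy) hsymm hx).2 hh⟩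
    · exact h1 ⟨⟨hr, hw⟩, (heavy_up_iff (heavy := heavy) hsymm hr).2 hh⟩
  · rintro ⟨h0, h⟩
    refine ⟨⟨⟨⟨h0, ?_⟩, ?_⟩, fun h' => h _ h'.1 h'.2⟩, fun h' => h _ h'.1 h'.2⟩
    · rintro ⟨⟨h1, h2⟩, h3⟩
      exact h _ h2 ((heavy_up_iff (heavy := heavy) hsymm h1).1 h3)
    · rintro ⟨⟨h1, h2⟩, h3⟩
      exact h _ h2 ((heavy_left_iff (heavy := heavy) hsymm h1).1 h3)

variable (hsymm : ∀ {p q}, heavy p q → heavy q p) (hadj : ∀ {p q}, heavy p q → CellAdj n p q)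
  (hm : IsStable (CellAdj n) (CellPrefers heavy) m)

/-- The sweep of a stable matching of cells. -/
def cellSweep : Sweep n where
  D := fun r x => decide (heavy (r, x) (r + 1, x))
  H := fun r x => decide (heavy (r, x) (r, x + 1))
  hh := fun r x => decide (m (r, x) (r, x + 1) ∧ heavy (r, x) (r, x + 1))
  hv := fun r x => decide (m (r, x) (r + 1, x) ∧ heavy (r, x) (r + 1, x))
  lh := fun r x => decide (m (r, x) (r, x + 1) ∧ ¬ heavy (r, x) (r, x + 1))
  lv := fun r x => decide (m (r, x) (r + 1, x) ∧ ¬ heavy (r, x) (r + 1, x))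
  D_range := fun r x h => by
    have h := hadj (of_decide_eq_true h)
    have h1 := h.1
    have h2 := h.2.1
    simp only [inGrid, decide_eq_true_eq] at h1 h2
    omega
  H_range := fun r x h => by
    have h := hadj (of_decide_eq_true h)
    have h1 := h.1
    have h2 := h.2.1
    simp only [inGrid, decide_eq_true_eq] at h1 h2
    omega
  hh_eq := fun r x => by
    rw [Bool.eq_iff_iff]
    simp only [Bool.and_eq_true, Bool.not_eq_true', decide_eq_false_iff_not, decide_eq_true_eq,
      matched_left_iff hm, matched_up_iff hm]
    constructor
    · rintro ⟨h1, h2⟩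
      refine ⟨⟨⟨h2, fun h => ?_⟩, fun h => ?_⟩, fun h => ?_⟩
      · have := hm.unique h1 h.1.2
        simp at this
      · have := hm.unique (hm.symm h1) h.1.2
        simp at this
      · have := hm.unique h1 h.1.2
        simp only [Prod.mk.injEq] at this
        omega
    -- A blocking partner would be joined by a heavy edge and have a smaller number. The only
    -- candidates are the cells above either end and the cell to the left, and these are what the
    -- Boolean factors exclude.
    · rintro ⟨⟨⟨h2, h3⟩, h4⟩, h5⟩
      refine ⟨?_, h2⟩
      by_contra hno
      rcases hm.blocked (hadj h2) hno with ⟨w, hw, hb⟩ | ⟨w, hw, hb⟩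
      · have hb' : heavy (r, x) w ∧ CellLT w (r, x + 1) := by
          rcases hb with hb | hb
          · exact absurd h2 hb.2
          · exact ⟨hb.1.2 h2, hb.2⟩
        have hlt := hb'.2
        rcases (hm.rel hw).cases with rfl | rfl | ⟨hx, rfl⟩ | ⟨hr, rfl⟩
        · exact hno hw
        · simp only [CellLT] at hlt; omega
        · exact h5 ⟨⟨hx, hw⟩, (heavy_left_iff (heavy := heavy) hsymm hx).2 hb'.1⟩
        · exact h3 ⟨⟨hr, hw⟩, (heavy_up_iff (heavy := heavy) hsymm hr).2 hb'.1⟩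
      · have hb' : heavy (r, x + 1) w ∧ CellLT w (r, x) := by
          rcases hb with hb | hb
          · exact absurd (hsymm h2) hb.2
          · exact ⟨hb.1.2 (hsymm h2), hb.2⟩
        have hlt := hb'.2
        rcases (hm.rel hw).cases with rfl | rfl | ⟨hx, rfl⟩ | ⟨hr, rfl⟩
        · simp only [CellLT] at hlt; omega
        · simp only [CellLT] at hlt; omega
        · simp only [CellLT] at hlt; omega
        · exact h4 ⟨⟨hr, hw⟩, (heavy_up_iff (heavy := heavy) hsymm hr).2 hb'.1⟩
  hv_eq := fun r x => by
    rw [Bool.eq_iff_iff]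
    simp only [Bool.and_eq_true, Bool.not_eq_true', decide_eq_false_iff_not, decide_eq_true_eq,
      matched_left_iff hm, matched_up_iff hm]
    constructor
    · rintro ⟨h1, h2⟩
      refine ⟨⟨⟨h2, fun h => ?_⟩, fun h => ?_⟩, fun h => ?_⟩
      · have := hm.unique h1 h.1.2
        simp only [Prod.mk.injEq] at this
        omega
      · have := hm.unique h1 h.1.2
        simp at this
      · have := hm.unique h1 h.1
        simp at this
    · rintro ⟨⟨⟨h2, h3⟩, h4⟩, h5⟩
      refine ⟨?_, h2⟩
      by_contra hno
      rcases hm.blocked (hadj h2) hno with ⟨w, hw, hb⟩ | ⟨w, hw, hb⟩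
      · have hb' : heavy (r, x) w ∧ CellLT w (r + 1, x) := by
          rcases hb with hb | hb
          · exact absurd h2 hb.2
          · exact ⟨hb.1.2 h2, hb.2⟩
        have hlt := hb'.2
        rcases (hm.rel hw).cases with rfl | rfl | ⟨hx, rfl⟩ | ⟨hr, rfl⟩
        · exact h5 ⟨hw, hb'.1⟩
        · exact hno hw
        · exact h4 ⟨⟨hx, hw⟩, (heavy_left_iff (heavy := heavy) hsymm hx).2 hb'.1⟩
        · exact h3 ⟨⟨hr, hw⟩, (heavy_up_iff (heavy := heavy) hsymm hr).2 hb'.1⟩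
      -- The upper cell has the smallest number among the neighbours of the lower one, so the lower
      -- cell cannot prefer anybody else.
      · have hlt : CellLT w (r, x) := by
          rcases hb with hb | hb
          · exact absurd (hsymm h2) hb.2
          · exact hb.2
        rcases (hm.rel hw).cases with rfl | rfl | ⟨hx, rfl⟩ | ⟨hr, rfl⟩ <;>
          (simp only [CellLT] at hlt; omega)
  lh_eq := fun r x => by
    rw [Bool.eq_iff_iff]
    simp only [Bool.and_eq_true, isLight_iff hsymm hm]
    simp only [Bool.not_eq_true', decide_eq_false_iff_not, decide_eq_true_eq,
      matched_left_iff hm, matched_up_iff hm]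
    constructor
    · rintro ⟨h1, h2⟩
      have h1' := hm.symm h1
      refine ⟨⟨⟨⟨⟨(hm.rel h1).1, fun w hw => ?_⟩, (hm.rel h1).2.1, fun w hw => ?_⟩, fun h => ?_⟩,
        fun h => ?_⟩, fun h => ?_⟩
      · rwa [← hm.unique h1 hw]
      · rw [← hm.unique h1' hw]
        exact fun h => h2 (hsymm h)
      · have := hm.unique h1 h.1.2
        simp at this
      · have := hm.unique h1' h.1.2
        simp at this
      · have := hm.unique h1 h.1.2
        simp only [Prod.mk.injEq] at this
        omega
    · rintro ⟨⟨⟨⟨⟨g1, l1⟩, g2, l2⟩, h3⟩, h4⟩, h5⟩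
      have hA : CellAdj n (r, x) (r, x + 1) := ⟨g1, g2, Or.inl rfl⟩
      have hmm : m (r, x) (r, x + 1) := by
        by_contra hno
        -- Both ends are light, so a preferred partner can win only by its number.
        rcases hm.blocked hA hno with ⟨w, hw, hb⟩ | ⟨w, hw, hb⟩
        · have hlt : CellLT w (r, x + 1) := by
            rcases hb with hb | hb
            · exact absurd hb.1 (l1 w hw)
            · exact hb.2
          rcases (hm.rel hw).cases with rfl | rfl | ⟨hx, rfl⟩ | ⟨hr, rfl⟩
          · exact hno hw
          · simp only [CellLT] at hlt; omega
          · exact h5 ⟨⟨hx, hw⟩, fun h => l1 _ hw ((heavy_left_iff (heavy := heavy) hsymm hx).1 h)⟩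
          · exact h3 ⟨⟨hr, hw⟩, fun h => l1 _ hw ((heavy_up_iff (heavy := heavy) hsymm hr).1 h)⟩
        · have hlt : CellLT w (r, x) := by
            rcases hb with hb | hb
            · exact absurd hb.1 (l2 w hw)
            · exact hb.2
          rcases (hm.rel hw).cases with rfl | rfl | ⟨hx, rfl⟩ | ⟨hr, rfl⟩
          · simp only [CellLT] at hlt; omega
          · simp only [CellLT] at hlt; omega
          · simp only [CellLT] at hlt; omega
          · exact h4 ⟨⟨hr, hw⟩, fun h => l2 _ hw ((heavy_up_iff (heavy := heavy) hsymm hr).1 h)⟩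
      exact ⟨hmm, l1 _ hmm⟩
  lv_eq := fun r x => by
    rw [Bool.eq_iff_iff]
    simp only [Bool.and_eq_true, isLight_iff hsymm hm]
    simp only [Bool.not_eq_true', decide_eq_false_iff_not, decide_eq_true_eq,
      matched_left_iff hm, matched_up_iff hm]
    constructor
    · rintro ⟨h1, h2⟩
      have h1' := hm.symm h1
      refine ⟨⟨⟨⟨⟨(hm.rel h1).1, fun w hw => ?_⟩, (hm.rel h1).2.1, fun w hw => ?_⟩, fun h => ?_⟩,
        fun h => ?_⟩, fun h => ?_⟩
      · rwa [← hm.unique h1 hw]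
      · rw [← hm.unique h1' hw]
        exact fun h => h2 (hsymm h)
      · have := hm.unique h1 h.1.2
        simp only [Prod.mk.injEq] at this
        omega
      · have := hm.unique h1 h.1.2
        simp at this
      · have := hm.unique h1 h.1
        simp at this
    · rintro ⟨⟨⟨⟨⟨g1, l1⟩, g2, l2⟩, h3⟩, h4⟩, h5⟩
      have hA : CellAdj n (r, x) (r + 1, x) := ⟨g1, g2, Or.inr (Or.inl rfl)⟩
      have hmm : m (r, x) (r + 1, x) := by
        by_contra hno
        rcases hm.blocked hA hno with ⟨w, hw, hb⟩ | ⟨w, hw, hb⟩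
        · rcases (hm.rel hw).cases with rfl | rfl | ⟨hx, rfl⟩ | ⟨hr, rfl⟩
          · exact h5 ⟨hw, l1 _ hw⟩
          · exact hno hw
          · exact h4 ⟨⟨hx, hw⟩, fun h => l1 _ hw ((heavy_left_iff (heavy := heavy) hsymm hx).1 h)⟩
          · exact h3 ⟨⟨hr, hw⟩, fun h => l1 _ hw ((heavy_up_iff (heavy := heavy) hsymm hr).1 h)⟩
        · have hlt : CellLT w (r, x) := by
            rcases hb with hb | hb
            · exact absurd hb.1 (l2 w hw)
            · exact hb.2
          rcases (hm.rel hw).cases with rfl | rfl | ⟨hx, rfl⟩ | ⟨hr, rfl⟩ <;>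
            (simp only [CellLT] at hlt; omega)
      exact ⟨hmm, l1 _ hmm⟩

/-- This turns the lightness of the sweep into a statement on heavy partners, which is the form
needed for counting vertices. -/
theorem cellSweep_light_iff (r x : ℕ) : (cellSweep hsymm hadj hm).light r x = true ↔
    inGrid n r x = true ∧ ∀ w, m (r, x) w → ¬ heavy (r, x) w :=
  isLight_iff hsymm hm r x

/-- An unmatched cell waits for the cell below in vain. -/
theorem cellSweep_unmatched {r x : ℕ} (hg : inGrid n r x = true) (h : ∀ w, ¬ m (r, x) w) :
    (cellSweep hsymm hadj hm).waits r x = true ∧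
      (cellSweep hsymm hadj hm).light (r + 1) x = false := by
  have hw : (cellSweep hsymm hadj hm).waits r x = true := by
    rw [Sweep.waits, (cellSweep_light_iff hsymm hadj hm r x).2 ⟨hg, fun w hw => absurd hw (h w)⟩]
    simp only [cellSweep, matched_left_iff hm, matched_up_iff hm, h]
    simp
  refine ⟨hw, ?_⟩
  have := (cellSweep hsymm hadj hm).lv_eq_waits r x
  rw [hw, Bool.true_and] at this
  rw [← this]
  simp [cellSweep, h]

end CellMatching

/-! ### Means over fair coins -/

section CoinMean

variable {E E' : Type*} [Fintype E] [DecidableEq E] [Fintype E'] [DecidableEq E']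

/-- The mean of a function of fair coins. -/
def coinMean (f : (E → Fin 2) → ℝ) : ℝ := (∑ c, f c) / 2 ^ Fintype.card E

theorem coinMean_mono {f g : (E → Fin 2) → ℝ} (h : ∀ c, f c ≤ g c) : coinMean f ≤ coinMean g := by
  unfold coinMean
  gcongr
  exact h _

theorem coinMean_const (a : ℝ) : coinMean (fun _ : E → Fin 2 => a) = a := by
  simp [coinMean]

theorem coinMean_add (f g : (E → Fin 2) → ℝ) :
    coinMean (fun c => f c + g c) = coinMean f + coinMean g := by
  simp [coinMean, Finset.sum_add_distrib, add_div]

theorem coinMean_mul (a : ℝ) (f : (E → Fin 2) → ℝ) :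
    coinMean (fun c => a * f c) = a * coinMean f := by
  simp [coinMean, ← Finset.mul_sum, mul_div_assoc]

theorem coinMean_sum {ι : Type*} (s : Finset ι) (f : ι → (E → Fin 2) → ℝ) :
    coinMean (fun c => ∑ i ∈ s, f i c) = ∑ i ∈ s, coinMean (f i) := by
  simp only [coinMean]
  rw [Finset.sum_comm, Finset.sum_div]

/-- The coins with indices in the range of an injection are fair coins. -/
theorem coinMean_comp {i : E' → E} (hi : Function.Injective i) (f : (E' → Fin 2) → ℝ) :
    coinMean (fun c : E → Fin 2 => f (c ∘ i)) = coinMean f := by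
  classical
  -- The coins split into those indexed by the range of `i` and the others, which contribute only a
  -- power of two.
  let φ : E' ⊕ {e : E // e ∉ Set.range i} ≃ E :=
    (Equiv.sumCongr (Equiv.ofInjective i hi) (Equiv.refl _)).trans
      (Equiv.sumCompl fun e => e ∈ Set.range i)
  have hφ : ∀ e, φ (Sum.inl e) = i e := fun e => rfl
  let ψ : (E → Fin 2) ≃ (E' → Fin 2) × ({e : E // e ∉ Set.range i} → Fin 2) :=
    (Equiv.arrowCongr φ.symm (Equiv.refl _)).trans (Equiv.sumArrowEquivProdArrow _ _ _)
  have hψ : ∀ c, (ψ c).1 = c ∘ i := fun c => by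
    funext e
    exact congrArg c (hφ e)
  have hcard : Fintype.card E = Fintype.card E' + Fintype.card {e : E // e ∉ Set.range i} := by
    rw [← Fintype.card_congr φ, Fintype.card_sum]
  unfold coinMean
  simp only [← hψ]
  rw [Equiv.sum_comp ψ (fun p => f p.1), Fintype.sum_prod_type]
  simp only [Finset.sum_const, Finset.card_univ, Fintype.card_fun, Fintype.card_fin, nsmul_eq_mul,
    ← Finset.mul_sum]
  rw [hcard, pow_add]
  push_cast
  rw [mul_comm, mul_div_mul_right _ _ (by positivity)]

/-- A single coin can be tossed again. -/
theorem two_mul_sum_eq (e : E) (F : (E → Fin 2) → ℕ) :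
    2 * ∑ c, F c =
      ∑ c, coinSum fun b => F (Function.update c e (if b = true then 1 else 0)) := by
  -- Setting the coin to both values yields the configuration itself and its flip, and flipping is a
  -- bijection.
  let flip : (E → Fin 2) ≃ (E → Fin 2) :=
    Function.Involutive.toPerm (fun c => Function.update c e (c e + 1)) fun c => by
      funext e'
      by_cases h : e' = e
      · subst h
        simp only [Function.update_self]
        generalize c e' = a
        revert a
        decide
      · simp [Function.update_of_ne h]
  have h : ∀ c, (coinSum fun b => F (Function.update c e (if b = true then 1 else 0))) =
      F c + F (flip c) := by
    intro c
    change F (Function.update c e (if false = true then 1 else 0)) +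
      F (Function.update c e (if true = true then 1 else 0)) =
      F c + F (Function.update c e (c e + 1))
    rcases Fin.exists_fin_two.1 ⟨c e, rfl⟩ with h | h
    · have : Function.update c e 0 = c := by rw [← h, Function.update_eq_self]
      simp [h, this]
    · have : Function.update c e 1 = c := by rw [← h, Function.update_eq_self]
      simp [h, this, add_comm]
  simp only [h]
  rw [Finset.sum_add_distrib, Equiv.sum_comp flip F, two_mul]

/-- A set of `k` coins is all tails with probability `2⁻ᵏ`. -/
theorem coinMean_tails (T : Finset E) :
    coinMean (fun c => if ∀ e ∈ T, c e = 0 then (1 : ℝ) else 0) = (1 / 2) ^ T.card := by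
  have hset : (Finset.univ.filter fun c : E → Fin 2 => ∀ e ∈ T, c e = 0) =
      Fintype.piFinset fun e => if e ∈ T then {0} else Finset.univ := by
    ext c
    simp only [Finset.mem_filter, Finset.mem_univ, true_and, Fintype.mem_piFinset]
    refine forall_congr' fun e => ?_
    split_ifs with h <;> simp [h]
  unfold coinMean
  rw [← Finset.sum_filter, Finset.sum_const, hset, Fintype.card_piFinset]
  have : ∀ e, (if e ∈ T then ({0} : Finset (Fin 2)) else Finset.univ).card =
      if e ∈ T then 1 else 2 := fun e => by split_ifs <;> simp
  simp only [this]
  rw [Finset.prod_ite, Finset.prod_const, Finset.prod_const, one_pow, one_mul]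
  have hc : (Finset.univ.filter fun e => e ∉ T).card + T.card = Fintype.card E := by
    rw [← Finset.card_compl_add_card T]
    congr 2
    ext e
    simp
  rw [← hc, pow_add, nsmul_eq_mul, mul_one]
  push_cast
  rw [div_mul_cancel_left₀ (by positivity), one_div, inv_pow]

end CoinMean

/-! ### Weights of matchings as counts of covered vertices -/

section Values

open Classical

variable {V : Type*} (G : SimpleGraph V)

theorem IsMatching.subset {M N : Set G.edgeSet} (hM : IsMatching G M) (h : N ⊆ M) :
    IsMatching G N := fun e he f hf => hM e (h he) f (h hf)

theorem isMatching_empty : IsMatching G ∅ := fun _ he => absurd he (Set.notMem_empty _)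

variable [Fintype V]

theorem integral_edgeLaw (f : (G.edgeSet → Fin 2) → ℝ) :
    ∫ c, f c ∂(edgeLaw G (PMF.uniformOfFintype (Fin 2))) = coinMean f := by
  unfold edgeLaw
  rw [integral_fintype (Integrable.of_finite), coinMean, Finset.sum_div]
  refine Finset.sum_congr rfl fun c _ => ?_
  rw [measureReal_def, Measure.pi_singleton]
  simp [PMF.uniformOfFintype_apply]
  ring

/-- The number of vertices on the edges of `M`. -/
def coveredCount (M : Set G.edgeSet) : ℕ :=
  (Finset.univ.filter fun v : V => ∃ e ∈ M, v ∈ (e : Sym2 V)).card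

/-- Double counting of incidences: an edge has two ends, and a vertex lies on at most one edge of a
matching. -/
theorem two_mul_card_eq {M : Set G.edgeSet} (hM : IsMatching G M) :
    (∑ e : G.edgeSet, if e ∈ M then (2 : ℝ) else 0) = coveredCount G M := by
  have hedge : ∀ e : G.edgeSet, (∑ v : V, if v ∈ (e : Sym2 V) then (1 : ℝ) else 0) = 2 := by
    rintro ⟨e, he⟩
    induction e using Sym2.ind with
    | _ a b =>
      have hab : a ≠ b := G.ne_of_adj he
      have : (Finset.univ.filter fun v => v ∈ s(a, b)) = {a, b} := by
        ext v
        simp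
      rw [Finset.sum_boole, this, Finset.card_pair hab]
      norm_num
  have hvert : ∀ v : V, (∑ e : G.edgeSet, if e ∈ M ∧ v ∈ (e : Sym2 V) then (1 : ℝ) else 0) =
      if ∃ e ∈ M, v ∈ (e : Sym2 V) then 1 else 0 := by
    intro v
    split_ifs with h
    · obtain ⟨e, he, hv⟩ := h
      rw [Finset.sum_eq_single e]
      · simp [he, hv]
      · intro f _ hne
        rw [if_neg]
        rintro ⟨hf, hv'⟩
        exact hne (hM f hf e he v hv' hv)
      · simp
    · refine Finset.sum_eq_zero fun e _ => if_neg fun h' => h ⟨e, h'⟩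
  calc (∑ e : G.edgeSet, if e ∈ M then (2 : ℝ) else 0)
      = ∑ e : G.edgeSet, ∑ v : V, if e ∈ M ∧ v ∈ (e : Sym2 V) then (1 : ℝ) else 0 := by
        refine Finset.sum_congr rfl fun e _ => ?_
        split_ifs with h
        · simp only [h, true_and, hedge]
        · simp [h]
    _ = ∑ v : V, ∑ e : G.edgeSet, if e ∈ M ∧ v ∈ (e : Sym2 V) then (1 : ℝ) else 0 :=
        Finset.sum_comm
    _ = coveredCount G M := by
        simp only [hvert]
        rw [Finset.sum_boole]
        rfl

/-- The weights `1` and `1 + Δ` given by coins. -/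
def coinWeight {E : Type*} (Δ : ℝ) (c : E → Fin 2) (e : E) : ℝ := ![1, 1 + Δ] (c e)

theorem coinWeight_eq {E : Type*} (Δ : ℝ) (c : E → Fin 2) (e : E) :
    coinWeight Δ c e = 1 + Δ * if c e = 1 then 1 else 0 := by
  unfold coinWeight
  rcases Fin.exists_fin_two.1 ⟨c e, rfl⟩ with h | h <;> simp [h]

/-- The weight of an edge is 1 plus Δ if it is heavy, and each edge accounts for two covered
vertices. This separates the problem into two counts that do not involve Δ as a factor. -/
theorem totalWeight_coinWeight (Δ : ℝ) (c : G.edgeSet → Fin 2) {M : Set G.edgeSet}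
    (hM : IsMatching G M) : totalWeight G (coinWeight Δ c) M =
      (coveredCount G M + Δ * coveredCount G {e ∈ M | c e = 1}) / 2 := by
  rw [← two_mul_card_eq G hM, ← two_mul_card_eq G (hM.subset G (Set.sep_subset _ _)),
    Finset.mul_sum, ← Finset.sum_add_distrib, Finset.sum_div]
  unfold totalWeight
  refine Finset.sum_congr rfl fun e _ => ?_
  rw [coinWeight_eq]
  by_cases h : e ∈ M <;> by_cases h' : c e = 1 <;> simp [h, h']
  ring

theorem coveredCount_le (M : Set G.edgeSet) : coveredCount G M ≤ Fintype.card V :=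
  Finset.card_le_univ _

theorem bddAbove_totalWeight (W : G.edgeSet → ℝ) :
    BddAbove (Set.range fun M : {M : Set G.edgeSet // IsMatching G M} => totalWeight G W M) :=
  (Set.finite_range _).bddAbove

theorem le_optimalValue (W : G.edgeSet → ℝ) {M : Set G.edgeSet} (hM : IsMatching G M) :
    totalWeight G W M ≤ optimalValue G W :=
  le_ciSup (bddAbove_totalWeight G W) ⟨M, hM⟩

theorem optimalValue_le {W : G.edgeSet → ℝ} {a : ℝ}
    (h : ∀ M, IsMatching G M → totalWeight G W M ≤ a) : optimalValue G W ≤ a :=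
  haveI : Nonempty {M : Set G.edgeSet // IsMatching G M} := ⟨⟨∅, isMatching_empty G⟩⟩
  ciSup_le fun M => h M.1 M.2

/-- The number of vertices that the greedy algorithm matches. -/
def greedyCount (idx : V ↪ ℕ) (W : G.edgeSet → ℝ) : ℕ :=
  (Finset.univ.filter fun v : V => ∃ w, GreedyPartner G idx W v w).card

/-- The number of vertices that the greedy algorithm matches through an edge of a given set. -/
def greedyCountIn (idx : V ↪ ℕ) (W : G.edgeSet → ℝ) (N : Set G.edgeSet) : ℕ :=
  (Finset.univ.filter fun v : V =>
    ∃ w, GreedyPartner G idx W v w ∧ ∃ h : G.Adj v w, (⟨s(v, w), h⟩ : G.edgeSet) ∈ N).card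

theorem coveredCount_greedyMatching_sep (idx : V ↪ ℕ) (W : G.edgeSet → ℝ) (N : Set G.edgeSet) :
    coveredCount G {e ∈ greedyMatching G idx W | e ∈ N} = greedyCountIn G idx W N := by
  unfold coveredCount greedyCountIn
  congr 1
  ext v
  simp only [Finset.mem_filter, Finset.mem_univ, true_and]
  constructor
  · rintro ⟨⟨e, he⟩, ⟨hM, hN⟩, hv⟩
    obtain ⟨w, rfl⟩ := Sym2.mem_iff_exists.1 hv
    exact ⟨w, (mem_greedyMatching_iff G idx W he).1 hM, he, hN⟩
  · rintro ⟨w, hw, h, hN⟩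
    exact ⟨⟨s(v, w), h⟩, ⟨(mem_greedyMatching_iff G idx W h).2 hw, hN⟩, Sym2.mem_mk_left _ _⟩

theorem greedyCountIn_univ (idx : V ↪ ℕ) (W : G.edgeSet → ℝ) :
    greedyCountIn G idx W Set.univ = greedyCount G idx W := by
  unfold greedyCountIn greedyCount
  congr 1
  ext v
  simp only [Finset.mem_filter, Finset.mem_univ, true_and]
  refine exists_congr fun w => ?_
  simp only [Set.mem_univ, exists_prop, and_true]
  exact ⟨fun h => h.1, fun h => ⟨h, (isStable_greedyPartner G idx W).rel h⟩⟩

theorem coveredCount_greedyMatching (idx : V ↪ ℕ) (W : G.edgeSet → ℝ) :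
    coveredCount G (greedyMatching G idx W) = greedyCount G idx W := by
  have h := coveredCount_greedyMatching_sep G idx W Set.univ
  simp only [Set.mem_univ, and_true, Set.ofPred_mem_eq] at h
  rw [h, greedyCountIn_univ]

theorem greedyValue_coinWeight (idx : V ↪ ℕ) (Δ : ℝ) (c : G.edgeSet → Fin 2) :
    greedyValue G idx (coinWeight Δ c) = (greedyCount G idx (coinWeight Δ c) +
      Δ * greedyCountIn G idx (coinWeight Δ c) {e | c e = 1}) / 2 := by
  rw [greedyValue, totalWeight_coinWeight G Δ c (isMatching_greedyMatching G idx _),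
    coveredCount_greedyMatching, ← coveredCount_greedyMatching_sep]
  rfl

theorem performanceRatio_eq (idx : V ↪ ℕ) (Δ : ℝ) :
    performanceRatio G idx ![1, 1 + Δ] (PMF.uniformOfFintype (Fin 2)) =
      coinMean (fun c => greedyValue G idx (coinWeight Δ c)) /
        coinMean (fun c => optimalValue G (coinWeight Δ c)) := by
  unfold performanceRatio
  rw [integral_edgeLaw, integral_edgeLaw]
  rfl

end Values

/-! ### The greedy matching of the grid as a family of sweeps -/

section GridSweep

variable {n : ℕ}

/-- The cell of a vertex of the grid. -/
def cell (u : Fin n × Fin n) : ℕ × ℕ := (u.1 + 1, u.2 + 1)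

theorem cell_injective : Function.Injective (cell (n := n)) := by
  rintro ⟨a, b⟩ ⟨a', b'⟩ h
  simp only [cell, Prod.mk.injEq, add_left_inj] at h
  exact Prod.ext (Fin.ext h.1) (Fin.ext h.2)

theorem inGrid_cell (u : Fin n × Fin n) : inGrid n (cell u).1 (cell u).2 = true := by
  have h1 := u.1.2
  have h2 := u.2.2
  exact decide_eq_true (by simp only [cell]; omega)

theorem exists_cell {p : ℕ × ℕ} (h : inGrid n p.1 p.2 = true) : ∃ u : Fin n × Fin n, cell u = p := by
  simp only [inGrid, decide_eq_true_eq] at h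
  refine ⟨(⟨p.1 - 1, by omega⟩, ⟨p.2 - 1, by omega⟩), Prod.ext ?_ ?_⟩ <;> (simp only [cell]; omega)

theorem grid_adj_iff (u v : Fin n × Fin n) :
    (grid n).Adj u v ↔ (u.1 = v.1 ∧ ((u.2 : ℕ) + 1 = v.2 ∨ (v.2 : ℕ) + 1 = u.2)) ∨
      (u.2 = v.2 ∧ ((u.1 : ℕ) + 1 = v.1 ∨ (v.1 : ℕ) + 1 = u.1)) := by
  unfold grid
  rw [SimpleGraph.boxProd_adj, SimpleGraph.pathGraph_adj, SimpleGraph.pathGraph_adj]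
  tauto

theorem cellAdj_cell_iff (u v : Fin n × Fin n) :
    CellAdj n (cell u) (cell v) ↔ (grid n).Adj u v := by
  rw [grid_adj_iff]
  simp only [CellAdj, inGrid_cell, true_and]
  simp only [cell, Prod.mk.injEq, Fin.ext_iff]
  omega

theorem gridIndex_lt_iff (u v : Fin n × Fin n) :
    gridIndex n u < gridIndex n v ↔ CellLT (cell u) (cell v) := by
  have e : ∀ w : Fin n × Fin n, gridIndex n w = w.2 + n * w.1 := fun w => by
    simp [gridIndex, finProdFinEquiv]
  rw [e, e]
  simp only [CellLT, cell]
  have h1 := u.2.2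
  have h2 := v.2.2
  constructor
  · intro h
    by_contra hcon
    push Not at hcon
    rcases Nat.lt_or_ge (v.1 : ℕ) u.1 with h3 | h3
    · have : n * ((v.1 : ℕ) + 1) ≤ n * u.1 := Nat.mul_le_mul_left _ h3
      rw [mul_add] at this
      omega
    · have h4 : (u.1 : ℕ) = v.1 := by omega
      rw [h4] at h
      have := hcon.2 (by omega)
      omega
  · rintro (h | ⟨h, h'⟩)
    · have : n * ((u.1 : ℕ) + 1) ≤ n * v.1 := Nat.mul_le_mul_left _ (by omega)
      rw [mul_add] at this
      omega
    · have h4 : (u.1 : ℕ) = v.1 := by omega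
      rw [h4]
      omega

/-- The edge between two cells is heavy. -/
def HeavyCells (c : (grid n).edgeSet → Fin 2) (p q : ℕ × ℕ) : Prop :=
  ∃ (u v : Fin n × Fin n) (h : (grid n).Adj u v), cell u = p ∧ cell v = q ∧ c ⟨s(u, v), h⟩ = 1

/-- Two cells are matched by the greedy algorithm. -/
def MatchedCells (Δ : ℝ) (c : (grid n).edgeSet → Fin 2) (p q : ℕ × ℕ) : Prop :=
  ∃ u v : Fin n × Fin n, cell u = p ∧ cell v = q ∧
    GreedyPartner (grid n) (gridIndex n) (coinWeight Δ c) u v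

variable {Δ : ℝ} (c : (grid n).edgeSet → Fin 2)

theorem HeavyCells.symm {p q : ℕ × ℕ} (h : HeavyCells c p q) : HeavyCells c q p := by
  obtain ⟨u, v, h, hu, hv, hc⟩ := h
  refine ⟨v, u, h.symm, hv, hu, ?_⟩
  rw [← hc]
  congr 1
  exact Subtype.ext Sym2.eq_swap

theorem HeavyCells.cellAdj {p q : ℕ × ℕ} (h : HeavyCells c p q) : CellAdj n p q := by
  obtain ⟨u, v, h, rfl, rfl, -⟩ := h
  exact (cellAdj_cell_iff u v).2 h

theorem heavyCells_cell_iff {u v : Fin n × Fin n} (h : (grid n).Adj u v) :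
    HeavyCells c (cell u) (cell v) ↔ c ⟨s(u, v), h⟩ = 1 := by
  constructor
  · rintro ⟨u', v', h', hu, hv, hc⟩
    obtain rfl := cell_injective hu
    obtain rfl := cell_injective hv
    exact hc
  · exact fun hc => ⟨u, v, h, rfl, rfl, hc⟩

theorem matchedCells_cell_iff {u : Fin n × Fin n} {q : ℕ × ℕ} : MatchedCells Δ c (cell u) q ↔
    ∃ v, cell v = q ∧ GreedyPartner (grid n) (gridIndex n) (coinWeight Δ c) u v := by
  constructor
  · rintro ⟨u', v', hu, hv, hc⟩
    obtain rfl := cell_injective hu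
    exact ⟨v', hv, hc⟩
  · exact fun ⟨v, hv, h⟩ => ⟨u, v, rfl, hv, h⟩

/-- Positivity of Δ is what makes comparing weights the same as comparing coins. -/
theorem prefers_coinWeight_iff {E : Type*} (hΔ : 0 < Δ) (c : E → Fin 2) (e f : E) (P : Prop) :
    (coinWeight Δ c e < coinWeight Δ c f ∨ (coinWeight Δ c e = coinWeight Δ c f ∧ P)) ↔
      ((c f = 1 ∧ ¬ c e = 1) ∨ ((c f = 1 ↔ c e = 1) ∧ P)) := by
  rw [coinWeight_eq, coinWeight_eq]
  by_cases h1 : c e = 1 <;> by_cases h2 : c f = 1 <;> simp [h1, h2, hΔ, hΔ.le, hΔ.ne']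

theorem prefers_grid_iff (hΔ : 0 < Δ) {u w v : Fin n × Fin n} (hw : (grid n).Adj u w)
    (hv : (grid n).Adj u v) : Prefers (grid n) (gridIndex n) (coinWeight Δ c) u w v ↔
      CellPrefers (HeavyCells c) (cell u) (cell w) (cell v) := by
  rw [Prefers, CellPrefers, pairWeight_of_adj _ _ hw, pairWeight_of_adj _ _ hv,
    heavyCells_cell_iff c hw, heavyCells_cell_iff c hv, prefers_coinWeight_iff hΔ,
    gridIndex_lt_iff]

/-- Stability is carried over from the grid to cells with natural number coordinates, where
neighbours above and to the left can be written by truncated subtraction. -/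
theorem isStable_matchedCells (hΔ : 0 < Δ) :
    IsStable (CellAdj n) (CellPrefers (HeavyCells c)) (MatchedCells Δ c) := by
  have hst := isStable_greedyPartner (grid n) (gridIndex n) (coinWeight Δ c)
  refine ⟨?_, ?_, ?_, ?_⟩
  · rintro p q ⟨u, v, hu, hv, h⟩
    exact ⟨v, u, hv, hu, hst.symm h⟩
  · rintro p q ⟨u, v, rfl, rfl, h⟩
    exact (cellAdj_cell_iff u v).2 (hst.rel h)
  · rintro p q q' ⟨u, v, rfl, rfl, h⟩ h'
    obtain ⟨v', rfl, h''⟩ := (matchedCells_cell_iff c).1 h'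
    rw [hst.unique h h'']
  · intro p q hpq hno
    obtain ⟨u, rfl⟩ := exists_cell hpq.1
    obtain ⟨v, rfl⟩ := exists_cell hpq.2.1
    have huv := (cellAdj_cell_iff u v).1 hpq
    rcases hst.blocked huv fun h => hno ⟨u, v, rfl, rfl, h⟩ with ⟨w, hw, hb⟩ | ⟨w, hw, hb⟩
    · exact Or.inl ⟨cell w, ⟨u, w, rfl, rfl, hw⟩, (prefers_grid_iff c hΔ (hst.rel hw) huv).1 hb⟩
    · exact Or.inr ⟨cell w, ⟨v, w, rfl, rfl, hw⟩,
        (prefers_grid_iff c hΔ (hst.rel hw) huv.symm).1 hb⟩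

/-- The sweep of the greedy matching of the grid. -/
def gridSweep (hΔ : 0 < Δ) : Sweep n :=
  cellSweep (heavy := HeavyCells c) (HeavyCells.symm c) (HeavyCells.cellAdj c)
    (isStable_matchedCells c hΔ)

open Classical in
/-- Replacement of the coin of the edge between two cells. -/
def setCoin (p q : ℕ × ℕ) (b : Bool) (c : (grid n).edgeSet → Fin 2) : (grid n).edgeSet → Fin 2 :=
  fun e => if (e : Sym2 (Fin n × Fin n)).map cell = s(p, q) then (if b = true then 1 else 0) else c e

theorem heavyCells_setCoin_self {p q : ℕ × ℕ} (h : CellAdj n p q) (b : Bool) :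
    HeavyCells (setCoin p q b c) p q ↔ b = true := by
  obtain ⟨u, rfl⟩ := exists_cell h.1
  obtain ⟨v, rfl⟩ := exists_cell h.2.1
  have hs : setCoin (cell u) (cell v) b c ⟨s(u, v), (cellAdj_cell_iff u v).1 h⟩ =
      if b = true then 1 else 0 := if_pos rfl
  rw [heavyCells_cell_iff _ ((cellAdj_cell_iff u v).1 h), hs]
  cases b <;> simp

theorem heavyCells_setCoin_of_ne {p q p' q' : ℕ × ℕ} (h : s(p', q') ≠ s(p, q)) (b : Bool) :
    HeavyCells (setCoin p q b c) p' q' ↔ HeavyCells c p' q' := by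
  unfold HeavyCells
  refine exists_congr fun u => exists_congr fun v => exists_congr fun hadj =>
    and_congr_right fun hu => and_congr_right fun hv => ?_
  rw [setCoin, if_neg]
  rintro h'
  apply h
  rw [← h', ← hu, ← hv]
  rfl

theorem setCoin_eq_update [DecidableEq (grid n).edgeSet] {u v : Fin n × Fin n}
    (h : (grid n).Adj u v) (b : Bool) : setCoin (cell u) (cell v) b c =
      Function.update c ⟨s(u, v), h⟩ (if b = true then 1 else 0) := by
  funext e
  by_cases he : e = ⟨s(u, v), h⟩
  · subst he
    simp [setCoin]
  · rw [Function.update_of_ne he, setCoin, if_neg]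
    intro h'
    apply he
    apply Subtype.ext
    apply Sym2.map.injective cell_injective
    rw [h']
    rfl

theorem sum_setCoin [Fintype (grid n).edgeSet] [DecidableEq (grid n).edgeSet] {p q : ℕ × ℕ}
    (h : CellAdj n p q) (F : ((grid n).edgeSet → Fin 2) → ℕ) :
    2 * ∑ c, F c = ∑ c, coinSum fun b => F (setCoin p q b c) := by
  obtain ⟨u, rfl⟩ := exists_cell h.1
  obtain ⟨v, rfl⟩ := exists_cell h.2.1
  simp only [fun c b => setCoin_eq_update c ((cellAdj_cell_iff u v).1 h) b]
  exact two_mul_sum_eq _ F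

theorem cellAdj_down {r x : ℕ} (hr : 1 ≤ r) (hrn : r < n) (hx : 1 ≤ x) (hxn : x ≤ n) :
    CellAdj n (r, x) (r + 1, x) := by
  refine ⟨?_, ?_, Or.inr (Or.inl rfl)⟩ <;> (simp only [inGrid, decide_eq_true_eq]; omega)

theorem cellAdj_right {r x : ℕ} (hr : 1 ≤ r) (hrn : r ≤ n) (hx : 1 ≤ x) (hxn : x < n) :
    CellAdj n (r, x) (r, x + 1) := by
  refine ⟨?_, ?_, Or.inl rfl⟩ <;> (simp only [inGrid, decide_eq_true_eq]; omega)

open Classical in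
/-- The sweeps of the greedy matchings of the grid, as a function of the coins. -/
def gridFamily (hΔ : 0 < Δ) [Fintype (grid n).edgeSet] [DecidableEq (grid n).edgeSet] :
    SweepFamily n ((grid n).edgeSet → Fin 2) where
  sweep := fun c => gridSweep c hΔ
  setD := fun r x => setCoin (r, x) (r + 1, x)
  setH := fun r x => setCoin (r, x) (r, x + 1)
  setD_D := fun {r x} h1 h2 h3 h4 b c r' x' => by
    simp only [gridSweep, cellSweep]
    split_ifs with h
    · obtain ⟨rfl, rfl⟩ := h
      simp only [heavyCells_setCoin_self c (cellAdj_down h1 h2 h3 h4)]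
      cases b <;> simp
    · have hne : s((r', x'), (r' + 1, x')) ≠ s((r, x), (r + 1, x)) := by
        simp only [ne_eq, Sym2.eq_iff, Prod.mk.injEq]
        omega
      simp only [heavyCells_setCoin_of_ne c hne]
  setD_H := fun r x b c r' x' => by
    have hne : s((r', x'), (r', x' + 1)) ≠ s((r, x), (r + 1, x)) := by
      simp only [ne_eq, Sym2.eq_iff, Prod.mk.injEq]
      omega
    simp only [gridSweep, cellSweep, heavyCells_setCoin_of_ne c hne]
  setH_H := fun {r x} h1 h2 h3 h4 b c r' x' => by
    simp only [gridSweep, cellSweep]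
    split_ifs with h
    · obtain ⟨rfl, rfl⟩ := h
      simp only [heavyCells_setCoin_self c (cellAdj_right h1 h2 h3 h4)]
      cases b <;> simp
    · have hne : s((r', x'), (r', x' + 1)) ≠ s((r, x), (r, x + 1)) := by
        simp only [ne_eq, Sym2.eq_iff, Prod.mk.injEq]
        omega
      simp only [heavyCells_setCoin_of_ne c hne]
  setH_D := fun r x b c r' x' => by
    have hne : s((r', x'), (r' + 1, x')) ≠ s((r, x), (r, x + 1)) := by
      simp only [ne_eq, Sym2.eq_iff, Prod.mk.injEq]
      omega
    simp only [gridSweep, cellSweep, heavyCells_setCoin_of_ne c hne]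
  sum_setD := fun h1 h2 h3 h4 F => sum_setCoin (cellAdj_down h1 h2 h3 h4) F
  sum_setH := fun h1 h2 h3 h4 F => sum_setCoin (cellAdj_right h1 h2 h3 h4) F

end GridSweep

/-! ### Boundary terms in sums over the grid -/

section Counting

theorem sum_shift_le (g : ℕ → ℕ) {u m M : ℕ} (h : m + u ≤ M) :
    ∑ k ∈ Finset.range m, g (k + u) ≤ ∑ k ∈ Finset.range M, g k := by
  calc ∑ k ∈ Finset.range m, g (k + u)
      ≤ ∑ k ∈ Finset.range u, g k + ∑ k ∈ Finset.range m, g (u + k) := by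
        simp only [add_comm _ u]
        exact Nat.le_add_left _ _
    _ = ∑ k ∈ Finset.range (u + m), g k := (Finset.sum_range_add _ _ _).symm
    _ ≤ _ := Finset.sum_le_sum_of_subset (Finset.range_mono (by omega))

theorem sum_sum_shift_le (g : ℕ → ℕ → ℕ) {u v p q P Q : ℕ} (hp : p + u ≤ P) (hq : q + v ≤ Q) :
    ∑ a ∈ Finset.range p, ∑ k ∈ Finset.range q, g (a + u) (k + v) ≤
      ∑ a ∈ Finset.range P, ∑ k ∈ Finset.range Q, g a k :=
  (Finset.sum_le_sum fun _ _ => sum_shift_le _ hq).trans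
    (sum_shift_le (fun a => ∑ k ∈ Finset.range Q, g a k) hp)

theorem sum_range_le_shift (g : ℕ → ℕ) {B : ℕ} (hg : ∀ k, g k ≤ B) (a m b : ℕ) :
    ∑ k ∈ Finset.range (a + m + b), g k ≤ ∑ k ∈ Finset.range m, g (k + a) + (a + b) * B := by
  rw [Finset.sum_range_add, Finset.sum_range_add]
  have h1 : ∑ k ∈ Finset.range a, g k ≤ a * B := by
    simpa using Finset.sum_le_card_nsmul (Finset.range a) g B fun k _ => hg k
  have h2 : ∑ k ∈ Finset.range b, g (a + m + k) ≤ b * B := by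
    simpa using Finset.sum_le_card_nsmul (Finset.range b) _ B fun k _ => hg (a + m + k)
  simp only [add_comm a]
  rw [add_mul]
  simp only [add_comm a] at h2
  linarith

/-- The cells near the boundary contribute little. -/
theorem sum_sum_le_interior (f : ℕ → ℕ → ℕ) (hf : ∀ r x, f r x ≤ 1) (N : ℕ) :
    ∑ i ∈ Finset.range (N + 8), ∑ j ∈ Finset.range (N + 8), f (i + 1) (j + 1) ≤
      ∑ a ∈ Finset.range (N + 4), ∑ k ∈ Finset.range N, f (a + 1) (k + 7) + 12 * (N + 8) := by
  have hrow : ∀ r, ∑ j ∈ Finset.range (N + 8), f r (j + 1) ≤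
      ∑ k ∈ Finset.range N, f r (k + 7) + 8 := by
    intro r
    -- Six columns are dropped on the left and two on the right. With the four rows dropped at the
    -- bottom this makes twelve lines of at most `N + 8` cells.
    have := sum_range_le_shift (fun j => f r (j + 1)) (fun j => hf r (j + 1)) 6 N 2
    rw [show 6 + N + 2 = N + 8 by ring] at this
    simpa using this
  have hbd : ∀ r, ∑ k ∈ Finset.range N, f r (k + 7) ≤ N := by
    intro r
    simpa using Finset.sum_le_card_nsmul (Finset.range N) _ 1 fun k _ => hf r (k + 7)
  have := sum_range_le_shift (fun i => ∑ k ∈ Finset.range N, f (i + 1) (k + 7))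
    (fun i => hbd (i + 1)) 0 (N + 4) 4
  calc ∑ i ∈ Finset.range (N + 8), ∑ j ∈ Finset.range (N + 8), f (i + 1) (j + 1)
      ≤ ∑ i ∈ Finset.range (N + 8), (∑ k ∈ Finset.range N, f (i + 1) (k + 7) + 8) :=
        Finset.sum_le_sum fun i _ => hrow (i + 1)
    _ = ∑ i ∈ Finset.range (N + 8), ∑ k ∈ Finset.range N, f (i + 1) (k + 7) + (N + 8) * 8 := by
        rw [Finset.sum_add_distrib]
        simp
    _ ≤ _ := by
        simp only [zero_add, add_zero, show N + 4 + 4 = N + 8 by ring] at this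
        linarith

theorem card_filter_grid {n : ℕ} (P : Fin n × Fin n → Prop) [DecidablePred P] (f : ℕ → ℕ → ℕ)
    (h : ∀ u : Fin n × Fin n, P u → f (u.1 + 1) (u.2 + 1) = 1) :
    (Finset.univ.filter P).card ≤
      ∑ i ∈ Finset.range n, ∑ j ∈ Finset.range n, f (i + 1) (j + 1) := by
  rw [Finset.card_filter, Fintype.sum_prod_type, Finset.sum_range]
  refine Finset.sum_le_sum fun i _ => ?_
  rw [Finset.sum_range]
  refine Finset.sum_le_sum fun j _ => ?_
  split_ifs with hP
  · rw [h _ hP]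
  · exact Nat.zero_le _

end Counting

/-! ### Densities of unmatched and of light vertices -/

section GreedyBound

variable {N : ℕ} {Δ : ℝ} (hΔ : 0 < Δ)

-- Each unmatched interior cell is charged to one of three steps, at most one row lower and two
-- columns further right than the base position. Hence the ranges `N + 5` and `N + 2`, which are the
-- largest that the band inequality allows in a grid of size `N + 8`.
open Classical in
theorem unmatched_card_le (c : (grid (N + 8)).edgeSet → Fin 2) :
    (Finset.univ.filter fun u : Fin (N + 8) × Fin (N + 8) =>
        ∀ w, ¬ GreedyPartner (grid (N + 8)) (gridIndex (N + 8)) (coinWeight Δ c) u w).card ≤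
      ∑ a ∈ Finset.range (N + 5), ∑ k ∈ Finset.range (N + 2),
        (gridSweep c hΔ).stepCost lossCount (a + 2) (k + 5) + 12 * (N + 8) := by
  set S := gridSweep c hΔ with hS
  let f : ℕ → ℕ → ℕ := fun r x => if S.waits r x = true ∧ S.light (r + 1) x = false then 1 else 0
  refine (card_filter_grid _ f ?_).trans ((sum_sum_le_interior f ?_ N).trans ?_)
  · intro u hu
    have := cellSweep_unmatched (HeavyCells.symm c) (HeavyCells.cellAdj c)
      (isStable_matchedCells c hΔ) (inGrid_cell u) fun w hw => by
        obtain ⟨v, -, hv⟩ := (matchedCells_cell_iff c).1 hw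
        exact hu v hv
    exact if_pos this
  · intro r x
    simp only [f]
    split_ifs <;> omega
  · refine Nat.add_le_add_right ?_ _
    calc ∑ a ∈ Finset.range (N + 4), ∑ k ∈ Finset.range N, f (a + 1) (k + 7)
        ≤ ∑ a ∈ Finset.range (N + 4), ∑ k ∈ Finset.range N,
          (S.stepCost Sweep.lossLeft (a + 2) (k + 7) + S.stepCost Sweep.lossRight (a + 2) (k + 6) +
            S.stepCost Sweep.lossAbove (a + 3) (k + 5)) := by
          refine Finset.sum_le_sum fun a ha => Finset.sum_le_sum fun k hk => ?_
          simp only [Finset.mem_range] at ha hk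
          simp only [f]
          split_ifs with h
          · exact S.loss_le (r := a + 1) (x := k + 5) (by omega) (by omega) h.1 h.2
          · exact Nat.zero_le _
      _ ≤ ∑ a ∈ Finset.range (N + 5), ∑ k ∈ Finset.range (N + 2),
          S.stepCost lossCount (a + 2) (k + 5) := by
          simp only [S.stepCost_lossCount, Finset.sum_add_distrib]
          have h1 := sum_sum_shift_le (fun a k => S.stepCost Sweep.lossLeft (a + 2) (k + 5))
            (u := 0) (v := 2) (p := N + 4) (q := N) (P := N + 5) (Q := N + 2) (by omega) (by omega)
          have h2 := sum_sum_shift_le (fun a k => S.stepCost Sweep.lossRight (a + 2) (k + 5))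
            (u := 0) (v := 1) (p := N + 4) (q := N) (P := N + 5) (Q := N + 2) (by omega) (by omega)
          have h3 := sum_sum_shift_le (fun a k => S.stepCost Sweep.lossAbove (a + 2) (k + 5))
            (u := 1) (v := 0) (p := N + 4) (q := N) (P := N + 5) (Q := N + 2) (by omega) (by omega)
          simp only [add_zero, add_assoc, Nat.reduceAdd] at h1 h2 h3 ⊢
          omega

open Classical in
theorem light_card_le (c : (grid (N + 8)).edgeSet → Fin 2) :
    (Finset.univ.filter fun u : Fin (N + 8) × Fin (N + 8) =>
        ¬ ∃ w, GreedyPartner (grid (N + 8)) (gridIndex (N + 8)) (coinWeight Δ c) u w ∧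
          ∃ h : (grid (N + 8)).Adj u w, (⟨s(u, w), h⟩ : (grid (N + 8)).edgeSet) ∈ {e | c e = 1}).card ≤
      ∑ a ∈ Finset.range (N + 5), ∑ k ∈ Finset.range (N + 2),
        (gridSweep c hΔ).stepCost lightCount (a + 2) (k + 5) + 12 * (N + 8) := by
  set S := gridSweep c hΔ with hS
  let f : ℕ → ℕ → ℕ := fun r x => if S.light r x = true then 1 else 0
  refine (card_filter_grid _ f ?_).trans ((sum_sum_le_interior f ?_ N).trans ?_)
  · intro u hu
    refine if_pos ((cellSweep_light_iff (HeavyCells.symm c) (HeavyCells.cellAdj c)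
      (isStable_matchedCells c hΔ) _ _).2 ⟨inGrid_cell u, fun w hw hh => hu ?_⟩)
    obtain ⟨v, rfl, hv⟩ := (matchedCells_cell_iff c).1 hw
    have hadj := (isStable_greedyPartner _ _ _).rel hv
    exact ⟨v, hv, hadj, (heavyCells_cell_iff c hadj).1 hh⟩
  · intro r x
    simp only [f]
    split_ifs <;> omega
  · refine Nat.add_le_add_right ?_ _
    calc ∑ a ∈ Finset.range (N + 4), ∑ k ∈ Finset.range N, f (a + 1) (k + 7)
        ≤ ∑ a ∈ Finset.range (N + 4), ∑ k ∈ Finset.range N,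
          S.stepCost lightCount (a + 2) (k + 5) := by
          refine Finset.sum_le_sum fun a _ => Finset.sum_le_sum fun k _ => ?_
          simp only [f]
          split_ifs with h
          · exact S.light_le (r := a + 1) (x := k + 5) h
          · exact Nat.zero_le _
      _ ≤ _ := sum_sum_shift_le (fun a k => S.stepCost lightCount (a + 2) (k + 5)) (u := 0) (v := 0)
          (by omega) (by omega)

end GreedyBound

section GreedyMean

variable {Δ : ℝ} {n : ℕ} [Fintype (grid n).edgeSet] [DecidableEq (grid n).edgeSet]

/-- A bound for a mean that follows from a certificate. -/
theorem coinMean_le_of_bandCheck (hΔ : 0 < Δ)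
    {cost : VertexState → Offer → VertexState → Bool → Bool → ℕ} {s C B : ℕ}
    {φ : BandPotential} {g : LinkPotential} (h : bandCheck cost s C φ g = true)
    (hφ : ∀ t₁ e₁ t₂ e₂ t₃ e₃, φ t₁ e₁ t₂ e₂ t₃ e₃ ≤ B) (hg : ∀ x t₁ e₁ t₂ e₂, g x t₁ e₁ t₂ e₂ ≤ B)
    {N : ℕ} (hn : n = N + 8) (F : ((grid n).edgeSet → Fin 2) → ℕ)
    (hF : ∀ c, F c ≤ ∑ a ∈ Finset.range (N + 5), ∑ k ∈ Finset.range (N + 2),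
        (gridSweep c hΔ).stepCost cost (a + 2) (k + 5) + 12 * n) :
    64 * s * coinMean (fun c => (F c : ℝ)) ≤ C * n ^ 2 + (256 * B + 768 * s) * n := by
  have h1 := (gridFamily (n := n) hΔ).sum_costSum_le h hφ hg (p := N + 5) (q := N + 2) (by omega)
    (by omega)
  have h2 : ∑ c, F c ≤ ∑ a ∈ Finset.range (N + 5), ∑ k ∈ Finset.range (N + 2),
      (gridFamily (n := n) hΔ).costSum cost (a + 2) (k + 5) +
        Fintype.card ((grid n).edgeSet → Fin 2) * (12 * n) := by
    refine (Finset.sum_le_sum fun c _ => hF c).trans (le_of_eq ?_)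
    rw [Finset.sum_add_distrib, Finset.sum_const, Finset.card_univ, smul_eq_mul, Finset.sum_comm]
    congr 1
    refine Finset.sum_congr rfl fun a _ => ?_
    rw [Finset.sum_comm]
    rfl
  -- Here `p = N + 5` and `q = N + 2`, so `p * q ≤ n * n` and `3 * p + q ≤ 4 * n`; the latter gives
  -- the term `256 * B`.
  have h3 : C * ((N + 5) * (N + 2)) + 64 * B * (3 * (N + 5) + (N + 2)) ≤
      C * (n * n) + 64 * B * (4 * n) := by
    have e1 : (N + 5) * (N + 2) ≤ n * n := Nat.mul_le_mul (by omega) (by omega)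
    have e2 : 3 * (N + 5) + (N + 2) ≤ 4 * n := by omega
    gcongr
  have h4 : 64 * s * ∑ c, F c ≤
      (C * (n * n) + 64 * B * (4 * n) + 64 * s * (12 * n)) *
        Fintype.card ((grid n).edgeSet → Fin 2) := by
    calc 64 * s * ∑ c, F c ≤ 64 * s * (∑ a ∈ Finset.range (N + 5), ∑ k ∈ Finset.range (N + 2),
          (gridFamily (n := n) hΔ).costSum cost (a + 2) (k + 5) +
            Fintype.card ((grid n).edgeSet → Fin 2) * (12 * n)) := Nat.mul_le_mul_left _ h2
      _ ≤ _ := by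
        have := h1.trans (Nat.mul_le_mul_right _ h3)
        rw [mul_add, add_mul _ (64 * s * (12 * n))]
        refine Nat.add_le_add ?_ (le_of_eq (by ring))
        rw [mul_assoc]
        exact this
  have hcard : (Fintype.card ((grid n).edgeSet → Fin 2) : ℝ) =
      2 ^ Fintype.card (grid n).edgeSet := by simp
  have h5 : (64 * s * ∑ c, (F c : ℝ) : ℝ) ≤
      (C * (n * n) + 64 * B * (4 * n) + 64 * s * (12 * n)) *
        2 ^ Fintype.card (grid n).edgeSet := by
    rw [← hcard]
    exact_mod_cast h4
  unfold coinMean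
  rw [← mul_div_assoc, div_le_iff₀ (by positivity)]
  refine h5.trans (le_of_eq (by ring))

theorem card_filter_not_real {V : Type*} [Fintype V] (P : V → Prop) [DecidablePred P] :
    ((Finset.univ.filter P).card : ℝ) =
      Fintype.card V - (Finset.univ.filter fun v => ¬ P v).card := by
  rw [eq_sub_iff_add_eq]
  exact_mod_cast Finset.card_filter_add_card_filter_not (s := Finset.univ) P

/-- The certificate bounds the density of unmatched vertices by 1793 / 22784. The linear error is
below `24 * n`, so the coefficient 1000 is generous; it also makes the left side nonpositive for `n
< 8`, where no band fits. -/
theorem le_coinMean_greedyCount (hΔ : 0 < Δ) : (0.9213 : ℝ) * n ^ 2 - 1000 * n ≤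
    coinMean fun c => (greedyCount (grid n) (gridIndex n) (coinWeight Δ c) : ℝ) := by
  classical
  by_cases hn : n < 8
  · have h0 : (0 : ℝ) ≤ coinMean fun c =>
        (greedyCount (grid n) (gridIndex n) (coinWeight Δ c) : ℝ) := by
      unfold coinMean
      positivity
    have : (n : ℝ) < 8 := by exact_mod_cast hn
    nlinarith [(Nat.cast_nonneg n : (0 : ℝ) ≤ n)]
  · obtain ⟨N, rfl⟩ : ∃ N, n = N + 8 := ⟨n - 8, by omega⟩
    have h := coinMean_le_of_bandCheck hΔ bandCheck_loss
      (fun t₁ e₁ t₂ e₂ t₃ e₃ => (lossBand_lt t₁ e₁ t₂ e₂ t₃ e₃).le)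
      (fun x t₁ e₁ t₂ e₂ => (lossLink_lt x t₁ e₁ t₂ e₂).le) rfl _ (unmatched_card_le (N := N) hΔ)
    have hc : ∀ c, (greedyCount (grid (N + 8)) (gridIndex (N + 8)) (coinWeight Δ c) : ℝ) =
        ((N + 8 : ℕ) : ℝ) ^ 2 + (-1) * ((Finset.univ.filter fun u : Fin (N + 8) × Fin (N + 8) =>
          ∀ w, ¬ GreedyPartner (grid (N + 8)) (gridIndex (N + 8)) (coinWeight Δ c) u w).card : ℝ) := by
      intro c
      unfold greedyCount
      rw [card_filter_not_real]
      simp only [not_exists, Fintype.card_prod, Fintype.card_fin]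
      push_cast
      ring
    simp only [hc]
    rw [coinMean_add, coinMean_const, coinMean_mul]
    norm_num at h ⊢
    nlinarith [(Nat.cast_nonneg N : (0 : ℝ) ≤ N)]

/-- The certificate yields the density 3/4 for heavily matched vertices, more than the 0.6967 that
is needed. -/
theorem le_coinMean_greedyCountIn (hΔ : 0 < Δ) : (0.6967 : ℝ) * n ^ 2 - 1000 * n ≤
    coinMean fun c =>
      (greedyCountIn (grid n) (gridIndex n) (coinWeight Δ c) {e | c e = 1} : ℝ) := by
  classical
  by_cases hn : n < 8
  · have h0 : (0 : ℝ) ≤ coinMean fun c =>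
        (greedyCountIn (grid n) (gridIndex n) (coinWeight Δ c) {e | c e = 1} : ℝ) := by
      unfold coinMean
      positivity
    have : (n : ℝ) < 8 := by exact_mod_cast hn
    nlinarith [(Nat.cast_nonneg n : (0 : ℝ) ≤ n)]
  · obtain ⟨N, rfl⟩ : ∃ N, n = N + 8 := ⟨n - 8, by omega⟩
    have h := coinMean_le_of_bandCheck (B := 2) hΔ bandCheck_light
      (fun t₁ e₁ t₂ e₂ t₃ e₃ => by cases t₁ <;> simp [lightBand])
      (fun x t₁ e₁ t₂ e₂ => by cases x <;> simp [lightLink]) rfl _ (light_card_le (N := N) hΔ)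
    have hc : ∀ c, (greedyCountIn (grid (N + 8)) (gridIndex (N + 8)) (coinWeight Δ c)
        {e | c e = 1} : ℝ) =
        ((N + 8 : ℕ) : ℝ) ^ 2 + (-1) * ((Finset.univ.filter fun u : Fin (N + 8) × Fin (N + 8) =>
          ¬ ∃ w, GreedyPartner (grid (N + 8)) (gridIndex (N + 8)) (coinWeight Δ c) u w ∧
            ∃ h : (grid (N + 8)).Adj u w,
              (⟨s(u, w), h⟩ : (grid (N + 8)).edgeSet) ∈ {e | c e = 1}).card : ℝ) := by
      intro c
      unfold greedyCountIn
      rw [card_filter_not_real]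
      simp only [Fintype.card_prod, Fintype.card_fin]
      push_cast
      ring
    simp only [hc]
    rw [coinMean_add, coinMean_const, coinMean_mul]
    norm_num at h ⊢
    nlinarith [(Nat.cast_nonneg N : (0 : ℝ) ≤ N)]

end GreedyMean

/-! ### Upper bound for the optimal matching -/

section OptimalBound

open Classical

theorem incident_card_le {n : ℕ} (v : Fin n × Fin n) [Fintype (grid n).edgeSet] :
    (Finset.univ.filter fun e : (grid n).edgeSet => v ∈ (e : Sym2 (Fin n × Fin n))).card ≤ 4 := by
  let r := (cell v).1
  let x := (cell v).2
  let C : Finset (ℕ × ℕ) := {(r, x + 1), (r + 1, x), (r, x - 1), (r - 1, x)}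
  have hinj : Function.Injective fun e : (grid n).edgeSet =>
      (e : Sym2 (Fin n × Fin n)).map cell :=
    (Sym2.map.injective cell_injective).comp Subtype.val_injective
  rw [← Finset.card_image_of_injective _ hinj]
  have hsub : (Finset.univ.filter fun e : (grid n).edgeSet =>
      v ∈ (e : Sym2 (Fin n × Fin n))).image
        (fun e : (grid n).edgeSet => (e : Sym2 (Fin n × Fin n)).map cell) ⊆
        C.image fun q => s(cell v, q) := by
    intro s hs
    obtain ⟨⟨e, he⟩, hv, rfl⟩ := Finset.mem_image.1 hs
    obtain ⟨w, rfl⟩ := Sym2.mem_iff_exists.1 (Finset.mem_filter.1 hv).2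
    refine Finset.mem_image.2 ⟨cell w, ?_, rfl⟩
    have h := CellAdj.cases (n := n) (r := r) (x := x) (w := cell w)
      ((cellAdj_cell_iff v w).2 he)
    simp only [C, Finset.mem_insert, Finset.mem_singleton]
    tauto
  exact (Finset.card_le_card hsub).trans (Finset.card_image_le.trans Finset.card_le_four)

/-- All edges at a vertex are light. -/
def LightAround {V : Type*} (G : SimpleGraph V) (c : G.edgeSet → Fin 2) (v : V) : Prop :=
  ∀ e : G.edgeSet, v ∈ (e : Sym2 V) → c e = 0

/-- The vertices covered by heavy edges of a matching are among those that have a heavy edge at all.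
-/
theorem optimalValue_coinWeight_le {V : Type*} (G : SimpleGraph V) [Fintype V] {Δ : ℝ} (hΔ : 0 < Δ)
    (c : G.edgeSet → Fin 2) : optimalValue G (coinWeight Δ c) ≤
      Fintype.card V / 2 + Δ / 2 * ∑ v : V, (1 + (-1) *
        if LightAround G c v
          then (1 : ℝ) else 0) := by
  refine optimalValue_le G fun M hM => ?_
  rw [totalWeight_coinWeight G Δ c hM]
  have h1 : (coveredCount G M : ℝ) ≤ Fintype.card V := by exact_mod_cast coveredCount_le G M
  have h2 : (coveredCount G {e ∈ M | c e = 1} : ℝ) ≤ ∑ v : V, (1 + (-1) *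
        if LightAround G c v
          then (1 : ℝ) else 0) := by
    unfold coveredCount
    rw [Finset.card_filter]
    push_cast
    refine Finset.sum_le_sum fun v _ => ?_
    by_cases h : ∃ e ∈ {e ∈ M | c e = 1}, v ∈ (e : Sym2 V)
    · rw [if_pos h, if_neg]
      · norm_num
      · obtain ⟨e, he, hv⟩ := h
        intro h'
        have h0 := h' e hv
        have h1 : c e = 1 := he.2
        rw [h0] at h1
        exact absurd h1 (by decide)
    · rw [if_neg h]
      split_ifs <;> norm_num
  have h3 := mul_le_mul_of_nonneg_left h2 hΔ.le
  linarith

/-- A vertex has at most four edges, so all of them are light with probability at least 1/16.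
Vertices on the boundary have fewer edges, which only helps. -/
theorem coinMean_optimalValue_le {n : ℕ} {Δ : ℝ} (hΔ : 0 < Δ) [Fintype (grid n).edgeSet]
    [DecidableEq (grid n).edgeSet] :
    coinMean (fun c => optimalValue (grid n) (coinWeight Δ c)) ≤
      (n : ℝ) ^ 2 / 2 * (1 + 15 / 16 * Δ) := by
  refine (coinMean_mono fun c => optimalValue_coinWeight_le (grid n) hΔ c).trans ?_
  rw [coinMean_add, coinMean_const, coinMean_mul, coinMean_sum]
  have h : ∀ v : Fin n × Fin n, coinMean (fun c : (grid n).edgeSet → Fin 2 => 1 + (-1) *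
        if LightAround (grid n) c v then (1 : ℝ) else 0) ≤ 15 / 16 := by
    intro v
    have ht : coinMean (fun c : (grid n).edgeSet → Fin 2 =>
        if LightAround (grid n) c v then (1 : ℝ) else 0) = _ :=
      (congrArg coinMean (funext fun c => if_congr (by simp [LightAround]) rfl rfl)).trans
        (coinMean_tails (Finset.univ.filter
          fun e : (grid n).edgeSet => v ∈ (e : Sym2 (Fin n × Fin n))))
    rw [coinMean_add, coinMean_const, coinMean_mul, ht]
    have h4 := pow_le_pow_of_le_one (by norm_num : (0 : ℝ) ≤ 1 / 2) (by norm_num)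
      (incident_card_le v)
    norm_num at h4 ⊢
    linarith
  have hs := Finset.sum_le_sum fun (v : Fin n × Fin n) (_ : v ∈ Finset.univ) => h v
  rw [Finset.sum_const, Finset.card_univ, Fintype.card_prod, Fintype.card_fin, nsmul_eq_mul] at hs
  push_cast at hs
  have h5 := mul_le_mul_of_nonneg_left hs (by positivity : (0 : ℝ) ≤ Δ / 2)
  rw [Fintype.card_prod, Fintype.card_fin]
  push_cast
  calc _ ≤ (n : ℝ) * n / 2 + Δ / 2 * (n * n * (15 / 16)) := add_le_add le_rfl h5
    _ = _ := by ring

end OptimalBound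

/-! ### Almost additivity over separated blocks -/

/-- A restriction of a stable matching to edges that are preferred to all others is stable. -/
theorem IsStable.restrict {V : Type*} {adj : V → V → Prop} {better : V → V → V → Prop}
    {m : V → V → Prop} (h : IsStable adj better m) {P : V → V → Prop} (hP : ∀ {u v}, P u v → P v u)
    (hbetter : ∀ {u v w}, adj u v → adj u w → better u w v → P u v → P u w)
    (hadj : ∀ {u v}, adj u v → adj v u) :
    IsStable (fun u v => adj u v ∧ P u v) better (fun u v => m u v ∧ P u v) where
  symm := fun ⟨h1, h2⟩ => ⟨h.symm h1, hP h2⟩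
  rel := fun ⟨h1, h2⟩ => ⟨h.rel h1, h2⟩
  unique := fun h1 h2 => h.unique h1.1 h2.1
  blocked := by
    rintro u v ⟨h1, h2⟩ hno
    rcases h.blocked h1 fun h3 => hno ⟨h3, h2⟩ with ⟨w, hw, hb⟩ | ⟨w, hw, hb⟩
    · exact Or.inl ⟨w, ⟨hw, hbetter h1 (h.rel hw) hb h2⟩, hb⟩
    · exact Or.inr ⟨w, ⟨hw, hbetter (hadj h1) (h.rel hw) hb (hP h2)⟩, hb⟩

/-- Disjoint copies of a numbered graph `H` inside a numbered graph `G`, without edges of `G`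
between different copies. -/
structure BlockSystem {U V : Type*} (H : SimpleGraph U) (idH : U ↪ ℕ) (G : SimpleGraph V)
    (idG : V ↪ ℕ) (B : Type*) where
  emb : B → U → V
  emb_inj : ∀ {b b' u u'}, emb b u = emb b' u' → b = b' ∧ u = u'
  adj_iff : ∀ {b b' u v}, G.Adj (emb b u) (emb b' v) ↔ b = b' ∧ H.Adj u v
  idx_lt_iff : ∀ {b u v}, idG (emb b u) < idG (emb b v) ↔ idH u < idH v

namespace BlockSystem

variable {U V B : Type*} {H : SimpleGraph U} {idH : U ↪ ℕ} {G : SimpleGraph V} {idG : V ↪ ℕ}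
  (X : BlockSystem H idH G idG B)

/-- The copy of an edge in a block. -/
def edge (b : B) (e : H.edgeSet) : G.edgeSet :=
  ⟨(e : Sym2 U).map (X.emb b), by
    obtain ⟨e, he⟩ := e
    induction e using Sym2.ind with
    | _ u v => exact X.adj_iff.2 ⟨rfl, he⟩⟩

theorem mem_edge {b : B} {e : H.edgeSet} {v : V} (h : v ∈ (X.edge b e : Sym2 V)) :
    ∃ u ∈ (e : Sym2 U), X.emb b u = v := Sym2.mem_map.1 h

theorem emb_mem_edge {b : B} {e : H.edgeSet} {u : U} (h : u ∈ (e : Sym2 U)) :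
    X.emb b u ∈ (X.edge b e : Sym2 V) := Sym2.mem_map.2 ⟨u, h, rfl⟩

theorem edge_injective : Function.Injective fun p : B × H.edgeSet => X.edge p.1 p.2 := by
  rintro ⟨b, e⟩ ⟨b', e'⟩ h
  obtain ⟨u, hu⟩ : ∃ u, u ∈ (e : Sym2 U) := by
    obtain ⟨e, he⟩ := e
    induction e using Sym2.ind with
    | _ u v => exact ⟨u, Sym2.mem_mk_left _ _⟩
  have h1 := X.emb_mem_edge (b := b) hu
  have h' : X.edge b e = X.edge b' e' := h
  rw [h'] at h1
  obtain ⟨u', -, h2⟩ := X.mem_edge h1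
  obtain ⟨rfl, -⟩ := X.emb_inj h2
  have hinj : Function.Injective (X.emb b') := fun _ _ h => (X.emb_inj h).2
  have h3 : e = e' := Subtype.ext (Sym2.map.injective hinj (congrArg Subtype.val h'))
  rw [h3]

/-- As no edges join different copies, every edge that is not in a block has an end outside all
blocks. -/
theorem exists_edge {e : G.edgeSet} (h : ∀ v ∈ (e : Sym2 V), ∃ b u, X.emb b u = v) :
    ∃ b e', X.edge b e' = e := by
  obtain ⟨e, he⟩ := e
  induction e using Sym2.ind with
  | _ v w =>
    obtain ⟨b, u, rfl⟩ := h v (Sym2.mem_mk_left _ _)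
    obtain ⟨b', u', rfl⟩ := h w (Sym2.mem_mk_right _ _)
    obtain ⟨rfl, hadj⟩ := X.adj_iff.1 he
    exact ⟨b, ⟨s(u, u'), hadj⟩, rfl⟩

/-- The weights in a block. -/
def blockCoins (b : B) (c : G.edgeSet → Fin 2) : H.edgeSet → Fin 2 := c ∘ X.edge b

theorem pairWeight_emb (Δ : ℝ) (c : G.edgeSet → Fin 2) (b : B) {u v : U} (h : H.Adj u v) :
    pairWeight G (coinWeight Δ c) (X.emb b u) (X.emb b v) =
      pairWeight H (coinWeight Δ (X.blockCoins b c)) u v := by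
  rw [pairWeight_of_adj _ _ h, pairWeight_of_adj _ _ (X.adj_iff.2 ⟨rfl, h⟩)]
  rfl

theorem prefers_emb_iff (Δ : ℝ) (c : G.edgeSet → Fin 2) (b : B) {u v w : U} (hv : H.Adj u v)
    (hw : H.Adj u w) : Prefers G idG (coinWeight Δ c) (X.emb b u) (X.emb b w) (X.emb b v) ↔
      Prefers H idH (coinWeight Δ (X.blockCoins b c)) u w v := by
  unfold Prefers
  rw [X.pairWeight_emb Δ c b hv, X.pairWeight_emb Δ c b hw, X.idx_lt_iff]

variable [Fintype B]

/-- The means of a quantity that is almost additive over the blocks. -/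
theorem coinMean_block [Fintype G.edgeSet] [DecidableEq G.edgeSet] [Fintype H.edgeSet]
    [DecidableEq H.edgeSet] (f : (G.edgeSet → Fin 2) → ℝ) (f' : (H.edgeSet → Fin 2) → ℝ) {a : ℝ}
    (h : ∀ c, |f c - ∑ b : B, f' (X.blockCoins b c)| ≤ a) :
    |coinMean f - Fintype.card B * coinMean f'| ≤ a := by
  have hsum : coinMean (fun c => ∑ b : B, f' (X.blockCoins b c)) =
      Fintype.card B * coinMean f' := by
    rw [coinMean_sum]
    have : ∀ b : B, coinMean (fun c => f' (X.blockCoins b c)) = coinMean f' := fun b =>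
      coinMean_comp (i := X.edge b) (fun e e' h => by
        have := X.edge_injective (a₁ := (b, e)) (a₂ := (b, e')) h
        simpa using this) f'
    simp [this]
  have h1 := coinMean_mono (f := f) (g := fun c => ∑ b : B, f' (X.blockCoins b c) + a) fun c => by
    have := (abs_le.1 (h c)).2
    linarith
  have h2 := coinMean_mono (f := fun c => ∑ b : B, f' (X.blockCoins b c)) (g := fun c => f c + a)
    fun c => by
      have := (abs_le.1 (h c)).1
      linarith
  rw [coinMean_add, coinMean_const, hsum] at h1
  rw [coinMean_add, coinMean_const, hsum] at h2
  rw [abs_le]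
  constructor <;> linarith

variable [Fintype U]

open Classical in
/-- The vertices of all blocks. -/
def support : Finset V := Finset.univ.image fun p : B × U => X.emb p.1 p.2

open Classical in
theorem mem_support {v : V} : v ∈ X.support ↔ ∃ b u, X.emb b u = v := by
  simp [support]

open Classical in
theorem card_support : X.support.card = Fintype.card B * Fintype.card U := by
  rw [support, Finset.card_image_of_injective, Finset.card_univ, Fintype.card_prod]
  rintro ⟨b, u⟩ ⟨b', u'⟩ h
  obtain ⟨rfl, rfl⟩ := X.emb_inj h
  rfl

/-- The greedy matchings of all blocks together. -/
def blockPartner (Δ : ℝ) (c : G.edgeSet → Fin 2) (x y : V) : Prop :=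
  ∃ b u v, X.emb b u = x ∧ X.emb b v = y ∧
    GreedyPartner H idH (coinWeight Δ (X.blockCoins b c)) u v

/-- Blocks are mutually non-adjacent and their numbering is compatible with the large graph, so
stability can be checked block by block. -/
theorem isStable_blockPartner (Δ : ℝ) (c : G.edgeSet → Fin 2) :
    IsStable (fun x y => G.Adj x y ∧ x ∈ X.support ∧ y ∈ X.support)
      (Prefers G idG (coinWeight Δ c)) (X.blockPartner Δ c) := by
  have hst := fun b => isStable_greedyPartner H idH (coinWeight Δ (X.blockCoins b c))
  refine ⟨?_, ?_, ?_, ?_⟩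
  · rintro x y ⟨b, u, v, hu, hv, h⟩
    exact ⟨b, v, u, hv, hu, (hst b).symm h⟩
  · rintro x y ⟨b, u, v, rfl, rfl, h⟩
    exact ⟨X.adj_iff.2 ⟨rfl, (hst b).rel h⟩, X.mem_support.2 ⟨b, u, rfl⟩,
      X.mem_support.2 ⟨b, v, rfl⟩⟩
  · rintro x y z ⟨b, u, v, rfl, rfl, h⟩ ⟨b', u', v', hu, rfl, h'⟩
    obtain ⟨rfl, rfl⟩ := X.emb_inj hu
    rw [(hst b').unique h h']
  · rintro x y ⟨hadj, hx, hy⟩ hno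
    obtain ⟨b, u, rfl⟩ := X.mem_support.1 hx
    obtain ⟨b', v, rfl⟩ := X.mem_support.1 hy
    obtain ⟨rfl, huv⟩ := X.adj_iff.1 hadj
    rcases (hst b).blocked huv fun h => hno ⟨b, u, v, rfl, rfl, h⟩ with ⟨w, hw, hb⟩ | ⟨w, hw, hb⟩
    · exact Or.inl ⟨X.emb b w, ⟨b, u, w, rfl, rfl, hw⟩,
        (X.prefers_emb_iff Δ c b huv ((hst b).rel hw)).2 hb⟩
    · exact Or.inr ⟨X.emb b w, ⟨b, v, w, rfl, rfl, hw⟩,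
        (X.prefers_emb_iff Δ c b huv.symm ((hst b).rel hw)).2 hb⟩

variable [Fintype V]

/-- The edge between two vertices belongs to `N`. -/
def PairIn (N : Set G.edgeSet) (u v : V) : Prop := ∃ h : G.Adj u v, (⟨s(u, v), h⟩ : G.edgeSet) ∈ N

/-- The greedy matching covers about as many vertices, through edges of an upward closed set, as the
greedy matchings of the blocks. -/
theorem greedyCountIn_block (Δ : ℝ) (c : G.edgeSet → Fin 2) (N : Set G.edgeSet)
    (hN : ∀ e ∈ N, ∀ f, coinWeight Δ c e ≤ coinWeight Δ c f → f ∈ N) :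
    |(greedyCountIn G idG (coinWeight Δ c) N : ℝ) - ∑ b : B,
      (greedyCountIn H idH (coinWeight Δ (X.blockCoins b c)) (X.edge b ⁻¹' N) : ℝ)| ≤
      2 * (Fintype.card V - Fintype.card B * Fintype.card U) := by
  classical
  set W := coinWeight Δ c with hW
  have hPsymm : ∀ {u v : V}, PairIn N u v → PairIn N v u := by
    rintro u v ⟨h, hN'⟩
    refine ⟨h.symm, ?_⟩
    have e : (⟨s(v, u), h.symm⟩ : G.edgeSet) = ⟨s(u, v), h⟩ := Subtype.ext Sym2.eq_swap
    rwa [e]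
  -- Upward closedness of `N` makes the restriction of both matchings to `N` stable, since a
  -- preferred edge is at least as heavy.
  have hPbetter : ∀ {u v w : V}, G.Adj u v → G.Adj u w → Prefers G idG W u w v → PairIn N u v →
      PairIn N u w := by
    rintro u v w huv huw hp ⟨_, hN'⟩
    refine ⟨huw, hN _ hN' _ ?_⟩
    rw [Prefers, pairWeight_of_adj _ _ huv, pairWeight_of_adj _ _ huw] at hp
    rcases hp with hp | hp
    · exact hp.le
    · exact hp.1.le
  have hkey : ∀ {u v w : V}, (G.Adj u v ∧ PairIn N u v) → (G.Adj u w ∧ PairIn N u w) →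
      Prefers G idG W u w v → edgeKey G idG W s(u, w) < edgeKey G idG W s(u, v) :=
    fun _ _ hp => hp.key_lt G idG W
  have hm : IsStable (fun u v => (G.Adj u v ∧ PairIn N u v) ∧ u ∈ (Finset.univ : Finset V) ∧
      v ∈ (Finset.univ : Finset V)) (Prefers G idG W)
      (fun u v => GreedyPartner G idG W u v ∧ PairIn N u v) := by
    simpa using (isStable_greedyPartner G idG W).restrict hPsymm hPbetter fun h => h.symm
  have hm' : IsStable (fun u v => (G.Adj u v ∧ PairIn N u v) ∧ u ∈ X.support ∧ v ∈ X.support)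
      (Prefers G idG W) (fun u v => X.blockPartner Δ c u v ∧ PairIn N u v) := by
    have h := (X.isStable_blockPartner Δ c).restrict (P := PairIn N) hPsymm
      (fun h1 h2 => hPbetter h1.1 h2.1) fun h => ⟨h.1.symm, h.2.2, h.2.1⟩
    have e : (fun u v => (G.Adj u v ∧ PairIn N u v) ∧ u ∈ X.support ∧ v ∈ X.support) =
        fun u v => (G.Adj u v ∧ u ∈ X.support ∧ v ∈ X.support) ∧ PairIn N u v := by
      funext u v
      exact propext (by tauto)
    rw [e]
    exact h
  have hle := card_symmDiff_freeVertices_le (edgeKey G idG W) hkey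
    (fun h => ⟨h.1.symm, hPsymm h.2⟩) hm hm' Finset.univ (fun _ _ y _ => Finset.mem_univ y)
  have hsd : (symmDiff (Finset.univ : Finset V) X.support).card + X.support.card =
      Fintype.card V := by
    have : symmDiff (Finset.univ : Finset V) X.support = X.supportᶜ := by
      ext v
      simp [Finset.mem_symmDiff]
    rw [this, Finset.card_compl_add_card]
  set P := freeVertices Finset.univ (fun u v => GreedyPartner G idG W u v ∧ PairIn N u v)
    Finset.univ with hP
  set P' := freeVertices X.support (fun u v => X.blockPartner Δ c u v ∧ PairIn N u v)
    Finset.univ with hP'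
  have hPcard : greedyCountIn G idG W N + P.card = Fintype.card V := by
    have e : P = Finset.univ.filter fun v => ¬ ∃ w, GreedyPartner G idG W v w ∧ PairIn N v w := by
      ext v
      simp [hP, freeVertices]
    rw [e, ← Finset.card_univ, ← Finset.card_filter_add_card_filter_not (s := Finset.univ)
      fun v => ∃ w, GreedyPartner G idG W v w ∧ PairIn N v w]
    congr 1
    unfold greedyCountIn
    congr 1
    ext v
    simp only [Finset.mem_filter, Finset.mem_univ, true_and]
    exact Iff.rfl
  have hP'card : ∑ b : B, greedyCountIn H idH (coinWeight Δ (X.blockCoins b c)) (X.edge b ⁻¹' N) +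
      P'.card = X.support.card := by
    have e : P' = X.support.filter fun v => ¬ ∃ w, X.blockPartner Δ c v w ∧ PairIn N v w := by
      ext v
      simp [hP', freeVertices]
    rw [e, ← Finset.card_filter_add_card_filter_not (s := X.support)
      fun v => ∃ w, X.blockPartner Δ c v w ∧ PairIn N v w]
    congr 1
    rw [Finset.card_filter, support, Finset.sum_image, ← Finset.univ_product_univ,
      Finset.sum_product]
    · refine Finset.sum_congr rfl fun b _ => ?_
      unfold greedyCountIn
      rw [Finset.card_filter]
      refine Finset.sum_congr rfl fun u _ => ?_
      refine if_congr ⟨?_, ?_⟩ rfl rfl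
      · rintro ⟨w, hw, h, hh⟩
        exact ⟨X.emb b w, ⟨b, u, w, rfl, rfl, hw⟩, X.adj_iff.2 ⟨rfl, h⟩, hh⟩
      · rintro ⟨w, ⟨b', u', v', hu, rfl, hw⟩, h, hh⟩
        obtain ⟨rfl, rfl⟩ := X.emb_inj hu
        exact ⟨v', hw, (isStable_greedyPartner H idH _).rel hw, hh⟩
    · rintro ⟨b, u⟩ _ ⟨b', u'⟩ _ h
      obtain ⟨rfl, rfl⟩ := X.emb_inj h
      rfl
  -- One multiple of the number of deleted vertices comes from the symmetric difference of the free
  -- sets, the other from the different numbers of vertices; hence the factor 2.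
  have h1 : P.card ≤ P'.card + (symmDiff P P').card := by
    calc P.card ≤ (P' ∪ symmDiff P P').card := Finset.card_le_card fun v hv => by
          simp only [Finset.mem_union, Finset.mem_symmDiff]; tauto
      _ ≤ _ := Finset.card_union_le _ _
  have h2 : P'.card ≤ P.card + (symmDiff P P').card := by
    calc P'.card ≤ (P ∪ symmDiff P P').card := Finset.card_le_card fun v hv => by
          simp only [Finset.mem_union, Finset.mem_symmDiff]; tauto
      _ ≤ _ := Finset.card_union_le _ _
  have hS := X.card_support
  rw [hS] at hsd hP'card
  have hsd' : ((symmDiff (Finset.univ : Finset V) X.support).card : ℝ) +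
      Fintype.card B * Fintype.card U = Fintype.card V := by exact_mod_cast hsd
  have hPc : (greedyCountIn G idG W N : ℝ) + P.card = Fintype.card V := by exact_mod_cast hPcard
  have hPc' : (∑ b : B,
      (greedyCountIn H idH (coinWeight Δ (X.blockCoins b c)) (X.edge b ⁻¹' N) : ℝ)) + P'.card =
        Fintype.card B * Fintype.card U := by exact_mod_cast hP'card
  have h1' : (P.card : ℝ) ≤ P'.card + (symmDiff (Finset.univ : Finset V) X.support).card := by
    exact_mod_cast h1.trans (Nat.add_le_add_left hle _)
  have h2' : (P'.card : ℝ) ≤ P.card + (symmDiff (Finset.univ : Finset V) X.support).card := by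
    exact_mod_cast h2.trans (Nat.add_le_add_left hle _)
  rw [abs_le]
  constructor <;> linarith

/-- The block estimate is applied to all edges and to the heavy ones; the factors 2 and 2Δ are
halved in the formula for the value. -/
theorem greedyValue_block {Δ : ℝ} (hΔ : 0 < Δ) (c : G.edgeSet → Fin 2) :
    |greedyValue G idG (coinWeight Δ c) -
      ∑ b : B, greedyValue H idH (coinWeight Δ (X.blockCoins b c))| ≤
      (1 + Δ) * (Fintype.card V - Fintype.card B * Fintype.card U) := by
  have h1 := X.greedyCountIn_block Δ c Set.univ fun _ _ _ _ => Set.mem_univ _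
  have h2 := X.greedyCountIn_block Δ c {e | c e = 1} fun e he f hf => by
    by_contra hne
    have he' : c e = 1 := he
    have hne' : ¬ c f = 1 := hne
    rw [coinWeight_eq, coinWeight_eq, if_pos he', if_neg hne'] at hf
    linarith
  simp only [Set.preimage_univ, greedyCountIn_univ] at h1
  have e : ∀ b, X.edge b ⁻¹' {e | c e = 1} = {e | X.blockCoins b c e = 1} := fun b => rfl
  simp only [e] at h2
  simp only [greedyValue_coinWeight]
  rw [← Finset.sum_div, Finset.sum_add_distrib, ← Finset.mul_sum, abs_le]
  rw [abs_le] at h1 h2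
  have h3 := mul_le_mul_of_nonneg_left h2.1 hΔ.le
  have h4 := mul_le_mul_of_nonneg_left h2.2 hΔ.le
  constructor <;> linarith [h1.1, h1.2]

theorem coinWeight_le {E : Type*} {Δ : ℝ} (hΔ : 0 < Δ) (c : E → Fin 2) (e : E) :
    coinWeight Δ c e ≤ 1 + Δ := by
  rw [coinWeight_eq]
  split_ifs <;> linarith

open Classical in
theorem sum_edge (f : G.edgeSet → ℝ) : ∑ b : B, ∑ e : H.edgeSet, f (X.edge b e) =
    ∑ e : G.edgeSet, if ∃ b e', X.edge b e' = e then f e else 0 := by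
  rw [← Fintype.sum_prod_type' fun b e => f (X.edge b e)]
  refine Fintype.sum_of_injective (fun p : B × H.edgeSet => X.edge p.1 p.2) X.edge_injective _ _
    (fun e he => if_neg ?_) fun p => (if_pos ⟨p.1, p.2, rfl⟩).symm
  rintro ⟨b, e', h⟩
  exact he ⟨(b, e'), h⟩

/-- Optimal matchings of the blocks together form a matching of the large graph. -/
theorem sum_optimalValue_le (Δ : ℝ) (c : G.edgeSet → Fin 2) :
    ∑ b : B, optimalValue H (coinWeight Δ (X.blockCoins b c)) ≤
      optimalValue G (coinWeight Δ c) := by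
  classical
  have hatt : ∀ b, ∃ M : {M : Set H.edgeSet // IsMatching H M},
      totalWeight H (coinWeight Δ (X.blockCoins b c)) M =
        optimalValue H (coinWeight Δ (X.blockCoins b c)) := fun b =>
    haveI : Nonempty {M : Set H.edgeSet // IsMatching H M} := ⟨⟨∅, isMatching_empty H⟩⟩
    exists_eq_ciSup_of_finite
  choose M hM using hatt
  let K : Set G.edgeSet := {e | ∃ b e', e' ∈ (M b : Set H.edgeSet) ∧ X.edge b e' = e}
  have hK : IsMatching G K := by
    rintro _ ⟨b, e, he, rfl⟩ _ ⟨b', f, hf, rfl⟩ v hv hv'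
    obtain ⟨u, hu, rfl⟩ := X.mem_edge hv
    obtain ⟨u', hu', h⟩ := X.mem_edge hv'
    obtain ⟨rfl, rfl⟩ := X.emb_inj h
    rw [(M b').2 e he f hf u' hu hu']
  refine le_trans (le_of_eq ?_) (le_optimalValue G _ hK)
  simp only [← hM]
  unfold totalWeight
  have h := X.sum_edge fun e => if e ∈ K then coinWeight Δ c e else 0
  have hmem : ∀ b e, X.edge b e ∈ K ↔ e ∈ (M b : Set H.edgeSet) := by
    intro b e
    constructor
    · rintro ⟨b', e', he, h⟩
      have := X.edge_injective (a₁ := (b', e')) (a₂ := (b, e)) h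
      simp only [Prod.mk.injEq] at this
      obtain ⟨rfl, rfl⟩ := this
      exact he
    · exact fun he => ⟨b, e, he, rfl⟩
  simp only [hmem] at h
  refine Eq.trans ?_ (h.trans ?_)
  · rfl
  · refine Finset.sum_congr rfl fun e _ => ?_
    split_ifs with h1 h2 h2
    · rfl
    · rfl
    · obtain ⟨b, e', -, h3⟩ := h2
      exact absurd ⟨b, e', h3⟩ h1
    · rfl

/-- A matching of the large graph restricts to each block. Its other edges each use a vertex outside
the blocks, no two the same one, and weigh at most `1 + Δ`. -/
theorem optimalValue_le_block {Δ : ℝ} (hΔ : 0 < Δ) (c : G.edgeSet → Fin 2) :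
    optimalValue G (coinWeight Δ c) ≤
      ∑ b : B, optimalValue H (coinWeight Δ (X.blockCoins b c)) +
        (1 + Δ) * (Fintype.card V - Fintype.card B * Fintype.card U) := by
  classical
  refine optimalValue_le G fun M hM => ?_
  have hblock : ∀ b, IsMatching H (X.edge b ⁻¹' M) := by
    intro b e he f hf u hu hu'
    have h := hM _ he _ hf (X.emb b u) (X.emb_mem_edge hu) (X.emb_mem_edge hu')
    have := X.edge_injective (a₁ := (b, e)) (a₂ := (b, f)) h
    simpa using this
  have h1 : ∑ b : B, totalWeight H (coinWeight Δ (X.blockCoins b c)) (X.edge b ⁻¹' M) ≤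
      ∑ b : B, optimalValue H (coinWeight Δ (X.blockCoins b c)) :=
    Finset.sum_le_sum fun b _ => le_optimalValue H _ (hblock b)
  have h2 : ∑ b : B, totalWeight H (coinWeight Δ (X.blockCoins b c)) (X.edge b ⁻¹' M) =
      ∑ e : G.edgeSet, if ∃ b e', X.edge b e' = e then
        (if e ∈ M then coinWeight Δ c e else 0) else 0 :=
    X.sum_edge fun e => if e ∈ M then coinWeight Δ c e else 0
  have hout : ∀ e : G.edgeSet, (if e ∈ M then coinWeight Δ c e else 0) ≤
      (if ∃ b e', X.edge b e' = e then (if e ∈ M then coinWeight Δ c e else 0) else 0) +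
        (1 + Δ) * ∑ v ∈ X.supportᶜ, if e ∈ M ∧ v ∈ (e : Sym2 V) then (1 : ℝ) else 0 := by
    intro e
    have hnn : (0 : ℝ) ≤ ∑ v ∈ X.supportᶜ, if e ∈ M ∧ v ∈ (e : Sym2 V) then (1 : ℝ) else 0 :=
      Finset.sum_nonneg fun v _ => by split_ifs <;> norm_num
    by_cases hin : ∃ b e', X.edge b e' = e
    · rw [if_pos hin]
      have := mul_nonneg (by linarith : (0 : ℝ) ≤ 1 + Δ) hnn
      linarith
    · rw [if_neg hin, zero_add]
      by_cases he : e ∈ M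
      · rw [if_pos he]
        have : ∃ v ∈ (e : Sym2 V), v ∉ X.support := by
          by_contra! hcon
          exact hin (X.exists_edge fun v hv => X.mem_support.1 (hcon v hv))
        obtain ⟨v, hv, hvS⟩ := this
        have h1 : (1 : ℝ) ≤ ∑ v ∈ X.supportᶜ, if e ∈ M ∧ v ∈ (e : Sym2 V) then (1 : ℝ) else 0 := by
          have := Finset.single_le_sum
            (f := fun v => if e ∈ M ∧ v ∈ (e : Sym2 V) then (1 : ℝ) else 0)
            (fun v _ => by split_ifs <;> norm_num) (Finset.mem_compl.2 hvS)
          rwa [if_pos ⟨he, hv⟩] at this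
        have h2 := mul_le_mul_of_nonneg_left h1 (by linarith : (0 : ℝ) ≤ 1 + Δ)
        linarith [coinWeight_le hΔ c e]
      · rw [if_neg he]
        exact mul_nonneg (by linarith) hnn
  have hcount : ∑ e : G.edgeSet, ∑ v ∈ X.supportᶜ,
      (if e ∈ M ∧ v ∈ (e : Sym2 V) then (1 : ℝ) else 0) ≤
        Fintype.card V - Fintype.card B * Fintype.card U := by
    rw [Finset.sum_comm]
    have h1 : ∀ v ∈ X.supportᶜ,
        (∑ e : G.edgeSet, if e ∈ M ∧ v ∈ (e : Sym2 V) then (1 : ℝ) else 0) ≤ 1 := by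
      intro v _
      rw [Finset.sum_boole]
      have : (Finset.univ.filter fun e : G.edgeSet => e ∈ M ∧ v ∈ (e : Sym2 V)).card ≤ 1 := by
        rw [Finset.card_le_one]
        intro e he f hf
        simp only [Finset.mem_filter, Finset.mem_univ, true_and] at he hf
        exact hM e he.1 f hf.1 v he.2 hf.2
      exact_mod_cast this
    refine (Finset.sum_le_sum h1).trans (le_of_eq ?_)
    rw [Finset.sum_const, nsmul_eq_mul, mul_one, eq_sub_iff_add_eq]
    have := Finset.card_compl_add_card X.support
    rw [X.card_support] at this
    exact_mod_cast this
  calc totalWeight G (coinWeight Δ c) M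
      = ∑ e : G.edgeSet, if e ∈ M then coinWeight Δ c e else 0 := rfl
    _ ≤ ∑ e : G.edgeSet, ((if ∃ b e', X.edge b e' = e then
          (if e ∈ M then coinWeight Δ c e else 0) else 0) +
        (1 + Δ) * ∑ v ∈ X.supportᶜ, if e ∈ M ∧ v ∈ (e : Sym2 V) then (1 : ℝ) else 0) :=
        Finset.sum_le_sum fun e _ => hout e
    _ ≤ _ := by
        rw [Finset.sum_add_distrib, ← Finset.mul_sum, ← h2]
        have := mul_le_mul_of_nonneg_left hcount (by linarith : (0 : ℝ) ≤ 1 + Δ)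
        linarith

end BlockSystem

/-! ### Existence of the limit and the final bounds -/

section Limit

theorem mul_add_inj {q a a' u u' : ℕ} (h : q * a + u = q * a' + u') (hu : u < q)
    (hu' : u' < q) : a = a' ∧ u = u' := by
  have hq : 0 < q := by omega
  have h1 := congrArg (· / q) h
  simp only [Nat.mul_add_div hq, Nat.div_eq_of_lt hu, Nat.div_eq_of_lt hu', add_zero] at h1
  subst h1
  omega

/-- The disjoint blocks of size `m` in the grid of size `n`, separated by lines of width one. -/
def gridBlocks {m k n : ℕ} (h : (m + 1) * k ≤ n) :
    BlockSystem (grid m) (gridIndex m) (grid n) (gridIndex n) (Fin k × Fin k) where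
  emb b u := (⟨(m + 1) * b.1 + u.1, by
      have h1 : (m + 1) * ((b.1 : ℕ) + 1) ≤ (m + 1) * k := Nat.mul_le_mul_left _ b.1.2
      have h2 := u.1.2
      rw [mul_add] at h1
      omega⟩, ⟨(m + 1) * b.2 + u.2, by
      have h1 : (m + 1) * ((b.2 : ℕ) + 1) ≤ (m + 1) * k := Nat.mul_le_mul_left _ b.2.2
      have h2 := u.2.2
      rw [mul_add] at h1
      omega⟩)
  emb_inj := by
    rintro ⟨a, b⟩ ⟨a', b'⟩ ⟨u, v⟩ ⟨u', v'⟩ h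
    simp only [Prod.mk.injEq, Fin.mk.injEq] at h
    obtain ⟨h1, h2⟩ := h
    obtain ⟨h3, h4⟩ := mul_add_inj h1 (by omega) (by omega)
    obtain ⟨h5, h6⟩ := mul_add_inj h2 (by omega) (by omega)
    simp only [Prod.mk.injEq, Fin.ext_iff]
    exact ⟨⟨h3, h5⟩, h4, h6⟩
  adj_iff := by
    rintro ⟨a, b⟩ ⟨a', b'⟩ ⟨u, v⟩ ⟨u', v'⟩
    simp only [grid_adj_iff, Prod.mk.injEq, Fin.ext_iff]
    constructor
    · rintro (⟨h1, h2⟩ | ⟨h1, h2⟩)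
      · obtain ⟨h3, h4⟩ := mul_add_inj h1 (by omega) (by omega)
        rcases h2 with h2 | h2
        · obtain ⟨h5, h6⟩ := mul_add_inj (u := v + 1) (by omega) (by omega) (by omega)
          omega
        · obtain ⟨h5, h6⟩ := mul_add_inj (u := v' + 1) (by omega) (by omega) (by omega)
          omega
      · obtain ⟨h3, h4⟩ := mul_add_inj h1 (by omega) (by omega)
        rcases h2 with h2 | h2
        · obtain ⟨h5, h6⟩ := mul_add_inj (u := u + 1) (by omega) (by omega) (by omega)
          omega
        · obtain ⟨h5, h6⟩ := mul_add_inj (u := u' + 1) (by omega) (by omega) (by omega)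
          omega
    · rintro ⟨⟨h1, h2⟩, h3⟩
      rw [h1, h2]
      omega
  idx_lt_iff := by
    rintro ⟨a, b⟩ ⟨u, v⟩ ⟨u', v'⟩
    simp only [gridIndex_lt_iff, CellLT, cell]
    omega

/-- A nonnegative function on the naturals that is almost additive over square blocks has a density. -/
theorem exists_tendsto_div_sq {F : ℕ → ℝ} {C : ℝ} (h0 : ∀ n, 0 ≤ F n) (hC : ∀ n, F n ≤ C * n ^ 2)
    (hF : ∀ m k n : ℕ, (m + 1) * k ≤ n →
      |F n - k ^ 2 * F m| ≤ C * ((n : ℝ) ^ 2 - k ^ 2 * m ^ 2)) :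
    ∃ L, Tendsto (fun n => F n / (n : ℝ) ^ 2) atTop (𝓝 L) := by
  have hC0 : 0 ≤ C := by simpa using (h0 1).trans (hC 1)
  have key : ∀ m n : ℕ, 0 < m → (m + 1) ^ 2 ≤ n →
      |F n / (n : ℝ) ^ 2 - F m / (m : ℝ) ^ 2| ≤ 8 * C / (m + 1) := by
    intro m n hm hn
    set k := n / (m + 1) with hk
    have h1 : (m + 1) * k ≤ n := Nat.mul_div_le _ _
    have h2 : n < (m + 1) * (k + 1) := Nat.lt_mul_div_succ n (Nat.succ_pos m)
    have h1' : ((m : ℝ) + 1) * k ≤ n := by exact_mod_cast h1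
    have h2' : (n : ℝ) < (m + 1) * (k + 1) := by exact_mod_cast h2
    have hn' : ((m : ℝ) + 1) ^ 2 ≤ n := by exact_mod_cast hn
    have hm' : (0 : ℝ) < m := by exact_mod_cast hm
    have hn0 : (0 : ℝ) < n := lt_of_lt_of_le (by positivity) hn'
    have hk0 : (0 : ℝ) ≤ k := Nat.cast_nonneg k
    -- The difference is at most `k + (m + 1)`, and both summands are at most `n / (m + 1)`; for the
    -- second this uses `(m + 1) ^ 2 ≤ n`.
    have hd : (n : ℝ) - k * m ≤ 2 * n / (m + 1) := by
      rw [le_div_iff₀ (by positivity)]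
      nlinarith
    have hnm : (k : ℝ) * m ≤ n := by nlinarith
    have hsq : (n : ℝ) ^ 2 - k ^ 2 * m ^ 2 ≤ 4 * n ^ 2 / (m + 1) := by
      calc (n : ℝ) ^ 2 - k ^ 2 * m ^ 2 = (n - k * m) * (n + k * m) := by ring
        _ ≤ (2 * n / (m + 1)) * (2 * n) := by
          apply mul_le_mul hd (by linarith) (by positivity) (by positivity)
        _ = _ := by ring
    have hb := hF m k n h1
    have hFm : F m / (m : ℝ) ^ 2 ≤ C := by
      rw [div_le_iff₀ (by positivity)]
      exact hC m
    have hFm0 : 0 ≤ F m / (m : ℝ) ^ 2 := div_nonneg (h0 m) (by positivity)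
    have e : F n / (n : ℝ) ^ 2 - F m / (m : ℝ) ^ 2 =
        ((F n - k ^ 2 * F m) - F m / (m : ℝ) ^ 2 * (n ^ 2 - k ^ 2 * m ^ 2)) / (n : ℝ) ^ 2 := by
      field_simp
      ring
    have hnn : (0 : ℝ) ≤ (n : ℝ) ^ 2 - k ^ 2 * m ^ 2 := by
      have := mul_self_le_mul_self (by positivity) hnm
      nlinarith
    rw [e, abs_div, abs_of_pos (by positivity : (0 : ℝ) < (n : ℝ) ^ 2), div_le_iff₀ (by positivity)]
    have h3 : F m / (m : ℝ) ^ 2 * (n ^ 2 - k ^ 2 * m ^ 2) ≤ C * ((n : ℝ) ^ 2 - k ^ 2 * m ^ 2) :=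
      mul_le_mul_of_nonneg_right hFm hnn
    have h4 := mul_nonneg hFm0 hnn
    calc |F n - k ^ 2 * F m - F m / (m : ℝ) ^ 2 * (n ^ 2 - k ^ 2 * m ^ 2)|
        ≤ |F n - k ^ 2 * F m| + |F m / (m : ℝ) ^ 2 * (n ^ 2 - k ^ 2 * m ^ 2)| := abs_sub _ _
      _ ≤ C * ((n : ℝ) ^ 2 - k ^ 2 * m ^ 2) + C * ((n : ℝ) ^ 2 - k ^ 2 * m ^ 2) := by
        rw [abs_of_nonneg h4]
        exact add_le_add hb h3
      _ ≤ C * (4 * n ^ 2 / (m + 1)) + C * (4 * n ^ 2 / (m + 1)) := by gcongr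
      _ = _ := by ring
  refine cauchySeq_tendsto_of_complete (Metric.cauchySeq_iff.2 fun ε hε => ?_)
  -- Two comparisons with the same block size `m + 1` are made, each costing less than `ε / 2`.
  obtain ⟨m, hm⟩ := exists_nat_gt (16 * C / ε)
  have hm1 : 8 * C / ((m + 1 : ℕ) + 1) < ε / 2 := by
    rw [div_lt_iff₀ (by positivity)]
    rw [div_lt_iff₀ hε] at hm
    push_cast
    nlinarith
  refine ⟨(m + 1 + 1) ^ 2, fun a ha b hb => ?_⟩
  have h1 := key (m + 1) a m.succ_pos ha
  have h2 := key (m + 1) b m.succ_pos hb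
  rw [Real.dist_eq]
  rw [abs_le] at h1 h2
  rw [abs_lt]
  constructor <;> linarith [h1.1, h1.2, h2.1, h2.2]

open Classical in
/-- The mean weight of the greedy matching of the grid. -/
def meanGreedy (Δ : ℝ) (n : ℕ) : ℝ :=
  coinMean fun c => greedyValue (grid n) (gridIndex n) (coinWeight Δ c)

open Classical in
/-- The mean weight of the optimal matching of the grid. -/
def meanOptimal (Δ : ℝ) (n : ℕ) : ℝ := coinMean fun c => optimalValue (grid n) (coinWeight Δ c)

variable {Δ : ℝ}

theorem gridRatio_eq (Δ : ℝ) (n : ℕ) : gridRatio Δ n = meanGreedy Δ n / meanOptimal Δ n := by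
  rw [gridRatio, performanceRatio_eq, meanGreedy, meanOptimal]
  congr!

theorem meanGreedy_le_meanOptimal (Δ : ℝ) (n : ℕ) : meanGreedy Δ n ≤ meanOptimal Δ n := by
  classical
  exact coinMean_mono fun _ => le_optimalValue _ _ (isMatching_greedyMatching _ _ _)

theorem meanGreedy_nonneg (hΔ : 0 < Δ) (n : ℕ) : 0 ≤ meanGreedy Δ n := by
  classical
  rw [← coinMean_const (E := (grid n).edgeSet) 0]
  refine coinMean_mono fun c => ?_
  rw [greedyValue_coinWeight]
  positivity

theorem meanOptimal_le (hΔ : 0 < Δ) (n : ℕ) : meanOptimal Δ n ≤ (n : ℝ) ^ 2 / 2 * (1 + 15 / 16 * Δ) := by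
  classical
  exact coinMean_optimalValue_le hΔ

theorem le_meanGreedy (hΔ : 0 < Δ) (n : ℕ) :
    (0.9213 + 0.6967 * Δ) / 2 * (n : ℝ) ^ 2 - 500 * (1 + Δ) * n ≤ meanGreedy Δ n := by
  classical
  have h1 := le_coinMean_greedyCount (n := n) hΔ
  have h2 := le_coinMean_greedyCountIn (n := n) hΔ
  have h3 : meanGreedy Δ n = 1 / 2 * ((coinMean fun c : (grid n).edgeSet → Fin 2 =>
      (greedyCount (grid n) (gridIndex n) (coinWeight Δ c) : ℝ)) + Δ * coinMean fun c =>
        (greedyCountIn (grid n) (gridIndex n) (coinWeight Δ c) {e | c e = 1} : ℝ)) := by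
    rw [← coinMean_mul Δ, ← coinMean_add, ← coinMean_mul]
    unfold meanGreedy
    simp only [greedyValue_coinWeight]
    congr 1
    funext c
    ring
  have h4 := mul_le_mul_of_nonneg_left h2 hΔ.le
  rw [h3]
  linarith

theorem abs_sub_le_of_block (hΔ : 0 < Δ) {m k n : ℕ} (h : (m + 1) * k ≤ n) :
    |meanGreedy Δ n - k ^ 2 * meanGreedy Δ m| ≤ (1 + Δ) * ((n : ℝ) ^ 2 - k ^ 2 * m ^ 2) ∧
      |meanOptimal Δ n - k ^ 2 * meanOptimal Δ m| ≤ (1 + Δ) * ((n : ℝ) ^ 2 - k ^ 2 * m ^ 2) := by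
  classical
  have e : (1 + Δ) * (Fintype.card (Fin n × Fin n) -
      Fintype.card (Fin k × Fin k) * Fintype.card (Fin m × Fin m)) =
        (1 + Δ) * ((n : ℝ) ^ 2 - k ^ 2 * m ^ 2) := by
    simp only [Fintype.card_prod, Fintype.card_fin]
    push_cast
    ring
  have e' : ((Fintype.card (Fin k × Fin k) : ℕ) : ℝ) = k ^ 2 := by
    simp only [Fintype.card_prod, Fintype.card_fin]
    push_cast
    ring
  rw [← e, ← e']
  refine ⟨(gridBlocks h).coinMean_block _ _ fun c => (gridBlocks h).greedyValue_block hΔ c,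
    (gridBlocks h).coinMean_block _ _ fun c => ?_⟩
  have h1 := (gridBlocks h).sum_optimalValue_le Δ c
  have h2 := (gridBlocks h).optimalValue_le_block hΔ c
  have h3 : (0 : ℝ) ≤ (1 + Δ) * (Fintype.card (Fin n × Fin n) -
      Fintype.card (Fin k × Fin k) * Fintype.card (Fin m × Fin m)) := by linarith
  rw [abs_le]
  constructor <;> linarith

/-- Numerator and denominator both have densities, so the ratio converges to the quotient of the
densities, and the bounds for the means pass to the limit. -/
theorem exists_tendsto_gridRatio (hΔ : 0 < Δ) : ∃ L, Tendsto (fun n => gridRatio Δ n) atTop (𝓝 L) ∧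
    gridBound Δ ≤ L := by
  have hC : ∀ n : ℕ, meanOptimal Δ n ≤ (1 + Δ) * (n : ℝ) ^ 2 := fun n => by
    have h1 := meanOptimal_le hΔ n
    have h2 : (0 : ℝ) ≤ (n : ℝ) ^ 2 := by positivity
    have h3 := mul_nonneg hΔ.le h2
    linarith
  obtain ⟨g, hg⟩ := exists_tendsto_div_sq (meanGreedy_nonneg hΔ)
    (fun n => (meanGreedy_le_meanOptimal Δ n).trans (hC n))
    fun m k n h => (abs_sub_le_of_block hΔ h).1
  obtain ⟨o, ho⟩ := exists_tendsto_div_sq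
    (fun n => (meanGreedy_nonneg hΔ n).trans (meanGreedy_le_meanOptimal Δ n)) hC
    fun m k n h => (abs_sub_le_of_block hΔ h).2
  have hinv : Tendsto (fun n : ℕ => 1 / (n : ℝ)) atTop (𝓝 0) := tendsto_one_div_atTop_nhds_zero_nat
  have hge : (0.9213 + 0.6967 * Δ) / 2 ≤ g := by
    have hlim : Tendsto (fun n : ℕ => (0.9213 + 0.6967 * Δ) / 2 - 500 * (1 + Δ) * (1 / (n : ℝ)))
        atTop (𝓝 ((0.9213 + 0.6967 * Δ) / 2 - 500 * (1 + Δ) * 0)) :=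
      tendsto_const_nhds.sub (hinv.const_mul _)
    rw [mul_zero, sub_zero] at hlim
    refine le_of_tendsto_of_tendsto hlim hg ?_
    filter_upwards [eventually_gt_atTop 0] with n hn
    have hn' : (0 : ℝ) < n := by exact_mod_cast hn
    rw [le_div_iff₀ (by positivity)]
    refine le_trans (le_of_eq ?_) (le_meanGreedy hΔ n)
    field_simp
  have hle : o ≤ (1 + 0.9375 * Δ) / 2 := by
    refine le_of_tendsto ho ?_
    filter_upwards [eventually_gt_atTop 0] with n hn
    have hn' : (0 : ℝ) < n := by exact_mod_cast hn
    rw [div_le_iff₀ (by positivity)]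
    refine (meanOptimal_le hΔ n).trans (le_of_eq ?_)
    ring
  have hgo : g ≤ o := le_of_tendsto_of_tendsto' hg ho fun n =>
    div_le_div_of_nonneg_right (meanGreedy_le_meanOptimal Δ n) (by positivity)
  -- The optimum has positive density because the greedy value, which it dominates, has.
  have hpos : 0 < o := lt_of_lt_of_le (by positivity) (hge.trans hgo)
  refine ⟨g / o, ?_, ?_⟩
  · refine (hg.div ho hpos.ne').congr' ?_
    filter_upwards [eventually_gt_atTop 0] with n hn
    have hn' : (0 : ℝ) < n := by exact_mod_cast hn
    rw [gridRatio_eq, Pi.div_apply, div_div_div_cancel_right₀ (by positivity)]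
  · unfold gridBound
    rw [div_le_div_iff₀ (by positivity) hpos]
    have h1 : 0 ≤ g := le_trans (by positivity) hge
    calc (0.9213 + 0.6967 * Δ) * o ≤ (2 * g) * ((1 + 0.9375 * Δ) / 2) :=
          mul_le_mul (by linarith) hle hpos.le (by linarith)
      _ = _ := by ring

theorem strictAntiOn_gridBound : StrictAntiOn gridBound (Set.Ioi 0) := by
  intro x hx y hy hxy
  have hx' : 0 < x := hx
  have hy' : 0 < y := hy
  unfold gridBound
  rw [div_lt_div_iff₀ (by positivity) (by positivity)]
  linarith

theorem tendsto_gridBound_zero : Tendsto gridBound (𝓝[>] 0) (𝓝 0.9213) := by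
  have h : ContinuousAt gridBound 0 := by
    unfold gridBound
    exact ContinuousAt.div (by fun_prop) (by fun_prop) (by norm_num)
  have h0 : gridBound 0 = 0.9213 := by norm_num [gridBound]
  rw [← h0]
  exact h.tendsto.mono_left nhdsWithin_le_nhds

theorem tendsto_gridBound_atTop : Tendsto gridBound atTop (𝓝 (0.6967 / 0.9375)) := by
  have h : Tendsto (fun x : ℝ => (0.9213 * x⁻¹ + 0.6967) / (x⁻¹ + 0.9375)) atTop
      (𝓝 ((0.9213 * 0 + 0.6967) / (0 + 0.9375))) :=
    ((tendsto_inv_atTop_zero.const_mul _).add_const _).div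
      (tendsto_inv_atTop_zero.add_const _) (by norm_num)
  rw [mul_zero, zero_add, zero_add] at h
  refine h.congr' ?_
  filter_upwards [eventually_gt_atTop 0] with x hx
  unfold gridBound
  field_simp

end Limit

end GreedyMatching

end

theorem mainTheorem5 :
    (∀ Δ : ℝ, 0 < Δ →
      ∃ L : ℝ, Tendsto (fun n : ℕ => GreedyMatching.gridRatio Δ n) atTop (𝓝 L) ∧
        GreedyMatching.gridBound Δ ≤ L) ∧
    StrictAntiOn GreedyMatching.gridBound (Set.Ioi 0) ∧
    (∃ b₀ : ℝ, Tendsto GreedyMatching.gridBound (𝓝[>] 0) (𝓝 b₀) ∧ |b₀ - 0.921| ≤ 0.0005) ∧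
    (∃ b₁ : ℝ, Tendsto GreedyMatching.gridBound atTop (𝓝 b₁) ∧ |b₁ - 0.743| ≤ 0.0005) := by
  refine ⟨fun Δ hΔ => GreedyMatching.exists_tendsto_gridRatio hΔ,
    GreedyMatching.strictAntiOn_gridBound,
    ⟨_, GreedyMatching.tendsto_gridBound_zero, ?_⟩, ⟨_, GreedyMatching.tendsto_gridBound_atTop, ?_⟩⟩
  · rw [abs_le]
    norm_num
  · rw [abs_le]
    norm_num
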